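/- Let $p\ge 1$, $\sigma>0$, and let $\nu$ be a probability law on $\mathbb R$ with mean $0$ and variance $\sigma^2$. *Parameter region.* Let $\tilde\Lambda_p$ be the set of $\beta=(\beta_1,\dots,\beta_p)^T\in\mathbb R^p$ such that: (1) all roots of $z^p-\beta_1z^{p-1}-\dots-\beta_p$ lie inside or on the unit circle; (2) the linear system $Y_i=\sum_{m=1}^p\beta_m Y_{|i-m|}$, $1\le i\le p-1$, with $Y_0=1$, has exactly one solution $(Y_1,\dots,Y_{p-1})$; (3) for this solution the Toeplitz matrix $(Y_{|i-j|})_{1\le i,j\le p}$ is positive definite. (It contains the stability region, where all roots lie strictly inside the unit circle. For $p=1$ it is $[-1,1]$, and for $p=2$ it also contains the unstable parameters whose two roots are $e^{\pm i\varphi}$, $0<\varphi<\pi$.) *Stream and block.* Let $K\subset\tilde\Lambda_p$ be compact. For each $\beta\in K$ let $\mathrm P_\beta$ be a probability measure, $l$ an integer-valued, possibly random, starting time, and $(X_i)$ a real stream with $$X_i=\beta_1X_{i-1}+\dots+\beta_pX_{i-p}+\varepsilon_i,\qquad i\ge l.$$ Put ${\bf z}_i=[X_{i-1},\dots,X_{i-p}]^T$.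 Under $\mathrm P_\beta$ let $\varepsilon_l,\varepsilon_{l+1},\dots$ be i.i.d. with law $\nu$, and let this sequence be independent of the starting state ${\bf z}_l$. Let the family of laws of ${\bf z}_l$ under $\mathrm P_\beta$, $\beta\in K$, be tight (for instance, let this law not depend on $\beta$). For $c>0$ define $$\tau_c=\inf\Big\{t\ge l:\ \sum_{i=l}^t\|{\bf z}_i\|^2\ge c\Big\},\quad \boldsymbol\Gamma_{\tau_c}=[{\bf z}_l\ \cdots\ {\bf z}_{\tau_c}]^T,\quad \widehat{\boldsymbol\beta}_{\tau_c}=(\boldsymbol\Gamma_{\tau_c}^T\boldsymbol\Gamma_{\tau_c})^{\dagger}\boldsymbol\Gamma_{\tau_c}^T[X_l,\dots,X_{\tau_c}]^T,$$ where $\dagger$ denotes the Moore–Penrose inverse, and let ${\bf V}_{\tau_c,\beta}=(\boldsymbol\Gamma_{\tau_c}^T\boldsymbol\Gamma_{\tau_c})^{1/2}(\widehat{\boldsymbol\beta}_{\tau_c}-\beta)$, with the symmetric positive semidefinite square root. *Claim.* Then $$\lim_{c\to\infty}\ \sup_{\beta\in K}\ \sup_{x\in\mathbb R^p}\Big|\mathrm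 P_\beta\big({\bf V}_{\tau_c,\beta}\le x\big)-\boldsymbol\Phi(x/\sigma)\Big|=0,$$ where $\le$ is meant coordinatewise and $\boldsymbol\Phi$ is the distribution function of $N(0,I_p)$. That is, ${\bf V}_{\tau_c,\beta}$ converges in distribution to $N(0,\sigma^2I_p)$ uniformly in $\beta\in K$. -/

import Mathlib

open MeasureTheory ProbabilityTheory Filter Topology

namespace SLS

noncomputable section

/-! ### The parameter region

Coordinates are indexed from `0`: `β j` is the coefficient of lag `j + 1`. -/

/-- All complex roots of the characteristic polynomial `z ^ p - β₁ z ^ (p - 1) - ⋯ - β_p` lie inside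
or on the unit circle (the series is stable or unstable, but not explosive). -/
def RootsInClosedDisc {p : ℕ} (β : EuclideanSpace ℝ (Fin p)) : Prop :=
  ∀ z : ℂ, z ^ p - ∑ j : Fin p, (β j : ℂ) * z ^ (p - 1 - (j : ℕ)) = 0 → ‖z‖ ≤ 1

/-- The sequence `Y₀ = 1, Y₁, …, Y_{p-1}` built from `Y = (Y₁, …, Y_{p-1})` (zero from `p` on; those
entries are never used below). -/
def corr {p : ℕ} (Y : Fin (p - 1) → ℝ) (k : ℕ) : ℝ :=
  if k = 0 then 1 else if h : k - 1 < p - 1 then Y ⟨k - 1, h⟩ else 0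

/-- The linear system `Y_i = ∑_{m=1}^p β_m Y_{|i-m|}`, `1 ≤ i ≤ p - 1`, with `Y₀ = 1`, in the
unknowns `Y₁, …, Y_{p-1}`. -/
def SolvesYuleWalker {p : ℕ} (β : EuclideanSpace ℝ (Fin p)) (Y : Fin (p - 1) → ℝ) : Prop :=
  ∀ i : ℕ, 1 ≤ i → i ≤ p - 1 →
    corr Y i = ∑ m : Fin p, β m * corr Y ((i : ℤ) - ((m : ℤ) + 1)).natAbs

/-- The `p × p` symmetric Toeplitz matrix `(Y_{|i-j|})` with unit diagonal. -/
def corrMatrix {p : ℕ} (Y : Fin (p - 1) → ℝ) : Matrix (Fin p) (Fin p) ℝ :=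
  Matrix.of fun i j => corr Y ((i : ℤ) - (j : ℤ)).natAbs

/-- The region `Λ̃_p`: the roots of the characteristic polynomial lie in the closed unit disc, the
system `SolvesYuleWalker` has exactly one solution, and the Toeplitz matrix of that solution is
positive definite. -/
def region (p : ℕ) : Set (EuclideanSpace ℝ (Fin p)) :=
  {β | RootsInClosedDisc β ∧
    (∃! Y : Fin (p - 1) → ℝ, SolvesYuleWalker β Y) ∧
    (∀ Y : Fin (p - 1) → ℝ, SolvesYuleWalker β Y → (corrMatrix Y).PosDef)}

/-! ### The block and the least squares estimator, for one path `x : ℤ → ℝ` of the stream -/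

/-- The state `z_i = (x_{i-1}, …, x_{i-p})`. -/
def lagVector (p : ℕ) (x : ℤ → ℝ) (i : ℤ) : EuclideanSpace ℝ (Fin p) :=
  WithLp.toLp 2 fun j => x (i - 1 - (j : ℤ))

/-- The stopping rule `τ_c = inf {t ≥ l : ∑_{i=l}^t ‖z_i‖² ≥ c}` of the block that starts at
time `l`. -/
def stopTime (p : ℕ) (x : ℤ → ℝ) (l : ℤ) (c : ℝ) : ℤ :=
  sInf {t : ℤ | l ≤ t ∧ c ≤ ∑ i ∈ Finset.Icc l t, ‖lagVector p x i‖ ^ 2}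

/-- The design matrix `Γ` with rows `z_l, …, z_t`. -/
def design (p : ℕ) (x : ℤ → ℝ) (l t : ℤ) : Matrix (Finset.Icc l t) (Fin p) ℝ :=
  Matrix.of fun i j => lagVector p x i j

/-- The observations `(x_l, …, x_t)`. -/
def response (x : ℤ → ℝ) (l t : ℤ) : Finset.Icc l t → ℝ := fun i => x i

/-- The Moore–Penrose inverse of a real symmetric matrix: nonzero eigenvalues are inverted, zero
eigenvalues are kept (`0⁻¹ = 0`). -/
def pinv {p : ℕ} (A : Matrix (Fin p) (Fin p) ℝ) : Matrix (Fin p) (Fin p) ℝ :=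
  cfc (fun s : ℝ => s⁻¹) A

/-- The symmetric positive semidefinite square root of a positive semidefinite matrix. -/
def msqrt {p : ℕ} (A : Matrix (Fin p) (Fin p) ℝ) : Matrix (Fin p) (Fin p) ℝ :=
  cfc Real.sqrt A

/-- The least squares estimator `(ΓᵀΓ)† Γᵀ (x_l, …, x_t)ᵀ`. -/
def lsEstimate (p : ℕ) (x : ℤ → ℝ) (l t : ℤ) : EuclideanSpace ℝ (Fin p) :=
  WithLp.toLp 2 (Matrix.mulVec (pinv ((design p x l t).transpose * design p x l t))
    (Matrix.mulVec (design p x l t).transpose (response x l t)))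

/-- `V_{τ_c, β} = (ΓᵀΓ)^{1/2} (β̂_{τ_c} - β)` with `Γ = Γ_{τ_c}`. -/
def normalizedError {p : ℕ} (β : EuclideanSpace ℝ (Fin p)) (x : ℤ → ℝ) (l : ℤ) (c : ℝ) :
    EuclideanSpace ℝ (Fin p) :=
  WithLp.toLp 2 (Matrix.mulVec
    (msqrt ((design p x l (stopTime p x l c)).transpose * design p x l (stopTime p x l c)))
    (fun j => lsEstimate p x l (stopTime p x l c) j - β j))

/-! ### Distribution functions -/

/-- The joint distribution function of a random vector `V` under `P`. -/
def jointCDF {Ω : Type*} [MeasurableSpace Ω] {p : ℕ} (P : Measure Ω)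
    (V : Ω → EuclideanSpace ℝ (Fin p)) (x : EuclideanSpace ℝ (Fin p)) : ℝ :=
  P.real {ω | ∀ j, V ω j ≤ x j}

/-- The distribution function of `N(0, I_p)`. -/
def stdNormalCDF {p : ℕ} (x : EuclideanSpace ℝ (Fin p)) : ℝ :=
  jointCDF (stdGaussian (EuclideanSpace ℝ (Fin p))) id x

/-! ### The stream -/

/-- Under `P`, the real stream `X` follows the AR(p) model with coefficients `β` and innovations `ε`
from the (possibly random) starting time `l` on; the innovations `ε_l, ε_{l+1}, …` are i.i.d. with
law `ν`, and this sequence is independent of the starting state `z_l`. -/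
structure IsARStream {Ω : Type*} [MeasurableSpace Ω] {p : ℕ} (P : Measure Ω)
    (β : EuclideanSpace ℝ (Fin p)) (ν : Measure ℝ) (X ε : ℤ → Ω → ℝ) (l : Ω → ℤ) : Prop where
  measurable_X : ∀ i, Measurable (X i)
  measurable_ε : ∀ i, Measurable (ε i)
  measurable_l : Measurable l
  model : ∀ᵐ ω ∂P, ∀ i : ℤ, l ω ≤ i →
    X i ω = ∑ j : Fin p, β j * X (i - 1 - (j : ℤ)) ω + ε i ω
  law : ∀ k : ℕ, P.map (fun ω => ε (l ω + k) ω) = ν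
  indep : iIndepFun (fun (k : ℕ) ω => ε (l ω + k) ω) P
  indep_start : IndepFun (fun ω (k : ℕ) => ε (l ω + k) ω)
    (fun ω => lagVector p (fun i => X i ω) (l ω)) P

end

end SLS

/-! Rescale one block by √c. Write y_k = z_k/√c for its states, H = Σ y_k y_kᵀ and v = Σ ε_k y_k.
Then the normalised error equals H^{-1/2} v (`IsHit.normalizedError_eq`), so the theorem follows
once H tends in probability to a nonrandom positive definite S and v is asymptotically N(0, σ²S).

Limit of H. The stopping rule drives tr H to 1. Each state is a shift of the previous one with a
single new coordinate β·z_k + ε_k. Summing over the block, H is therefore Toeplitz up to boundary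
terms of order ‖z‖²/c, and its first row satisfies the Yule–Walker equations up to these terms and
v/√c (`IsHit.stein_approx`). The (0,0) equation, which would involve Σ ε_k²/c, is never used; the
trace normalisation replaces it. Hence stable and unstable parameters need no separate treatment.
Conditions (2) and (3) of the region provide a unique limit solution S of trace one, and it is
positive definite; compactness turns uniqueness into stability (`exists_forall_stein_close`).

Small states. Roots in the closed disc make S₀₀ - βᵀSβ nonnegative, so the form of S does not grow
under the transposed companion matrix (`quad_backShift`, `quad_le_of_rootsInClosedDisc`). This
bounds paths locally uniformly in β (`exists_forall_norm_path_le`). If the start and the innovations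
are o(√c), a state of order √c would force many predecessors of that order, exceeding the energy c
(`exists_forall_norm_sq_le`). The energy dominates Σ ε_k² up to a constant, so the block has O(c)
steps, and finite variance makes the largest innovation o(√c) over that horizon.

Central limit theorem. For predictable weights w that are uniformly small with Σ w² → const, exp(i Σ
w ε + σ²/2 Σ w²) has mean close to 1, by conditioning one step at a time
(`tendsto_integral_exp_sum`).

Uniformity. A failure would yield c_n → ∞ and β_n ∈ K, along a subsequence β_n → β₀ ∈ K. The whole
argument therefore runs along such sequences, with the probability measure changing with n. The
Lévy–Prokhorov distance handles all orthants at once, since the normal distribution function is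
Lipschitz under shifts (`eventually_forall_abs_jointCDF_sub_le`). -/

namespace SLS

noncomputable section

/-! ### Innovations along a filtration -/

/-- `ξ₀, ξ₁, …` have law `ν`, and `ξ k` is independent of the past `F k`, with respect to which
`ξ₀, …, ξ_{k-1}` are measurable. -/
structure IsInnovation {Ω : Type*} {m : MeasurableSpace Ω} (P : Measure Ω) (ν : Measure ℝ)
    (F : Filtration ℕ m) (ξ : ℕ → Ω → ℝ) : Prop where
  measurable_succ : ∀ k, Measurable[F (k + 1)] (ξ k)
  law : ∀ k, P.map (ξ k) = ν
  indep : ∀ k, Indep (F k) (MeasurableSpace.comap (ξ k) inferInstance) P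

namespace IsInnovation

variable {Ω : Type*} {m : MeasurableSpace Ω} {P : Measure Ω} {ν : Measure ℝ}
  {F : Filtration ℕ m} {ξ : ℕ → Ω → ℝ}

lemma measurable (h : IsInnovation P ν F ξ) (k : ℕ) : Measurable (ξ k) :=
  (h.measurable_succ k).mono (F.le _) le_rfl

/-- Integrate out the innovation `ξ k`, with the past frozen. -/
lemma integral_comp [IsProbabilityMeasure P] [IsProbabilityMeasure ν] (h : IsInnovation P ν F ξ)
    (k : ℕ) {α E : Type*} [MeasurableSpace α] [NormedAddCommGroup E] [NormedSpace ℝ E]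
    {U : Ω → α} (hU : Measurable[F k] U) {g : α × ℝ → E} (hg : StronglyMeasurable g)
    (hi : Integrable (fun ω => g (U ω, ξ k ω)) P) :
    ∫ ω, g (U ω, ξ k ω) ∂P = ∫ ω, (∫ y, g (U ω, y) ∂ν) ∂P := by
  have hUm : Measurable U := hU.mono (F.le _) le_rfl
  have hind : IndepFun U (ξ k) P := indep_of_indep_of_le_left (h.indep k) hU.comap_le
  have hmap := (indepFun_iff_map_prod_eq_prod_map_map hUm.aemeasurable
    (h.measurable k).aemeasurable).1 hind
  rw [h.law k] at hmap
  have hpair : Measurable fun ω => (U ω, ξ k ω) := hUm.prodMk (h.measurable k)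
  have hprob : IsProbabilityMeasure (P.map U) := Measure.isProbabilityMeasure_map hUm.aemeasurable
  have hi' : Integrable g ((P.map U).prod ν) := by
    rw [← hmap]
    exact (integrable_map_measure hg.aestronglyMeasurable hpair.aemeasurable).2 hi
  have h1 : ∫ ω, g (U ω, ξ k ω) ∂P = ∫ x, g x ∂((P.map U).prod ν) := by
    rw [← hmap, integral_map hpair.aemeasurable hg.aestronglyMeasurable]
  rw [h1, integral_prod _ hi', integral_map hUm.aemeasurable]
  exact (hg.integral_prod_right').aestronglyMeasurable

lemma measurable_sum (h : IsInnovation P ν F ξ) {w : ℕ → Ω → ℝ}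
    (hw : ∀ k, Measurable[F k] (w k)) (N : ℕ) :
    Measurable[F N] fun ω => ∑ k ∈ Finset.range N, w k ω * ξ k ω := by
  refine Finset.measurable_fun_sum _ fun k hk => ?_
  have hk' : k + 1 ≤ N := Finset.mem_range.1 hk
  exact ((hw k).mono (F.mono (by omega)) le_rfl).mul
    ((h.measurable_succ k).mono (F.mono hk') le_rfl)

lemma measurable_sum_sq {w : ℕ → Ω → ℝ} (hw : ∀ k, Measurable[F k] (w k)) (N : ℕ) :
    Measurable[F N] fun ω => ∑ k ∈ Finset.range N, w k ω ^ 2 :=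
  Finset.measurable_fun_sum _ fun k hk =>
    ((hw k).mono (F.mono (Finset.mem_range.1 hk).le) le_rfl).pow_const 2

/-- If the weights are predictable and the characteristic function is close to a Gaussian one at
the weights, the exponential of the transform, compensated by its quadratic variation, has mean
close to one. -/
lemma norm_integral_exp_sub_one_le [IsProbabilityMeasure P] [IsProbabilityMeasure ν]
    (h : IsInnovation P ν F ξ) {w : ℕ → Ω → ℝ}
    (hw : ∀ k, Measurable[F k] (w k)) {L s r : ℝ} (hs : 0 ≤ s) (hr : 0 ≤ r)
    (hL : ∀ n ω, ∑ k ∈ Finset.range n, w k ω ^ 2 ≤ L)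
    (hφ : ∀ k ω, ‖charFun ν (w k ω) - Complex.exp (-(s * w k ω ^ 2 / 2 : ℝ))‖ ≤ r * w k ω ^ 2)
    (N : ℕ) :
    ‖(∫ ω, Complex.exp ((∑ k ∈ Finset.range N, w k ω * ξ k ω : ℝ) * Complex.I
      + (s / 2 * ∑ k ∈ Finset.range N, w k ω ^ 2 : ℝ)) ∂P) - 1‖
      ≤ Real.exp (s / 2 * L) * r * L := by
  set T : ℕ → Ω → ℂ := fun n ω => Complex.exp ((∑ k ∈ Finset.range n, w k ω * ξ k ω : ℝ) * Complex.I
      + (s / 2 * ∑ k ∈ Finset.range n, w k ω ^ 2 : ℝ)) with hT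
  have hTnorm : ∀ n ω, ‖T n ω‖ = Real.exp (s / 2 * ∑ k ∈ Finset.range n, w k ω ^ 2) := by
    intro n ω
    rw [hT]
    simp only [Complex.norm_exp]
    congr 1
    simp [-Complex.ofReal_sum, -Complex.ofReal_mul]
  have hTF : ∀ n, Measurable[F n] (T n) := by
    intro n
    refine Complex.measurable_exp.comp ?_
    exact ((Complex.measurable_ofReal.comp (h.measurable_sum hw n)).mul_const _).add
      (Complex.measurable_ofReal.comp ((measurable_sum_sq hw n).const_mul _))
  have hTm : ∀ n, Measurable (T n) := fun n => (hTF n).mono (F.le _) le_rfl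
  have hTb : ∀ n ω, ‖T n ω‖ ≤ Real.exp (s / 2 * L) := by
    intro n ω
    rw [hTnorm]
    have := hL n ω
    gcongr
  have hTi : ∀ n, Integrable (T n) P := fun n =>
    Integrable.of_bound (hTm n).aestronglyMeasurable _ (ae_of_all _ (hTb n))
  have hwm : ∀ k, Measurable (w k) := fun k => (hw k).mono (F.le _) le_rfl
  have hw2 : ∀ k ω, w k ω ^ 2 ≤ L := by
    intro k ω
    refine le_trans ?_ (hL (k + 1) ω)
    exact Finset.single_le_sum (f := fun k => w k ω ^ 2) (fun i _ => sq_nonneg _) (by simp)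
  have hwi : ∀ k, Integrable (fun ω => w k ω ^ 2) P := fun k =>
    Integrable.of_bound ((hwm k).pow_const 2).aestronglyMeasurable L
      (ae_of_all _ fun ω => by rw [Real.norm_of_nonneg (sq_nonneg _)]; exact hw2 k ω)
  -- Telescoping: conditionally on the past, step `n` multiplies `T n` by exp(s w²/2) times the
  -- characteristic function at w, which differs from 1 by at most exp(s w²/2) r w².
  have key : ∀ n, ‖(∫ ω, T n ω ∂P) - 1‖ ≤
      Real.exp (s / 2 * L) * r * ∫ ω, ∑ k ∈ Finset.range n, w k ω ^ 2 ∂P := by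
    intro n
    induction n with
    | zero => simp [hT]
    | succ n ih =>
      have hstep : ∀ ω, T (n + 1) ω =
          (T n ω * Complex.exp (s / 2 * w n ω ^ 2 : ℝ)) * Complex.exp (w n ω * ξ n ω * Complex.I) := by
        intro ω
        simp only [hT, Finset.sum_range_succ, ← Complex.exp_add]
        congr 1
        push_cast
        ring
      have hg : StronglyMeasurable fun x : (ℂ × ℝ) × ℝ =>
          x.1.1 * Complex.exp (x.1.2 * x.2 * Complex.I) := by
        apply Measurable.stronglyMeasurable
        fun_prop
      have hU : Measurable[F n] fun ω => (T n ω * Complex.exp (s / 2 * w n ω ^ 2 : ℝ), w n ω) := by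
        refine Measurable.prodMk ((hTF n).mul ?_) (hw n)
        exact Complex.measurable_exp.comp
          (Complex.measurable_ofReal.comp (((hw n).pow_const 2).const_mul _))
      have hInt := h.integral_comp n hU hg (by
        refine (hTi (n + 1)).congr (ae_of_all _ fun ω => ?_)
        exact hstep ω)
      have h1 : ∫ ω, T (n + 1) ω ∂P = ∫ ω, T n ω * Complex.exp (s / 2 * w n ω ^ 2 : ℝ)
          * charFun ν (w n ω) ∂P := by
        rw [integral_congr_ae (ae_of_all _ hstep)]
        refine hInt.trans (integral_congr_ae (ae_of_all _ fun ω => ?_))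
        simp only [charFun_apply_real, integral_const_mul]
      have hi2 : Integrable (fun ω => T n ω * Complex.exp (s / 2 * w n ω ^ 2 : ℝ)
          * charFun ν (w n ω)) P := by
        refine Integrable.of_bound (C := Real.exp (s / 2 * L) * Real.exp (s / 2 * L)) ?_ ?_
        · refine Measurable.aestronglyMeasurable ?_
          refine ((hTm n).mul ?_).mul (measurable_charFun.comp (hwm n))
          exact Complex.measurable_exp.comp
            (Complex.measurable_ofReal.comp (((hwm n).pow_const 2).const_mul _))
        · refine ae_of_all _ fun ω => ?_
          rw [norm_mul, norm_mul, Complex.norm_exp_ofReal]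
          have h3 := hw2 n ω
          have h4 : ‖charFun ν (w n ω)‖ ≤ 1 := norm_charFun_le_one _
          calc ‖T n ω‖ * Real.exp (s / 2 * w n ω ^ 2) * ‖charFun ν (w n ω)‖
              ≤ (Real.exp (s / 2 * L) * Real.exp (s / 2 * L)) * 1 := by
                gcongr
                exact hTb n ω
            _ = _ := mul_one _
      have h2 : ‖(∫ ω, T (n + 1) ω ∂P) - ∫ ω, T n ω ∂P‖ ≤
          Real.exp (s / 2 * L) * r * ∫ ω, w n ω ^ 2 ∂P := by
        rw [h1, ← integral_sub hi2 (hTi n), ← integral_const_mul]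
        refine norm_integral_le_of_norm_le ((hwi n).const_mul _) (ae_of_all _ fun ω => ?_)
        have e1 : T n ω * Complex.exp (s / 2 * w n ω ^ 2 : ℝ) * charFun ν (w n ω) - T n ω
            = T n ω * Complex.exp (s / 2 * w n ω ^ 2 : ℝ) *
              (charFun ν (w n ω) - Complex.exp (-(s * w n ω ^ 2 / 2 : ℝ))) := by
          rw [mul_sub, mul_assoc (T n ω) _ (Complex.exp (-_)),
            ← Complex.exp_add ((s / 2 * w n ω ^ 2 : ℝ) : ℂ)]
          have : ((s / 2 * w n ω ^ 2 : ℝ) : ℂ) + -((s * w n ω ^ 2 / 2 : ℝ) : ℂ) = 0 := by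
            push_cast; ring
          rw [this]; simp
        rw [e1, norm_mul, norm_mul, Complex.norm_exp_ofReal, hTnorm, ← Real.exp_add, mul_assoc]
        refine mul_le_mul ?_ (hφ n ω) (norm_nonneg _) (Real.exp_pos _).le
        rw [← mul_add, ← Finset.sum_range_succ (fun k => w k ω ^ 2)]
        have := hL (n + 1) ω
        gcongr
      have e3 : ∫ ω, ∑ k ∈ Finset.range (n + 1), w k ω ^ 2 ∂P =
          (∫ ω, ∑ k ∈ Finset.range n, w k ω ^ 2 ∂P) + ∫ ω, w n ω ^ 2 ∂P := by
        simp only [Finset.sum_range_succ]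
        exact integral_add (integrable_finsetSum _ fun k _ => hwi k) (hwi n)
      rw [e3, mul_add]
      calc ‖(∫ ω, T (n + 1) ω ∂P) - 1‖
          = ‖((∫ ω, T n ω ∂P) - 1) + ((∫ ω, T (n + 1) ω ∂P) - ∫ ω, T n ω ∂P)‖ := by
            congr 1; ring
        _ ≤ _ := (norm_add_le _ _).trans (add_le_add ih h2)
  refine (key N).trans ?_
  refine mul_le_mul_of_nonneg_left ?_ (by positivity)
  calc ∫ ω, ∑ k ∈ Finset.range N, w k ω ^ 2 ∂P ≤ ∫ _, L ∂P :=
        integral_mono (integrable_finsetSum _ fun k _ => hwi k) (integrable_const _) (hL N)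
    _ = L := by simp

/-- The transform of the innovations by bounded predictable weights has second moment at most
the variance times the bound on the quadratic variation. -/
lemma integral_sum_sq_le [IsProbabilityMeasure P] [IsProbabilityMeasure ν]
    (h : IsInnovation P ν F ξ) (hν : MemLp id 2 ν)
    (hmean : ∫ y, y ∂ν = 0) {s : ℝ} (hvar : ∫ y, y ^ 2 ∂ν = s) {w : ℕ → Ω → ℝ}
    (hw : ∀ k, Measurable[F k] (w k)) {L : ℝ}
    (hL : ∀ n ω, ∑ k ∈ Finset.range n, w k ω ^ 2 ≤ L) (N : ℕ) :
    Integrable (fun ω => (∑ k ∈ Finset.range N, w k ω * ξ k ω) ^ 2) P ∧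
    ∫ ω, (∑ k ∈ Finset.range N, w k ω * ξ k ω) ^ 2 ∂P ≤ s * L := by
  have hwm : ∀ k, Measurable (w k) := fun k => (hw k).mono (F.le _) le_rfl
  have hw2 : ∀ k ω, w k ω ^ 2 ≤ L := by
    intro k ω
    refine le_trans ?_ (hL (k + 1) ω)
    exact Finset.single_le_sum (f := fun k => w k ω ^ 2) (fun i _ => sq_nonneg _) (by simp)
  have hwi : ∀ k, Integrable (fun ω => w k ω ^ 2) P := fun k =>
    Integrable.of_bound ((hwm k).pow_const 2).aestronglyMeasurable L
      (ae_of_all _ fun ω => by rw [Real.norm_of_nonneg (sq_nonneg _)]; exact hw2 k ω)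
  have hξ2 : ∀ k, MemLp (ξ k) 2 P := by
    intro k
    have := (h.law k).symm ▸ hν
    exact (memLp_map_measure_iff (by fun_prop) (h.measurable k).aemeasurable).1 this
  have hwξ : ∀ k, MemLp (fun ω => w k ω * ξ k ω) 2 P := by
    intro k
    refine MemLp.of_le_mul (c := √L) (hξ2 k) ((hwm k).mul (h.measurable k)).aestronglyMeasurable
      (ae_of_all _ fun ω => ?_)
    rw [norm_mul]
    gcongr
    exact Real.abs_le_sqrt (hw2 k ω)
  have hS2 : ∀ n, MemLp (fun ω => ∑ k ∈ Finset.range n, w k ω * ξ k ω) 2 P := fun n =>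
    memLp_finsetSum _ fun k _ => hwξ k
  have hs0 : 0 ≤ s := hvar ▸ integral_nonneg fun y => sq_nonneg y
  have hy1 : Integrable (fun y : ℝ => y) ν := hν.integrable (by norm_num)
  have hy2 : Integrable (fun y : ℝ => y ^ 2) ν := hν.integrable_sq
  have key : ∀ n, ∫ ω, (∑ k ∈ Finset.range n, w k ω * ξ k ω) ^ 2 ∂P =
      s * ∫ ω, ∑ k ∈ Finset.range n, w k ω ^ 2 ∂P := by
    intro n
    induction n with
    | zero => simp
    | succ n ih =>
      have hg : StronglyMeasurable fun x : (ℝ × ℝ) × ℝ => (x.1.1 + x.1.2 * x.2) ^ 2 := by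
        apply Measurable.stronglyMeasurable
        fun_prop
      have hInt := h.integral_comp n ((h.measurable_sum hw n).prodMk (hw n)) hg (by
        refine (hS2 (n + 1)).integrable_sq.congr (ae_of_all _ fun ω => ?_)
        simp only [Finset.sum_range_succ])
      have e1 : ∀ a b : ℝ, ∫ y, (a + b * y) ^ 2 ∂ν = a ^ 2 + s * b ^ 2 := by
        intro a b
        have : ∀ y : ℝ, (a + b * y) ^ 2 = a ^ 2 + 2 * a * b * y + b ^ 2 * y ^ 2 := fun y => by ring
        simp_rw [this]
        rw [integral_add (f := fun y : ℝ => a ^ 2 + 2 * a * b * y) (g := fun y => b ^ 2 * y ^ 2)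
            ((integrable_const _).add (hy1.const_mul _)) (hy2.const_mul _),
          integral_add (integrable_const _) (hy1.const_mul _), integral_const_mul,
          integral_const_mul, hmean, hvar]
        simp
        ring
      simp only [e1] at hInt
      simp only [Finset.sum_range_succ]
      rw [hInt, integral_add (hS2 n).integrable_sq ((hwi n).const_mul _), ih,
        integral_add (integrable_finsetSum _ fun k _ => hwi k) (hwi n), integral_const_mul]
      ring
  refine ⟨(hS2 N).integrable_sq, ?_⟩
  rw [key]
  refine mul_le_mul_of_nonneg_left ?_ hs0
  calc ∫ ω, ∑ k ∈ Finset.range N, w k ω ^ 2 ∂P ≤ ∫ _, L ∂P :=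
        integral_mono (integrable_finsetSum _ fun k _ => hwi k) (integrable_const _) (hL N)
    _ = L := by simp

/-- Independence factorises the Laplace transform; this feeds a Chernoff bound for small sums of
squares. -/
lemma integral_exp_neg_sum_sq [IsProbabilityMeasure P] [IsProbabilityMeasure ν]
    (h : IsInnovation P ν F ξ) (N : ℕ) :
    ∫ ω, Real.exp (-∑ k ∈ Finset.range N, ξ k ω ^ 2) ∂P = (∫ y, Real.exp (-y ^ 2) ∂ν) ^ N := by
  induction N with
  | zero => simp
  | succ n ih =>
    have hg : StronglyMeasurable fun x : ℝ × ℝ => x.1 * Real.exp (-x.2 ^ 2) := by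
      apply Measurable.stronglyMeasurable
      fun_prop
    have hU : Measurable[F n] fun ω => Real.exp (-∑ k ∈ Finset.range n, ξ k ω ^ 2) := by
      refine Real.measurable_exp.comp (Measurable.neg (Finset.measurable_fun_sum _ fun k hk => ?_))
      exact ((h.measurable_succ k).mono (F.mono (Finset.mem_range.1 hk)) le_rfl).pow_const 2
    have hstep : ∀ ω, Real.exp (-∑ k ∈ Finset.range (n + 1), ξ k ω ^ 2) =
        Real.exp (-∑ k ∈ Finset.range n, ξ k ω ^ 2) * Real.exp (-ξ n ω ^ 2) := by
      intro ω
      rw [← Real.exp_add, Finset.sum_range_succ, neg_add]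
    have hInt := h.integral_comp n hU hg (by
      refine Integrable.of_bound (C := 1) ?_ (ae_of_all _ fun ω => ?_)
      · have := h.measurable n
        have h2 := hU.mono (F.le _) le_rfl
        exact (h2.mul (by fun_prop)).aestronglyMeasurable
      · rw [← hstep, Real.norm_of_nonneg (Real.exp_pos _).le, Real.exp_le_one_iff, neg_nonpos]
        positivity)
    simp_rw [hstep]
    rw [hInt]
    simp only [integral_const_mul, integral_mul_const, ih]
    rw [pow_succ]

end IsInnovation

/-- Lower bound, linear in the number of terms, for the sum of squares of innovations. -/
lemma exists_measure_sum_sq_lt_le.{u} {ν : Measure ℝ} [IsProbabilityMeasure ν]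
    (hν2 : Integrable (fun y : ℝ => y ^ 2) ν) (hpos : 0 < ∫ y, y ^ 2 ∂ν) :
    ∃ κ > 0, ∃ ρ : ℝ, 0 ≤ ρ ∧ ρ < 1 ∧ ∀ {Ω : Type u} {m : MeasurableSpace Ω} {P : Measure Ω}
      [IsProbabilityMeasure P] {F : Filtration ℕ m} {ξ : ℕ → Ω → ℝ}, IsInnovation P ν F ξ →
      ∀ N : ℕ, P {ω | ∑ k ∈ Finset.range N, ξ k ω ^ 2 < κ * N} ≤ ENNReal.ofReal (ρ ^ N) := by
  set a := ∫ y, Real.exp (-y ^ 2) ∂ν with ha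
  have hi : Integrable (fun y : ℝ => Real.exp (-y ^ 2)) ν :=
    Integrable.of_bound (C := 1) (by fun_prop) (ae_of_all _ fun y => by
      rw [Real.norm_of_nonneg (Real.exp_pos _).le, Real.exp_le_one_iff, neg_nonpos]
      positivity)
  have ha0 : 0 ≤ a := integral_nonneg fun y => (Real.exp_pos _).le
  -- Otherwise 1 - exp(-y²) ≥ 0 has mean zero, so y = 0 almost surely, against the positive second
  -- moment.
  have ha1 : a < 1 := by
    by_contra hcon
    have h1 : 0 ≤ᵐ[ν] fun y : ℝ => 1 - Real.exp (-y ^ 2) := ae_of_all _ fun y => by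
      simp only [Pi.zero_apply, sub_nonneg, Real.exp_le_one_iff, neg_nonpos]
      positivity
    have h2 : ∫ y, (1 - Real.exp (-y ^ 2)) ∂ν = 0 := by
      refine le_antisymm ?_ (integral_nonneg_of_ae h1)
      rw [integral_sub (integrable_const _) hi]
      simp only [integral_const, probReal_univ, smul_eq_mul, mul_one]
      linarith
    rw [integral_eq_zero_iff_of_nonneg_ae h1 ((integrable_const _).sub hi)] at h2
    have h3 : ∫ y, y ^ 2 ∂ν = 0 := by
      rw [integral_eq_zero_iff_of_nonneg (fun y => sq_nonneg y) hν2]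
      filter_upwards [h2] with y hy
      simp only [Pi.zero_apply] at hy ⊢
      have : Real.exp (-y ^ 2) = 1 := by linarith
      rw [Real.exp_eq_one_iff] at this
      linarith
    linarith
  -- Markov's inequality will give the bound exp(κN) a^N, so κ only has to keep exp(κ) a below one.
  obtain ⟨κ, hκ, hρ⟩ : ∃ κ > 0, Real.exp κ * a < 1 := by
    have : Tendsto (fun κ : ℝ => Real.exp κ * a) (𝓝[>] 0) (𝓝 (Real.exp 0 * a)) :=
      Tendsto.mono_left (Continuous.tendsto (by fun_prop) 0) nhdsWithin_le_nhds
    rw [Real.exp_zero, one_mul] at this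
    obtain ⟨κ, h1, h2⟩ := ((this.eventually_lt_const ha1).and self_mem_nhdsWithin).exists
    exact ⟨κ, h2, h1⟩
  refine ⟨κ, hκ, Real.exp κ * a, by positivity, hρ, ?_⟩
  intro Ω m P _ F ξ h N
  have hm : Measurable fun ω => ∑ k ∈ Finset.range N, ξ k ω ^ 2 :=
    Finset.measurable_fun_sum _ fun k _ => (h.measurable k).pow_const 2
  have hInt : Integrable (fun ω => Real.exp (-∑ k ∈ Finset.range N, ξ k ω ^ 2)) P :=
    Integrable.of_bound (C := 1) (Real.measurable_exp.comp hm.neg).aestronglyMeasurable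
      (ae_of_all _ fun y => by
        rw [Real.norm_of_nonneg (Real.exp_pos _).le, Real.exp_le_one_iff, neg_nonpos]
        positivity)
  have hmark := mul_meas_ge_le_integral_of_nonneg (ae_of_all _ fun ω => (Real.exp_pos _).le) hInt
    (Real.exp (-(κ * N)))
  rw [h.integral_exp_neg_sum_sq] at hmark
  refine ENNReal.le_ofReal_iff_toReal_le (measure_ne_top _ _) (by positivity) |>.2 ?_
  change P.real _ ≤ _
  calc P.real {ω | ∑ k ∈ Finset.range N, ξ k ω ^ 2 < κ * N}
      ≤ P.real {ω | Real.exp (-(κ * N)) ≤ Real.exp (-∑ k ∈ Finset.range N, ξ k ω ^ 2)} := by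
        refine measureReal_mono fun ω hω => ?_
        simp only [Set.mem_ofPred_eq] at hω ⊢
        gcongr
    _ = Real.exp (κ * N) * (Real.exp (-(κ * N)) *
          P.real {ω | Real.exp (-(κ * N)) ≤ Real.exp (-∑ k ∈ Finset.range N, ξ k ω ^ 2)}) := by
        rw [← mul_assoc, ← Real.exp_add]; simp
    _ ≤ Real.exp (κ * N) * a ^ N := by gcongr
    _ = (Real.exp κ * a) ^ N := by rw [mul_pow, ← Real.exp_nat_mul, mul_comm κ]

/-- The maximum of the innovations. -/
lemma measure_exists_lt_abs_le {Ω : Type*} {m : MeasurableSpace Ω} {P : Measure Ω}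
    {ν : Measure ℝ} {F : Filtration ℕ m} {ξ : ℕ → Ω → ℝ} (h : IsInnovation P ν F ξ)
    (N : ℕ) (t : ℝ) :
    P {ω | ∃ k < N, t < |ξ k ω|} ≤ N * ν {y | t < |y|} := by
  have hs : MeasurableSet {y : ℝ | t < |y|} := measurableSet_lt measurable_const (by fun_prop)
  have e : {ω | ∃ k < N, t < |ξ k ω|} = ⋃ k ∈ Finset.range N, ξ k ⁻¹' {y | t < |y|} := by
    ext ω; simp
  rw [e]
  refine (measure_biUnion_finset_le _ _).trans ?_
  have : ∀ k, P (ξ k ⁻¹' {y | t < |y|}) = ν {y | t < |y|} := fun k => by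
    rw [← h.law k, Measure.map_apply (h.measurable k) hs]
  simp only [this, Finset.sum_const, Finset.card_range, nsmul_eq_mul, le_refl]

/-- The truncated second moment dominates and tends to zero. This o(1), where Chebyshev gives only
O(1), makes the maximum of O(c) innovations o(√c). -/
lemma tendsto_mul_measure_lt_abs {ν : Measure ℝ} [IsProbabilityMeasure ν]
    (hν2 : Integrable (fun y : ℝ => y ^ 2) ν) :
    Tendsto (fun t : ℝ => t ^ 2 * ν.real {y | t < |y|}) atTop (𝓝 0) := by
  have hs : ∀ t : ℝ, MeasurableSet {y : ℝ | t < |y|} := fun t =>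
    measurableSet_lt measurable_const (by fun_prop)
  have h1 : Tendsto (fun t : ℝ => ∫ y, {y : ℝ | t < |y|}.indicator (fun y => y ^ 2) y ∂ν) atTop
      (𝓝 (∫ _, (0 : ℝ) ∂ν)) := by
    refine tendsto_integral_filter_of_dominated_convergence (fun y => y ^ 2) ?_ ?_ hν2 ?_
    · exact Eventually.of_forall fun t =>
        (Measurable.indicator (by fun_prop) (hs t)).aestronglyMeasurable
    · refine Eventually.of_forall fun t => ae_of_all _ fun y => ?_
      refine (norm_indicator_le_norm_self _ _).trans ?_
      rw [Real.norm_of_nonneg (sq_nonneg _)]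
    · refine ae_of_all _ fun y => ?_
      refine tendsto_const_nhds.congr' ?_
      filter_upwards [eventually_ge_atTop |y|] with t ht
      rw [Set.indicator_of_notMem]
      simpa using ht
  rw [integral_zero] at h1
  refine squeeze_zero' (Eventually.of_forall fun t => by positivity) ?_ h1
  filter_upwards [eventually_ge_atTop (0 : ℝ)] with t ht
  have : t ^ 2 * ν.real {y | t < |y|} = ∫ y, {y : ℝ | t < |y|}.indicator (fun _ => t ^ 2) y ∂ν := by
    rw [integral_indicator (hs t)]
    simp [mul_comm]
  rw [this]
  refine integral_mono ((integrable_const _).indicator (hs t)) (hν2.indicator (hs t)) fun y => ?_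
  refine Set.indicator_le_indicator' fun hy => ?_
  rw [← sq_abs y]
  have : t < |y| := hy
  gcongr

end

end SLS

namespace SLS

noncomputable section

/-! ### Events whose probability tends to one -/

/-- The event `E n` holds with `P n`-probability tending to one (outer probability of the
complement, as `E n` need not be measurable). -/
def Whp {Ω : Type*} [MeasurableSpace Ω] (P : ℕ → Measure Ω) (E : ℕ → Ω → Prop) : Prop :=
  Tendsto (fun n => P n {ω | ¬ E n ω}) atTop (𝓝 0)

namespace Whp

variable {Ω : Type*} [MeasurableSpace Ω] {P : ℕ → Measure Ω} {E E' : ℕ → Ω → Prop}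

lemma mono' (h : Whp P E) (hE : ∀ᶠ n in atTop, ∀ ω, E n ω → E' n ω) : Whp P E' := by
  refine tendsto_of_tendsto_of_tendsto_of_le_of_le' tendsto_const_nhds h
    (Eventually.of_forall fun _ => zero_le) ?_
  filter_upwards [hE] with n hn
  exact measure_mono fun ω hω h' => hω (hn ω h')

lemma mono (h : Whp P E) (hE : ∀ n ω, E n ω → E' n ω) : Whp P E' :=
  h.mono' (Eventually.of_forall hE)

lemma of_measure_le {a : ℕ → ENNReal} (ha : Tendsto a atTop (𝓝 0))
    (h : ∀ᶠ n in atTop, P n {ω | ¬ E n ω} ≤ a n) : Whp P E :=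
  tendsto_of_tendsto_of_tendsto_of_le_of_le' tendsto_const_nhds ha
    (Eventually.of_forall fun _ => zero_le) h

lemma of_ae (h : ∀ n, ∀ᵐ ω ∂(P n), E n ω) : Whp P E := by
  have : ∀ n, P n {ω | ¬ E n ω} = 0 := fun n => ae_iff.1 (h n)
  simp [Whp, this]

lemma and (h : Whp P E) (h' : Whp P E') : Whp P fun n ω => E n ω ∧ E' n ω := by
  have h0 := Tendsto.add h h'
  rw [add_zero] at h0
  refine of_measure_le h0 (Eventually.of_forall fun n => ?_)
  refine (measure_mono fun ω hω => ?_).trans (measure_union_le _ _)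
  by_cases h1 : E n ω
  · exact Or.inr fun h2 => hω ⟨h1, h2⟩
  · exact Or.inl h1

/-- A uniformly bounded sequence converging to zero in probability has integrals tending to
zero. -/
lemma eventually_norm_integral_le [∀ n, IsProbabilityMeasure (P n)] {f : ℕ → Ω → ℂ} {B δ : ℝ}
    (hfm : ∀ n, Measurable (f n)) (hfB : ∀ n ω, ‖f n ω‖ ≤ B) (hδ : 0 < δ)
    (h : Whp P fun n ω => ‖f n ω‖ ≤ δ) : ∀ᶠ n in atTop, ‖∫ ω, f n ω ∂(P n)‖ ≤ 2 * δ := by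
  have h1 : Tendsto (fun n => (P n).real {ω | ¬ ‖f n ω‖ ≤ δ} * B) atTop (𝓝 (0 * B)) := by
    refine Tendsto.mul_const _ ?_
    have := (ENNReal.tendsto_toReal ENNReal.zero_ne_top).comp h
    simpa [Function.comp_def, Measure.real] using this
  rw [zero_mul] at h1
  filter_upwards [h1.eventually_le_const hδ] with n hn
  have hs : MeasurableSet {ω | ¬ ‖f n ω‖ ≤ δ} :=
    (measurableSet_le (hfm n).norm measurable_const).compl
  have hi : Integrable (fun ω => δ + {ω | ¬ ‖f n ω‖ ≤ δ}.indicator (fun _ => B) ω) (P n) :=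
    (integrable_const _).add ((integrable_const _).indicator hs)
  refine (norm_integral_le_of_norm_le hi (ae_of_all _ fun ω => ?_)).trans ?_
  · by_cases h2 : ‖f n ω‖ ≤ δ
    · rw [Set.indicator_of_notMem (by simpa using h2), add_zero]
      exact h2
    · rw [Set.indicator_of_mem (by simpa using h2)]
      linarith [hfB n ω]
  · rw [integral_add (integrable_const _) ((integrable_const _).indicator hs),
      integral_indicator hs]
    simp only [integral_const, probReal_univ, smul_eq_mul, one_mul, measureReal_restrict_apply_univ]
    linarith

end Whp

/-! ### A central limit theorem for predictable transforms of innovations -/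

/-- Both functions have the Taylor expansion 1 - s t²/2 + o(t²) at zero. The arbitrarily small
constant `r` takes the place of a third moment. -/
lemma exists_norm_charFun_sub_exp_le {ν : Measure ℝ} [IsProbabilityMeasure ν] (hν : MemLp id 2 ν)
    (hmean : ∫ y, y ∂ν = 0) {s : ℝ} (hvar : ∫ y, y ^ 2 ∂ν = s) {r : ℝ} (hr : 0 < r) :
    ∃ η > 0, ∀ t : ℝ, |t| ≤ η →
      ‖charFun ν t - Complex.exp (-(s * t ^ 2 / 2 : ℝ))‖ ≤ r * t ^ 2 := by
  have h1 : (fun t : ℝ => charFun ν t - (1 - s * t ^ 2 / 2)) =o[𝓝 0] fun t : ℝ => t ^ 2 := by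
    have htay : ∀ t : ℝ, taylorWithinEval (charFun ν) 2 Set.univ 0 t = 1 - s * t ^ 2 / 2 := by
      intro t
      have := taylorWithinEval_charFun_two_zero (P := ν) (X := id) aemeasurable_id
        (by simpa using hν) t
      simp only [Measure.map_id, id_eq, hmean, Pi.pow_apply, hvar] at this
      rw [this]
      simp
    simp_rw [← htay]
    convert! taylor_isLittleO_univ (contDiff_charFun hν) using 2
    simp
  have h2 : (fun t : ℝ => Complex.exp (-(s * t ^ 2 / 2 : ℝ)) - (1 - s * t ^ 2 / 2))
      =o[𝓝 0] fun t : ℝ => t ^ 2 := by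
    rw [Asymptotics.isLittleO_iff]
    intro c hc
    have t1 : Tendsto (fun t : ℝ => |s| * t ^ 2 / 2) (𝓝 0) (𝓝 (|s| * 0 ^ 2 / 2)) :=
      Continuous.tendsto (by fun_prop) 0
    have t2 : Tendsto (fun t : ℝ => |s| / 2 * (|s| * t ^ 2 / 2)) (𝓝 0)
      (𝓝 (|s| / 2 * (|s| * 0 ^ 2 / 2))) := t1.const_mul _
    norm_num at t1 t2
    filter_upwards [t1.eventually_le_const one_pos, t2.eventually_le_const hc] with t ht1 ht2
    have hn : ‖(-(s * t ^ 2 / 2 : ℝ) : ℂ)‖ = |s| * t ^ 2 / 2 := by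
      rw [norm_neg, Complex.norm_real, Real.norm_eq_abs, abs_div, abs_mul, abs_pow, sq_abs]
      norm_num
    have h3 := Complex.norm_exp_sub_one_sub_id_le (x := (-(s * t ^ 2 / 2 : ℝ) : ℂ)) (by rwa [hn])
    have e : Complex.exp (-(s * t ^ 2 / 2 : ℝ)) - (1 - s * t ^ 2 / 2) =
        Complex.exp (-(s * t ^ 2 / 2 : ℝ)) - 1 - (-(s * t ^ 2 / 2 : ℝ) : ℂ) := by
      push_cast; ring
    rw [e]
    refine h3.trans ?_
    rw [hn, Real.norm_of_nonneg (sq_nonneg t)]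
    calc (|s| * t ^ 2 / 2) ^ 2 = |s| / 2 * (|s| * t ^ 2 / 2) * t ^ 2 := by ring
      _ ≤ c * t ^ 2 := by gcongr
  have h3 := h1.sub h2
  rw [Asymptotics.isLittleO_iff] at h3
  obtain ⟨η, hη, hb⟩ := Metric.eventually_nhds_iff_ball.1 (h3 hr)
  refine ⟨η / 2, by positivity, fun t ht => ?_⟩
  have := hb t (by rw [Metric.mem_ball, Real.dist_eq, sub_zero]; linarith)
  rwa [Real.norm_of_nonneg (sq_nonneg t), sub_sub_sub_cancel_right] at this

/-- Central limit theorem, for predictable weights with bounded quadratic variation `∑ w ^ 2` that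
converges to a constant, while the largest weight tends to zero. -/
theorem tendsto_integral_exp_sum {Ω : Type*} {m : MeasurableSpace Ω} {P : ℕ → Measure Ω}
    [∀ n, IsProbabilityMeasure (P n)] {ν : Measure ℝ} [IsProbabilityMeasure ν] (hν : MemLp id 2 ν)
    (hmean : ∫ y, y ∂ν = 0) {s : ℝ} (hvar : ∫ y, y ^ 2 ∂ν = s)
    {F : ℕ → Filtration ℕ m} {ξ : ℕ → ℕ → Ω → ℝ} (h : ∀ n, IsInnovation (P n) ν (F n) (ξ n))
    {w : ℕ → ℕ → Ω → ℝ} (hw : ∀ n k, Measurable[F n k] (w n k)) (N : ℕ → ℕ) {L v : ℝ}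
    (hL : ∀ n M ω, ∑ k ∈ Finset.range M, w n k ω ^ 2 ≤ L)
    (hmax : ∀ η > 0, Whp P fun n ω => ∀ k < N n, |w n k ω| ≤ η)
    (hQ : ∀ δ > 0, Whp P fun n ω => |∑ k ∈ Finset.range (N n), w n k ω ^ 2 - v| ≤ δ) :
    Tendsto (fun n => ∫ ω, Complex.exp ((∑ k ∈ Finset.range (N n), w n k ω * ξ n k ω : ℝ)
      * Complex.I) ∂(P n)) atTop (𝓝 (Complex.exp (-(s / 2 * v : ℝ)))) := by
  have hs : 0 ≤ s := hvar ▸ integral_nonneg fun y => sq_nonneg y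
  have hΩ : Nonempty Ω := by
    by_contra hcon
    rw [not_nonempty_iff] at hcon
    have := (inferInstance : IsProbabilityMeasure (P 0)).measure_univ
    simp [Set.eq_empty_of_isEmpty] at this
  have hL0 : 0 ≤ L := by simpa using hL 0 0 hΩ.some
  set C := Real.exp (-(s / 2 * v)) * (Real.exp (s / 2 * L) * L) with hC
  rw [Metric.tendsto_atTop']
  suffices hsuf : ∀ ε > 0, ∀ᶠ n in atTop, ‖(∫ ω, Complex.exp ((∑ k ∈ Finset.range (N n),
      w n k ω * ξ n k ω : ℝ) * Complex.I) ∂(P n)) - Complex.exp (-(s / 2 * v : ℝ))‖ < ε by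
    intro ε hε
    obtain ⟨n₀, hn₀⟩ := eventually_atTop.1 (hsuf ε hε)
    exact ⟨n₀, fun n hn => by rw [dist_eq_norm]; exact hn₀ n hn.le⟩
  intro ε hε
  obtain ⟨r, hr, hrC⟩ : ∃ r > 0, C * r ≤ ε / 4 := by
    have hC0 : 0 ≤ C := by positivity
    refine ⟨ε / 4 / (C + 1), by positivity, ?_⟩
    rw [mul_div_assoc', div_le_iff₀ (by positivity)]
    nlinarith
  obtain ⟨η, hη, hφ⟩ := exists_norm_charFun_sub_exp_le hν hmean hvar hr
  -- Dropping weights above `η` keeps them predictable and makes the characteristic function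
  -- estimate valid on every path; with probability tending to one nothing is dropped.
  set w' : ℕ → ℕ → Ω → ℝ := fun n k ω => if |w n k ω| ≤ η then w n k ω else 0 with hw'
  have hw'F : ∀ n k, Measurable[F n k] (w' n k) := by
    intro n k
    refine Measurable.ite ?_ (hw n k) measurable_const
    have : Measurable[F n k] fun ω => |w n k ω| := (continuous_abs.measurable).comp (hw n k)
    exact this measurableSet_Iic
  have hw'sq : ∀ n k ω, w' n k ω ^ 2 ≤ w n k ω ^ 2 := by
    intro n k ω
    simp only [hw']
    split_ifs
    · rfl
    · simpa using sq_nonneg _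
  have hL' : ∀ n M ω, ∑ k ∈ Finset.range M, w' n k ω ^ 2 ≤ L := fun n M ω =>
    (Finset.sum_le_sum fun k _ => hw'sq n k ω).trans (hL n M ω)
  have hT := fun n => (h n).norm_integral_exp_sub_one_le (hw'F n) hs hr.le (hL' n)
    (fun k ω => hφ _ (by simp only [hw']; split_ifs with h1; exacts [h1, by simpa using hη.le]))
    (N n)
  set T : ℕ → Ω → ℂ := fun n ω =>
    Complex.exp ((∑ k ∈ Finset.range (N n), w' n k ω * ξ n k ω : ℝ) * Complex.I
      + (s / 2 * ∑ k ∈ Finset.range (N n), w' n k ω ^ 2 : ℝ)) with hTdef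
  set e : ℕ → Ω → ℂ := fun n ω =>
    Complex.exp ((∑ k ∈ Finset.range (N n), w n k ω * ξ n k ω : ℝ) * Complex.I) with he
  have hem : ∀ n, Measurable (e n) := fun n => by
    refine Complex.measurable_exp.comp (Measurable.mul_const (Complex.measurable_ofReal.comp ?_) _)
    exact ((h n).measurable_sum (hw n) _).mono ((F n).le _) le_rfl
  have hTm : ∀ n, Measurable (T n) := fun n => by
    refine Complex.measurable_exp.comp (Measurable.add
      (Measurable.mul_const (Complex.measurable_ofReal.comp ?_) _)
      (Complex.measurable_ofReal.comp (Measurable.const_mul ?_ _)))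
    · exact ((h n).measurable_sum (hw'F n) _).mono ((F n).le _) le_rfl
    · exact (IsInnovation.measurable_sum_sq (hw'F n) _).mono ((F n).le _) le_rfl
  have hen : ∀ n ω, ‖e n ω‖ = 1 := fun n ω => Complex.norm_exp_ofReal_mul_I _
  have hTn : ∀ n ω, ‖T n ω‖ ≤ Real.exp (s / 2 * L) := fun n ω => by
    simp only [hTdef, Complex.exp_add, norm_mul, Complex.norm_exp_ofReal_mul_I, one_mul,
      Complex.norm_exp_ofReal]
    have := hL' n (N n) ω
    gcongr
  set E₀ : ℂ := Complex.exp (-(s / 2 * v : ℝ)) with hE₀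
  have hE₀n : ‖E₀‖ = Real.exp (-(s / 2 * v)) := by
    rw [hE₀, ← Complex.ofReal_neg, Complex.norm_exp_ofReal]
  have hei : ∀ n, Integrable (e n) (P n) := fun n =>
    Integrable.of_bound (hem n).aestronglyMeasurable 1 (ae_of_all _ fun ω => (hen n ω).le)
  have hTi : ∀ n, Integrable (T n) (P n) := fun n =>
    Integrable.of_bound (hTm n).aestronglyMeasurable _ (ae_of_all _ (hTn n))
  have hsmall : ∃ δ > 0, ∀ x : ℝ, |x| ≤ δ → ‖1 - Complex.exp (s / 2 * x : ℝ)‖ ≤ ε / 4 := by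
    have : Tendsto (fun x : ℝ => ‖1 - Complex.exp (s / 2 * x : ℝ)‖) (𝓝 0)
        (𝓝 ‖1 - Complex.exp (s / 2 * (0 : ℝ) : ℝ)‖) := Continuous.tendsto (by fun_prop) 0
    norm_num at this
    obtain ⟨δ, hδ, hb⟩ := Metric.eventually_nhds_iff_ball.1
      (this.eventually_le_const (show 0 < ε / 4 by positivity))
    refine ⟨δ / 2, by positivity, fun x hx => ?_⟩
    have := hb x (by rw [Metric.mem_ball, Real.dist_eq, sub_zero]; linarith)
    push_cast
    exact this
  obtain ⟨δ, hδ, hδe⟩ := hsmall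
  -- Where no weight is dropped, `E₀ * T n` is `e n` times exp(s/2 (Σ w² - v)), and the exponent is
  -- small.
  have hwhp : Whp P fun n ω => ‖e n ω - E₀ * T n ω‖ ≤ ε / 4 := by
    refine ((hmax η hη).and (hQ δ hδ)).mono fun n ω ⟨h1, h2⟩ => ?_
    have h3 : ∀ k ∈ Finset.range (N n), w' n k ω = w n k ω := fun k hk => by
      simp only [hw', if_pos (h1 k (Finset.mem_range.1 hk))]
    have h4 : T n ω = e n ω * Complex.exp (s / 2 * ∑ k ∈ Finset.range (N n), w n k ω ^ 2 : ℝ) := by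
      simp only [hTdef, he, ← Complex.exp_add]
      rw [Finset.sum_congr rfl fun k hk => by rw [h3 k hk]]
      congr 3
      rw [Finset.sum_congr rfl fun k hk => by rw [h3 k hk]]
    have h5 : e n ω - E₀ * T n ω = e n ω * (1 - Complex.exp
        (s / 2 * (∑ k ∈ Finset.range (N n), w n k ω ^ 2 - v) : ℝ)) := by
      rw [h4, mul_sub (s / 2), Complex.ofReal_sub, sub_eq_add_neg (Complex.ofReal _),
        Complex.exp_add, ← hE₀]
      ring
    rw [h5, norm_mul, hen, one_mul]
    exact hδe _ h2
  have hev := Whp.eventually_norm_integral_le (B := 1 + ‖E₀‖ * Real.exp (s / 2 * L))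
    (fun n => (hem n).sub ((hTm n).const_mul E₀)) (fun n ω => by
      refine (norm_sub_le _ _).trans ?_
      rw [hen, norm_mul]
      gcongr
      exact hTn n ω) (by positivity) hwhp
  filter_upwards [hev] with n hn
  have e1 : (∫ ω, e n ω ∂(P n)) - E₀ =
      (∫ ω, (e n ω - E₀ * T n ω) ∂(P n)) + E₀ * ((∫ ω, T n ω ∂(P n)) - 1) := by
    rw [integral_sub (hei n) ((hTi n).const_mul _), integral_const_mul]
    ring
  rw [e1]
  calc _ ≤ 2 * (ε / 4) + ‖E₀‖ * (Real.exp (s / 2 * L) * r * L) := by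
        refine (norm_add_le _ _).trans (add_le_add hn ?_)
        rw [norm_mul]
        gcongr
        exact hT n
    _ = 2 * (ε / 4) + C * r := by rw [hE₀n, hC]; ring
    _ < ε := by linarith

end

end SLS

namespace SLS

noncomputable section

/-! ### The companion form of the recursion and its Stein equation -/

/-- One step of the autoregression, on the vector of lags. -/
def step {q : ℕ} (β z : EuclideanSpace ℝ (Fin (q + 1))) (u : ℝ) : EuclideanSpace ℝ (Fin (q + 1)) :=
  WithLp.toLp 2 (Fin.cons (∑ j, β j * z j + u) fun i : Fin q => z i.castSucc)

@[simp] lemma step_zero {q : ℕ} (β z : EuclideanSpace ℝ (Fin (q + 1))) (u : ℝ) :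
    step β z u 0 = ∑ j, β j * z j + u := rfl

@[simp] lemma step_succ {q : ℕ} (β z : EuclideanSpace ℝ (Fin (q + 1))) (u : ℝ) (i : Fin q) :
    step β z u i.succ = z i.castSucc := rfl

/-- The transpose of the companion matrix. -/
def backShift {q : ℕ} (β v : EuclideanSpace ℝ (Fin (q + 1))) : EuclideanSpace ℝ (Fin (q + 1)) :=
  WithLp.toLp 2 fun j =>
    v 0 * β j + Fin.snoc (α := fun _ => ℝ) (fun i : Fin q => v i.succ) 0 j

lemma backShift_castSucc {q : ℕ} (β v : EuclideanSpace ℝ (Fin (q + 1))) (i : Fin q) :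
    backShift β v i.castSucc = v 0 * β i.castSucc + v i.succ := by
  simp [backShift]

lemma backShift_last {q : ℕ} (β v : EuclideanSpace ℝ (Fin (q + 1))) :
    backShift β v (Fin.last q) = v 0 * β (Fin.last q) := by
  simp [backShift]

/-- Duality: a linear functional of the new state is the back-shifted functional of the old one plus
noise. Growth of paths is thus controlled through `backShift`, on which the Stein form is monotone.
-/
lemma sum_mul_step {q : ℕ} (β v z : EuclideanSpace ℝ (Fin (q + 1))) (u : ℝ) :
    ∑ j, v j * step β z u j = ∑ j, backShift β v j * z j + v 0 * u := by
  rw [Fin.sum_univ_succ, Fin.sum_univ_castSucc (fun j => backShift β v j * z j)]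
  simp only [step_zero, step_succ, backShift_castSucc, backShift_last]
  rw [Fin.sum_univ_castSucc (fun j => β j * z j)]
  simp only [add_mul, Finset.sum_add_distrib, mul_add, Finset.mul_sum, mul_assoc]
  ring

/-- The quadratic form of a matrix. -/
def quad {q : ℕ} (S : Matrix (Fin (q + 1)) (Fin (q + 1)) ℝ) (v : EuclideanSpace ℝ (Fin (q + 1))) :
    ℝ := ∑ i, ∑ j, v i * S i j * v j

/-- The matrix `H` is a symmetric Toeplitz matrix whose entries satisfy the Yule–Walker equations
with coefficients `β`. -/
structure IsStein {q : ℕ} (β : EuclideanSpace ℝ (Fin (q + 1)))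
    (H : Matrix (Fin (q + 1)) (Fin (q + 1)) ℝ) : Prop where
  symm : ∀ i j, H i j = H j i
  shift : ∀ i j : Fin q, H i.succ j.succ = H i.castSucc j.castSucc
  yuleWalker : ∀ j : Fin q, H 0 j.succ = ∑ m, β m * H m j.castSucc

lemma IsStein.smul {q : ℕ} {β : EuclideanSpace ℝ (Fin (q + 1))}
    {H : Matrix (Fin (q + 1)) (Fin (q + 1)) ℝ} (h : IsStein β H) (a : ℝ) : IsStein β (a • H) where
  symm i j := by simp [h.symm i j]
  shift i j := by simp [h.shift i j]
  yuleWalker j := by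
    simp only [Matrix.smul_apply, h.yuleWalker j, smul_eq_mul, Finset.mul_sum]
    exact Finset.sum_congr rfl fun m _ => by ring

lemma IsStein.diag {q : ℕ} {β : EuclideanSpace ℝ (Fin (q + 1))}
    {H : Matrix (Fin (q + 1)) (Fin (q + 1)) ℝ} (h : IsStein β H) (i : Fin (q + 1)) :
    H i i = H 0 0 := by
  induction i using Fin.induction with
  | zero => rfl
  | succ i ih => rw [h.shift, ih]

lemma IsStein.trace {q : ℕ} {β : EuclideanSpace ℝ (Fin (q + 1))}
    {H : Matrix (Fin (q + 1)) (Fin (q + 1)) ℝ} (h : IsStein β H) :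
    H.trace = (q + 1) * H 0 0 := by
  simp [Matrix.trace, h.diag]

lemma isStein_corrMatrix {q : ℕ} {β : EuclideanSpace ℝ (Fin (q + 1))} {Y : Fin (q + 1 - 1) → ℝ}
    (h : SolvesYuleWalker β Y) : IsStein β (corrMatrix Y) where
  symm i j := by
    simp only [corrMatrix, Matrix.of_apply]
    rw [← Int.natAbs_neg, neg_sub]
  shift i j := by
    simp only [corrMatrix, Matrix.of_apply, Fin.val_succ, Fin.val_castSucc]
    congr 2
    push_cast
    ring
  yuleWalker j := by
    have h1 := h (j + 1) (by omega) (by omega)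
    simp only [corrMatrix, Matrix.of_apply, Fin.val_succ, Fin.val_castSucc, Fin.val_zero]
    convert h1 using 2
    · congr 1
    · rename_i m _
      rw [← Int.natAbs_neg]
      congr 2
      push_cast
      ring_nf

/-- A symmetric Toeplitz matrix is determined by its first row, so uniqueness for the linear system
carries over to Stein matrices. -/
lemma IsStein.exists_corrMatrix {q : ℕ} {β : EuclideanSpace ℝ (Fin (q + 1))}
    {H : Matrix (Fin (q + 1)) (Fin (q + 1)) ℝ} (h : IsStein β H) (h0 : H 0 0 = 1) :
    ∃ Y : Fin (q + 1 - 1) → ℝ, SolvesYuleWalker β Y ∧ corrMatrix Y = H := by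
  let Y : Fin (q + 1 - 1) → ℝ := fun k => H 0 ⟨k + 1, by have := k.2; omega⟩
  have hcorr : ∀ k (hk : k < q + 1), corr (p := q + 1) Y k = H 0 ⟨k, hk⟩ := by
    intro k hk
    rcases k with _ | k
    · simpa [corr] using h0.symm
    · have : k < q + 1 - 1 := by omega
      rw [corr, if_neg (by omega), dif_pos (by simpa using this)]
      rfl
  have htoep : ∀ i d (hi : i + d < q + 1), H ⟨i, by omega⟩ ⟨i + d, hi⟩ = H 0 ⟨d, by omega⟩ := by
    intro i d
    induction i with
    | zero => intro hi; simp
    | succ i ih =>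
      intro hi
      rw [← ih (by omega)]
      have := h.shift ⟨i, by omega⟩ ⟨i + d, by omega⟩
      simp only [Fin.succ_mk, Fin.castSucc_mk] at this
      rw [← this]
      congr 2
      omega
  have hH : corrMatrix (p := q + 1) Y = H := by
    ext i j
    simp only [corrMatrix, Matrix.of_apply]
    rcases le_total (i : ℕ) j with hij | hij
    · obtain ⟨d, hd⟩ := Nat.exists_eq_add_of_le hij
      have e : ((i : ℤ) - (j : ℤ)).natAbs = d := by omega
      rw [e, hcorr d (by omega), ← htoep i d (by omega)]
      congr 1
      exact Fin.ext hd.symm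
    · obtain ⟨d, hd⟩ := Nat.exists_eq_add_of_le hij
      have e : ((i : ℤ) - (j : ℤ)).natAbs = d := by omega
      rw [e, hcorr d (by omega), ← htoep j d (by omega), h.symm]
      congr 1
      exact Fin.ext hd.symm
  refine ⟨Y, ?_, hH⟩
  intro i hi1 hi2
  have hy := h.yuleWalker ⟨i - 1, by omega⟩
  rw [← hH] at hy
  simp only [corrMatrix, Matrix.of_apply, Fin.val_succ, Fin.val_castSucc, Fin.val_zero] at hy
  convert hy using 2
  · omega
  · rename_i m _
    congr 2
    omega

/-- For parameters in the region, the Stein equation has exactly one solution of trace one, and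
this solution is positive definite. -/
lemma exists_stein_of_mem_region {q : ℕ} {β : EuclideanSpace ℝ (Fin (q + 1))}
    (hβ : β ∈ region (q + 1)) :
    ∃ S : Matrix (Fin (q + 1)) (Fin (q + 1)) ℝ, S.PosDef ∧ IsStein β S ∧ S.trace = 1 ∧
      ∀ H, IsStein β H → H.trace = 1 → H = S := by
  obtain ⟨-, ⟨Y, hY, hYu⟩, hpd⟩ := hβ
  have hq : (0 : ℝ) < q + 1 := by positivity
  have h00 : corrMatrix (p := q + 1) Y 0 0 = 1 := by simp [corrMatrix, corr]
  refine ⟨((q : ℝ) + 1)⁻¹ • corrMatrix Y, (hpd Y hY).smul (by positivity),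
    (isStein_corrMatrix hY).smul _, ?_, ?_⟩
  · rw [Matrix.trace_smul, (isStein_corrMatrix hY).trace, h00]
    simp only [smul_eq_mul, mul_one]
    exact inv_mul_cancel₀ hq.ne'
  · intro H hH htr
    have h1 : ((q : ℝ) + 1) * H 0 0 = 1 := by rw [← hH.trace, htr]
    obtain ⟨Y', hY', hY'H⟩ := (hH.smul ((q : ℝ) + 1)).exists_corrMatrix (by simpa using h1)
    rw [hYu Y' hY'] at hY'H
    rw [hY'H, smul_smul, inv_mul_cancel₀ hq.ne', one_smul]

/-- Write `backShift β v` as v₀β + t, with t the tail of v followed by 0. Yule–Walker turns the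
cross term into the first row of `S` against v, and the Toeplitz property turns tᵀSt into the
remaining block of vᵀSv. Only the coefficients of v₀² differ. -/
lemma quad_backShift {q : ℕ} {β : EuclideanSpace ℝ (Fin (q + 1))}
    {S : Matrix (Fin (q + 1)) (Fin (q + 1)) ℝ} (h : IsStein β S)
    (v : EuclideanSpace ℝ (Fin (q + 1))) :
    quad S (backShift β v) = quad S v - (S 0 0 - quad S β) * v 0 ^ 2 := by
  have hb : ∀ j, backShift β v j = v 0 * β j +
      Fin.snoc (α := fun _ => ℝ) (fun i : Fin q => v i.succ) 0 j := fun j => rfl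
  set t : Fin (q + 1) → ℝ := Fin.snoc (α := fun _ => ℝ) (fun i : Fin q => v i.succ) 0 with ht
  have htc : ∀ i : Fin q, t i.castSucc = v i.succ := fun i => by simp [ht]
  have htl : t (Fin.last q) = 0 := by simp [ht]
  have e1 : quad S (backShift β v) = v 0 ^ 2 * quad S β + 2 * v 0 * (∑ j, ∑ m, β m * S m j * t j)
      + ∑ i, ∑ j, t i * S i j * t j := by
    have hsw : ∑ i, ∑ j, t i * S i j * β j = ∑ j, ∑ m, β m * S m j * t j :=
      Finset.sum_congr rfl fun i _ => Finset.sum_congr rfl fun j _ => by rw [h.symm i j]; ring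
    have hsw2 : ∑ i, ∑ j, β i * S i j * t j = ∑ j, ∑ m, β m * S m j * t j := Finset.sum_comm
    have : quad S (backShift β v) = v 0 ^ 2 * quad S β + v 0 * (∑ i, ∑ j, t i * S i j * β j)
        + v 0 * (∑ i, ∑ j, β i * S i j * t j) + ∑ i, ∑ j, t i * S i j * t j := by
      simp only [quad, hb, Finset.mul_sum, ← Finset.sum_add_distrib]
      exact Finset.sum_congr rfl fun i _ => Finset.sum_congr rfl fun j _ => by ring
    rw [this, hsw, hsw2]
    ring
  have e2 : ∑ j, ∑ m, β m * S m j * t j = ∑ j : Fin q, S 0 j.succ * v j.succ := by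
    rw [Fin.sum_univ_castSucc]
    simp only [htl, mul_zero, Finset.sum_const_zero, add_zero, htc]
    exact Finset.sum_congr rfl fun j _ => by rw [h.yuleWalker, Finset.sum_mul]
  have e3 : ∑ i, ∑ j, t i * S i j * t j = ∑ i : Fin q, ∑ j : Fin q, v i.succ * S i.succ j.succ
      * v j.succ := by
    rw [Fin.sum_univ_castSucc]
    simp only [htl, zero_mul, Finset.sum_const_zero, add_zero, htc]
    refine Finset.sum_congr rfl fun i _ => ?_
    rw [Fin.sum_univ_castSucc]
    simp only [htl, mul_zero, add_zero, htc, h.shift]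
  have e4 : quad S v = v 0 ^ 2 * S 0 0 + 2 * v 0 * (∑ j : Fin q, S 0 j.succ * v j.succ)
      + ∑ i : Fin q, ∑ j : Fin q, v i.succ * S i.succ j.succ * v j.succ := by
    have e5 : ∑ i : Fin q, v i.succ * S i.succ 0 * v 0 =
        v 0 * ∑ j : Fin q, S 0 j.succ * v j.succ := by
      rw [Finset.mul_sum]
      exact Finset.sum_congr rfl fun j _ => by rw [h.symm j.succ 0]; ring
    have e6 : ∑ j : Fin q, v 0 * S 0 j.succ * v j.succ =
        v 0 * ∑ j : Fin q, S 0 j.succ * v j.succ := by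
      rw [Finset.mul_sum]
      exact Finset.sum_congr rfl fun j _ => by ring
    simp only [quad]
    rw [Fin.sum_univ_succ]
    simp only [Fin.sum_univ_succ (fun j => v _ * S _ j * v j), Finset.sum_add_distrib, e5, e6]
    ring
  rw [e1, e2, e3, e4]
  ring

lemma quad_nonneg {q : ℕ} {S : Matrix (Fin (q + 1)) (Fin (q + 1)) ℝ} (hS : S.PosDef)
    (v : EuclideanSpace ℝ (Fin (q + 1))) : 0 ≤ quad S v := by
  have := hS.posSemidef.dotProduct_mulVec_nonneg v
  simpa [quad, dotProduct, Matrix.mulVec, Finset.mul_sum, mul_assoc] using this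

lemma exists_charPoly_root {q : ℕ} (β : EuclideanSpace ℝ (Fin (q + 1))) :
    ∃ z : ℂ, z ^ (q + 1) - ∑ j : Fin (q + 1), (β j : ℂ) * z ^ (q + 1 - 1 - (j : ℕ)) = 0 := by
  let r : Polynomial ℂ := ∑ j : Fin (q + 1),
    Polynomial.C (β j : ℂ) * Polynomial.X ^ (q + 1 - 1 - (j : ℕ))
  have hr : r.degree < ((q + 1 : ℕ) : WithBot ℕ) := by
    refine (Polynomial.degree_sum_le _ _).trans_lt ?_
    rw [Finset.sup_lt_iff (by exact WithBot.bot_lt_coe _)]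
    intro j _
    refine (Polynomial.degree_C_mul_X_pow_le _ _).trans_lt ?_
    exact_mod_cast (by omega : q + 1 - 1 - (j : ℕ) < q + 1)
  have hd : (Polynomial.X ^ (q + 1) - r).degree = ((q + 1 : ℕ) : WithBot ℕ) := by
    rw [Polynomial.degree_sub_eq_left_of_degree_lt, Polynomial.degree_X_pow]
    rwa [Polynomial.degree_X_pow]
  obtain ⟨z, hz⟩ := IsAlgClosed.exists_root (Polynomial.X ^ (q + 1) - r) (by rw [hd]; exact_mod_cast q.succ_ne_zero)
  refine ⟨z, ?_⟩
  simpa [r, Polynomial.IsRoot, Polynomial.eval_finsetSum] using hz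

/-- Roots in the closed unit disc make the innovation variance of the Stein equation
nonnegative. -/
lemma quad_le_of_rootsInClosedDisc {q : ℕ} {β : EuclideanSpace ℝ (Fin (q + 1))}
    {S : Matrix (Fin (q + 1)) (Fin (q + 1)) ℝ} (h : IsStein β S) (hS : S.PosDef)
    (hroots : RootsInClosedDisc β) : quad S β ≤ S 0 0 := by
  obtain ⟨z, hz⟩ := exists_charPoly_root β
  have hz1 : ‖z‖ ≤ 1 := hroots z hz
  let b : ℕ → ℂ := fun m => if hm : m < q + 1 then (β ⟨m, hm⟩ : ℂ) else 0
  have hbv : ∀ j : Fin (q + 1), b j = β j := fun j => dif_pos j.2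
  -- Horner's scheme: the eigenvector of the transposed companion matrix for the root `z`, with
  -- first entry 1. The root equation is what makes it stop, `v (q + 1) = 0`.
  let v : ℕ → ℂ := fun j => z ^ j - ∑ m ∈ Finset.range j, b m * z ^ (j - 1 - m)
  have hv0 : v 0 = 1 := by simp [v]
  have hvs : ∀ j, z * v j = b j + v (j + 1) := by
    intro j
    simp only [v, Finset.sum_range_succ, mul_sub, Finset.mul_sum]
    have : ∑ m ∈ Finset.range j, z * (b m * z ^ (j - 1 - m)) =
        ∑ m ∈ Finset.range j, b m * z ^ (j + 1 - 1 - m) := by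
      refine Finset.sum_congr rfl fun m hm => ?_
      have hm' := Finset.mem_range.1 hm
      have : j + 1 - 1 - m = j - 1 - m + 1 := by omega
      rw [this, pow_succ]
      ring
    rw [this]
    simp
    ring
  have hvl : v (q + 1) = 0 := by
    rw [← hz]
    simp only [v]
    congr 1
    rw [← Fin.sum_univ_eq_sum_range (fun m => b m * z ^ (q + 1 - 1 - m))]
    simp only [hbv]
  let a : EuclideanSpace ℝ (Fin (q + 1)) := WithLp.toLp 2 fun j => (v j).re
  let c : EuclideanSpace ℝ (Fin (q + 1)) := WithLp.toLp 2 fun j => (v j).im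
  have ha : ∀ j, a j = (v j).re := fun j => rfl
  have hc : ∀ j, c j = (v j).im := fun j => rfl
  have ha0 : a 0 = 1 := by simp [ha, hv0]
  have hc0 : c 0 = 0 := by simp [hc, hv0]
  have hba : ∀ j, backShift β a j = z.re * a j - z.im * c j := by
    intro j
    rw [ha, hc, ← Complex.mul_re, hvs, hbv, Complex.add_re, Complex.ofReal_re]
    induction j using Fin.lastCases with
    | last => simp [backShift_last, ha0, hvl]
    | cast i => rw [backShift_castSucc, ha0, one_mul]; rfl
  have hbc : ∀ j, backShift β c j = z.re * c j + z.im * a j := by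
    intro j
    rw [ha, hc, ← Complex.mul_im, hvs, hbv, Complex.add_im, Complex.ofReal_im, zero_add]
    induction j using Fin.lastCases with
    | last => simp [backShift_last, hc0, hvl]
    | cast i => rw [backShift_castSucc, hc0, zero_mul, zero_add]; rfl
  have hsum : quad S (backShift β a) + quad S (backShift β c) =
      (z.re ^ 2 + z.im ^ 2) * (quad S a + quad S c) := by
    simp only [quad, hba, hbc, ← Finset.sum_add_distrib, Finset.mul_sum]
    exact Finset.sum_congr rfl fun i _ => Finset.sum_congr rfl fun j _ => by ring
  -- This now reads S₀₀ - βᵀSβ = (1 - |z|²)(quad S a + quad S c), so one root in the closed disc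
  -- suffices.
  rw [quad_backShift h, quad_backShift h, ha0, hc0] at hsum
  have hzn : z.re ^ 2 + z.im ^ 2 ≤ 1 := by
    have : z.re ^ 2 + z.im ^ 2 = ‖z‖ ^ 2 := by rw [Complex.sq_norm, Complex.normSq_apply]; ring
    rw [this]
    exact pow_le_one₀ (norm_nonneg _) hz1
  have := quad_nonneg hS a
  have := quad_nonneg hS c
  nlinarith

end

end SLS

namespace SLS

noncomputable section

/-! ### Bounds that are locally uniform in the parameter -/

/-- Pair the state with a test vector and move the steps onto that vector: its form does not grow,
and each innovation enters through its zeroth coordinate. At the end the state itself is the test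
vector. No spectral gap is needed. -/
lemma norm_path_le {q : ℕ} {β : EuclideanSpace ℝ (Fin (q + 1))}
    {S : Matrix (Fin (q + 1)) (Fin (q + 1)) ℝ} {a b : ℝ} (ha : 0 < a)
    (hlow : ∀ v, a * ‖v‖ ^ 2 ≤ quad S v) (hup : ∀ v, quad S v ≤ b * ‖v‖ ^ 2)
    (hback : ∀ v, quad S (backShift β v) ≤ quad S v)
    {z : ℕ → EuclideanSpace ℝ (Fin (q + 1))} {u : ℕ → ℝ}
    (hz : ∀ k, z (k + 1) = step β (z k) (u k)) (j k : ℕ) :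
    ‖z (j + k)‖ ≤ √(b / a) * (‖z j‖ + ∑ i ∈ Finset.range k, |u (j + i)|) := by
  have hnorm : ∀ v : EuclideanSpace ℝ (Fin (q + 1)), ‖v‖ ≤ √(quad S v / a) := fun v =>
    Real.le_sqrt_of_sq_le (by rw [le_div_iff₀ ha]; linarith [hlow v])
  have key : ∀ k (v : EuclideanSpace ℝ (Fin (q + 1))), ∑ i, v i * z (j + k) i ≤
      √(quad S v / a) * (‖z j‖ + ∑ i ∈ Finset.range k, |u (j + i)|) := by
    intro k
    induction k with
    | zero =>
      intro v
      simp only [add_zero, Finset.range_zero, Finset.sum_empty]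
      have h1 := real_inner_le_norm (z j) v
      simp only [PiLp.inner_apply, RCLike.inner_apply, conj_trivial] at h1
      refine h1.trans ?_
      rw [mul_comm]
      gcongr
      exact hnorm v
    | succ k ih =>
      intro v
      rw [← add_assoc, hz, sum_mul_step, Finset.sum_range_succ, ← add_assoc ‖z j‖, mul_add]
      refine add_le_add ((ih _).trans ?_) ?_
      · have := hback v
        gcongr
      · refine (le_abs_self _).trans ?_
        rw [abs_mul]
        gcongr
        refine le_trans ?_ (hnorm v)
        simpa using PiLp.norm_apply_le v 0
  have h1 := key k (z (j + k))
  have h2 : ∑ i, z (j + k) i * z (j + k) i = ‖z (j + k)‖ ^ 2 := by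
    rw [EuclideanSpace.real_norm_sq_eq]
    exact Finset.sum_congr rfl fun i _ => (sq _).symm
  rw [h2] at h1
  rcases (norm_nonneg (z (j + k))).eq_or_lt with h0 | h0
  · rw [← h0]
    positivity
  have h3 : √(quad S (z (j + k)) / a) ≤ √(b / a) * ‖z (j + k)‖ := by
    rw [← Real.sqrt_sq h0.le, ← Real.sqrt_mul' _ (sq_nonneg _)]
    apply Real.sqrt_le_sqrt
    rw [div_mul_eq_mul_div]
    have := hup (z (j + k))
    gcongr
  have h4 : ‖z (j + k)‖ * ‖z (j + k)‖ ≤ ‖z (j + k)‖ *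
      (√(b / a) * (‖z j‖ + ∑ i ∈ Finset.range k, |u (j + i)|)) := by
    calc ‖z (j + k)‖ * ‖z (j + k)‖ = ‖z (j + k)‖ ^ 2 := (sq _).symm
      _ ≤ (√(b / a) * ‖z (j + k)‖) * (‖z j‖ + ∑ i ∈ Finset.range k, |u (j + i)|) :=
        h1.trans (by gcongr)
      _ = _ := by ring
  exact le_of_mul_le_mul_left h4 h0

lemma abs_quad_le {q : ℕ} {S : Matrix (Fin (q + 1)) (Fin (q + 1)) ℝ} {δ : ℝ}
    (hS : ∀ i j, |S i j| ≤ δ) (v : EuclideanSpace ℝ (Fin (q + 1))) :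
    |quad S v| ≤ δ * (q + 1) * ‖v‖ ^ 2 := by
  have hδ : 0 ≤ δ := (abs_nonneg _).trans (hS 0 0)
  have h1 : (∑ i, |v i|) ^ 2 ≤ (q + 1) * ‖v‖ ^ 2 := by
    rw [EuclideanSpace.real_norm_sq_eq]
    have := sq_sum_le_card_mul_sum_sq (s := Finset.univ) (f := fun i => |v i|)
    simpa using this
  calc |quad S v| ≤ ∑ i, ∑ j, |v i * S i j * v j| :=
        (Finset.abs_sum_le_sum_abs _ _).trans
          (Finset.sum_le_sum fun i _ => Finset.abs_sum_le_sum_abs _ _)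
    _ ≤ ∑ i, ∑ j, δ * (|v i| * |v j|) := by
        refine Finset.sum_le_sum fun i _ => Finset.sum_le_sum fun j _ => ?_
        rw [abs_mul, abs_mul]
        have := hS i j
        calc |v i| * |S i j| * |v j| ≤ |v i| * δ * |v j| := by gcongr
          _ = _ := by ring
    _ = δ * (∑ i, |v i|) ^ 2 := by
        rw [sq, Finset.sum_mul_sum, Finset.mul_sum]
        simp_rw [Finset.mul_sum]
    _ ≤ δ * ((q + 1) * ‖v‖ ^ 2) := by gcongr
    _ = _ := by ring

lemma exists_le_quad {q : ℕ} {S : Matrix (Fin (q + 1)) (Fin (q + 1)) ℝ} (hS : S.PosDef) :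
    ∃ a > 0, ∀ v, a * ‖v‖ ^ 2 ≤ quad S v := by
  have hcont : Continuous fun v : EuclideanSpace ℝ (Fin (q + 1)) => quad S v := by
    unfold quad; fun_prop
  have hne : (Metric.sphere (0 : EuclideanSpace ℝ (Fin (q + 1))) 1).Nonempty :=
    NormedSpace.sphere_nonempty.2 zero_le_one
  obtain ⟨w, hw, hmin⟩ := (isCompact_sphere (0 : EuclideanSpace ℝ (Fin (q + 1))) 1).exists_isMinOn
    hne hcont.continuousOn
  have hw1 : ‖w‖ = 1 := by simpa using hw
  have hw0 : (w : Fin (q + 1) → ℝ) ≠ 0 := by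
    intro h
    have : w = 0 := by ext i; simpa using congrFun h i
    rw [this] at hw1
    simp at hw1
  refine ⟨quad S w, ?_, fun v => ?_⟩
  · have := hS.dotProduct_mulVec_pos hw0
    simpa [quad, dotProduct, Matrix.mulVec, Finset.mul_sum, mul_assoc] using this
  · rcases eq_or_ne v 0 with rfl | hv
    · simp [quad]
    have hvn : 0 < ‖v‖ := norm_pos_iff.2 hv
    have h1 : quad S w ≤ quad S (‖v‖⁻¹ • v) := hmin (by simp [norm_smul, hvn.ne'])
    have h2 : quad S (‖v‖⁻¹ • v) = ‖v‖⁻¹ ^ 2 * quad S v := by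
      simp only [quad, PiLp.smul_apply, smul_eq_mul, Finset.mul_sum]
      exact Finset.sum_congr rfl fun i _ => Finset.sum_congr rfl fun j _ => by ring
    rw [h2, inv_pow, ← div_eq_inv_mul, le_div_iff₀ (by positivity)] at h1
    exact h1

/-- Approximate solutions of the Stein equation for nearby parameters are close to the solution
of trace one. -/
lemma exists_forall_stein_close {q : ℕ} {β₀ : EuclideanSpace ℝ (Fin (q + 1))}
    {S : Matrix (Fin (q + 1)) (Fin (q + 1)) ℝ}
    (hS : ∀ H, IsStein β₀ H → H.trace = 1 → H = S) (B : ℝ) {δ : ℝ} (hδ : 0 < δ) :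
    ∃ η > 0, ∀ (β : EuclideanSpace ℝ (Fin (q + 1))) (H : Matrix (Fin (q + 1)) (Fin (q + 1)) ℝ),
      dist β β₀ ≤ η → (∀ i j, |H i j| ≤ B) → (∀ i j, H i j = H j i) →
      (∀ i j : Fin q, |H i.succ j.succ - H i.castSucc j.castSucc| ≤ η) →
      (∀ j : Fin q, |H 0 j.succ - ∑ m, β m * H m j.castSucc| ≤ η) →
      |H.trace - 1| ≤ η → ∀ i j, |H i j - S i j| ≤ δ := by
  -- Compactness: counterexamples with tolerances 1/(n+1) have an entrywise convergent subsequence,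
  -- whose limit solves the equation at `β₀` exactly with trace one, hence is `S`.
  by_contra! hcon
  have hpos : ∀ n : ℕ, (0 : ℝ) < 1 / ((n : ℝ) + 1) := fun n => by positivity
  choose β H h1 h2 h3 h4 h5 h6 i' j' h7 using fun n : ℕ => hcon (1 / ((n : ℝ) + 1)) (hpos n)
  have hlim : Tendsto (fun n : ℕ => 1 / ((n : ℝ) + 1)) atTop (𝓝 0) :=
    tendsto_one_div_add_atTop_nhds_zero_nat
  have hβ : Tendsto β atTop (𝓝 β₀) :=
    tendsto_iff_dist_tendsto_zero.2 (squeeze_zero (fun _ => dist_nonneg) h1 hlim)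
  have hcpt : IsCompact (Set.univ.pi fun _ : Fin (q + 1) => Set.univ.pi fun _ : Fin (q + 1) =>
      Set.Icc (-B) B) := isCompact_univ_pi fun _ => isCompact_univ_pi fun _ => isCompact_Icc
  obtain ⟨M, -, φ, hφ, hM⟩ := hcpt.tendsto_subseq (x := fun n i j => H n i j)
    fun n i _ j _ => abs_le.1 (h2 n i j)
  have hMij : ∀ i j, Tendsto (fun n => H (φ n) i j) atTop (𝓝 (M i j)) := fun i j =>
    ((continuous_apply_apply i j).tendsto M).comp hM
  have hβj : ∀ j, Tendsto (fun n => β (φ n) j) atTop (𝓝 (β₀ j)) := fun j =>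
    ((PiLp.continuous_apply 2 _ j).tendsto β₀).comp (hβ.comp hφ.tendsto_atTop)
  have hlimφ := hlim.comp hφ.tendsto_atTop
  have hzero : ∀ {f : ℕ → ℝ} {x : ℝ}, Tendsto f atTop (𝓝 x) →
      (∀ n, |f n| ≤ 1 / ((φ n : ℝ) + 1)) → x = 0 := by
    intro f x hf hb
    exact tendsto_nhds_unique hf (squeeze_zero_norm hb hlimφ)
  have hStein : IsStein β₀ (Matrix.of M) := by
    refine ⟨fun i j => ?_, fun i j => ?_, fun j => ?_⟩
    · refine tendsto_nhds_unique (hMij i j) ?_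
      exact (hMij j i).congr fun n => h3 (φ n) j i
    · exact sub_eq_zero.1 (hzero ((hMij _ _).sub (hMij _ _)) fun n => h4 (φ n) i j)
    · exact sub_eq_zero.1 (hzero ((hMij _ _).sub
        (tendsto_finsetSum _ fun m _ => (hβj m).mul (hMij _ _))) fun n => h5 (φ n) j)
  have htr : (Matrix.of M).trace = 1 := sub_eq_zero.1 (hzero
    ((tendsto_finsetSum _ fun i _ => hMij i i).sub_const 1) fun n => h6 (φ n))
  have hMS : ∀ i j, M i j = S i j := fun i j => congrFun₂ (hS _ hStein htr) i j
  have hev : ∀ᶠ n in atTop, ∀ i j, |H (φ n) i j - S i j| < δ := by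
    rw [eventually_all]
    intro i
    rw [eventually_all]
    intro j
    have := ((hMij i j).sub_const (S i j)).abs
    rw [hMS, sub_self, abs_zero] at this
    exact this.eventually_lt_const hδ
  obtain ⟨n, hn⟩ := hev.exists
  exact absurd (hn (i' (φ n)) (j' (φ n))) (not_lt.2 (h7 (φ n)).le)

/-- Positivity on e_i ± e_j with equal diagonal entries gives |S i j| ≤ S 0 0, and the trace bounds
S 0 0. The bound does not depend on `β`, as the compactness argument requires. -/
lemma abs_apply_le_of_posDef {q : ℕ} {β : EuclideanSpace ℝ (Fin (q + 1))}
    {S : Matrix (Fin (q + 1)) (Fin (q + 1)) ℝ} (hS : S.PosDef) (h : IsStein β S)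
    (htr : S.trace = 1) (i j : Fin (q + 1)) : |S i j| ≤ 1 := by
  have h00 : S 0 0 ≤ 1 := by
    have h1 := h.trace
    have h2 := hS.diag_pos (i := 0)
    rw [htr] at h1
    have : (0 : ℝ) ≤ q := by positivity
    nlinarith
  have hx : ∀ s : ℝ, 0 ≤ (1 + s ^ 2) * S 0 0 + 2 * s * S i j := by
    intro s
    have := hS.posSemidef.dotProduct_mulVec_nonneg (Pi.single i 1 + s • Pi.single j 1)
    simp only [star_trivial, Matrix.mulVec_add, Matrix.mulVec_smul, dotProduct_add,
      add_dotProduct, smul_dotProduct, dotProduct_smul, Matrix.mulVec_single_one,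
      single_dotProduct, smul_eq_mul, Matrix.col_apply, one_mul] at this
    rw [h.diag i, h.diag j, h.symm j i] at this
    linarith
  rw [abs_le]
  constructor
  · linarith [hx 1]
  · linarith [hx (-1)]

/-- Locally uniform power bound for the recursion. -/
lemma exists_forall_norm_path_le {q : ℕ} {β₀ : EuclideanSpace ℝ (Fin (q + 1))}
    (hβ₀ : β₀ ∈ region (q + 1)) :
    ∃ C > 0, ∃ ρ > 0, ∀ β ∈ region (q + 1), dist β β₀ ≤ ρ →
      ∀ (z : ℕ → EuclideanSpace ℝ (Fin (q + 1))) (u : ℕ → ℝ),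
      (∀ k, z (k + 1) = step β (z k) (u k)) → ∀ j k,
      ‖z (j + k)‖ ≤ C * (‖z j‖ + ∑ i ∈ Finset.range k, |u (j + i)|) := by
  obtain ⟨S₀, hpd, -, -, hu⟩ := exists_stein_of_mem_region hβ₀
  obtain ⟨a, ha, hlow⟩ := exists_le_quad hpd
  have hq : (0 : ℝ) < q + 1 := by positivity
  -- Entries within a/(2(q+1)) change the form by at most (a/2)‖v‖², so the lower bound a/2 survives
  -- for nearby parameters.
  obtain ⟨ρ, hρ, hclose⟩ := exists_forall_stein_close hu 1
    (show 0 < a / (2 * (q + 1)) by positivity)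
  refine ⟨√((1 * (q + 1)) / (a / 2)), Real.sqrt_pos.2 (by positivity), ρ, hρ, ?_⟩
  intro β hβ hdist z u hz
  obtain ⟨S, hSpd, hSt, htr, -⟩ := exists_stein_of_mem_region hβ
  have hent := abs_apply_le_of_posDef hSpd hSt htr
  have hSS := hclose β S hdist hent hSt.symm (fun i j => by rw [hSt.shift]; simpa using hρ.le)
    (fun j => by rw [hSt.yuleWalker]; simpa using hρ.le) (by rw [htr]; simpa using hρ.le)
  refine norm_path_le (S := S) (by positivity) ?_ ?_ ?_ hz
  · intro v
    have h1 := abs_quad_le (S := S - S₀) (fun i j => by simpa using hSS i j) v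
    have h2 : quad (S - S₀) v = quad S v - quad S₀ v := by
      simp only [quad, Matrix.sub_apply, ← Finset.sum_sub_distrib]
      exact Finset.sum_congr rfl fun i _ => Finset.sum_congr rfl fun j _ => by ring
    have h3 : a / (2 * (q + 1)) * (q + 1) * ‖v‖ ^ 2 = a / 2 * ‖v‖ ^ 2 := by field_simp
    rw [h2, h3] at h1
    have := (abs_le.1 h1).1
    linarith [hlow v]
  · intro v
    exact (le_abs_self _).trans (abs_quad_le hent v)
  · intro v
    rw [quad_backShift hSt]
    have := quad_le_of_rootsInClosedDisc hSt hSpd hβ.1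
    nlinarith [sq_nonneg (v 0)]

end

end SLS

namespace SLS

noncomputable section

/-! ### Deterministic analysis of one path -/

/-- The energy `∑_{i < k} ‖z i‖ ^ 2` collected before time `k`. -/
def energy {q : ℕ} (z : ℕ → EuclideanSpace ℝ (Fin (q + 1))) (k : ℕ) : ℝ :=
  ∑ i ∈ Finset.range k, ‖z i‖ ^ 2

/-- The normalised states up to the level `c` of the energy. States of norm above `√c` are
discarded, which bounds the total energy. -/
def trunc {q : ℕ} (c : ℝ) (z : ℕ → EuclideanSpace ℝ (Fin (q + 1))) (k : ℕ) :
    EuclideanSpace ℝ (Fin (q + 1)) :=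
  open Classical in if energy z k < c ∧ ‖z k‖ ^ 2 ≤ c then (√c)⁻¹ • z k else 0

/-- The Gram matrix of the first `N` vectors. -/
def gram {q : ℕ} (y : ℕ → EuclideanSpace ℝ (Fin (q + 1))) (N : ℕ) :
    Matrix (Fin (q + 1)) (Fin (q + 1)) ℝ :=
  Matrix.of fun i j => ∑ k ∈ Finset.range N, y k i * y k j

variable {q : ℕ} {z : ℕ → EuclideanSpace ℝ (Fin (q + 1))}

lemma energy_succ (k : ℕ) : energy z (k + 1) = energy z k + ‖z k‖ ^ 2 :=
  Finset.sum_range_succ _ _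

lemma energy_mono : Monotone (energy z) :=
  monotone_nat_of_le_succ fun k => by rw [energy_succ]; linarith [sq_nonneg ‖z k‖]

lemma norm_inv_sqrt_smul_sq {c : ℝ} (hc : 0 < c) (x : EuclideanSpace ℝ (Fin (q + 1))) :
    ‖(√c)⁻¹ • x‖ ^ 2 = ‖x‖ ^ 2 / c := by
  rw [norm_smul, mul_pow, norm_inv, Real.norm_of_nonneg (Real.sqrt_nonneg _), inv_pow,
    Real.sq_sqrt hc.le, div_eq_inv_mul]

/-- At a retained state the earlier energy is below c and the state itself contributes at most c,
hence 2. The bound holds on every path, as the central limit theorem demands of its weights. -/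
lemma sum_norm_trunc_sq_le {c : ℝ} (hc : 0 < c) (M : ℕ) :
    ∑ k ∈ Finset.range M, ‖trunc c z k‖ ^ 2 ≤ 2 := by
  suffices h : ∑ k ∈ Finset.range M, ‖trunc c z k‖ ^ 2 ≤ 2 ∧
      ∑ k ∈ Finset.range M, ‖trunc c z k‖ ^ 2 ≤ energy z M / c from h.1
  induction M with
  | zero => simp [energy]
  | succ M ih =>
    obtain ⟨h1, h2⟩ := ih
    rw [Finset.sum_range_succ, energy_succ, add_div]
    have h3 : ‖trunc c z M‖ ^ 2 ≤ ‖z M‖ ^ 2 / c := by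
      unfold trunc
      split_ifs
      · exact (norm_inv_sqrt_smul_sq hc _).le
      · rw [norm_zero, zero_pow two_ne_zero]; positivity
    refine ⟨?_, add_le_add h2 h3⟩
    by_cases h4 : energy z M < c ∧ ‖z M‖ ^ 2 ≤ c
    · have h5 : energy z M / c ≤ 1 := (div_le_one hc).2 h4.1.le
      have h6 : ‖z M‖ ^ 2 / c ≤ 1 := (div_le_one hc).2 h4.2
      linarith
    · have : trunc c z M = 0 := by rw [trunc, if_neg h4]
      rw [this]
      simpa using h1

/-- States met before the energy reaches `c` are small compared with `√c`, if the innovations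
and the initial state are. -/
lemma exists_forall_norm_sq_le (q : ℕ) {C δ : ℝ} (hC : 0 < C) (hδ : 0 < δ) :
    ∃ η > 0, ∀ (z : ℕ → EuclideanSpace ℝ (Fin (q + 1))) (u : ℕ → ℝ) (c : ℝ) (N : ℕ), 0 < c →
      (∀ j k, ‖z (j + k)‖ ≤ C * (‖z j‖ + ∑ i ∈ Finset.range k, |u (j + i)|)) →
      ‖z 0‖ ≤ η * √c → (∀ k < N, |u k| ≤ η * √c) →
      ∀ k ≤ N, energy z k < c → ‖z k‖ ^ 2 ≤ δ * c := by
  -- A window of `m` states with energy at most c contributes 2C²c/m ≤ δc/2 on average; `η` below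
  -- makes the start and `m` innovations contribute no more than the rest.
  obtain ⟨m, hm⟩ := exists_nat_ge (4 * C ^ 2 / δ)
  have hm' : 4 * C ^ 2 ≤ m * δ := (div_le_iff₀ hδ).1 hm
  have hm0 : (0 : ℝ) < m := by
    have : 0 < 4 * C ^ 2 / δ := by positivity
    linarith
  set η := √δ / (2 * C * (m + 1)) with hηdef
  have hη : 0 < η := by positivity
  have hη2 : 4 * C ^ 2 * (m + 1) ^ 2 * η ^ 2 = δ := by
    rw [hηdef, div_pow, Real.sq_sqrt hδ.le]
    field_simp
    ring
  refine ⟨η, hη, fun z u c N hc hz h0 hu k hk hek => ?_⟩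
  have hs : √c ^ 2 = c := Real.sq_sqrt hc.le
  have hsum : ∀ j n : ℕ, n ≤ m → j + n ≤ N → ∑ i ∈ Finset.range n, |u (j + i)| ≤ m * (η * √c) := by
    intro j n hn hjn
    calc ∑ i ∈ Finset.range n, |u (j + i)| ≤ ∑ i ∈ Finset.range n, η * √c :=
          Finset.sum_le_sum fun i hi => hu _ (by have := Finset.mem_range.1 hi; omega)
      _ = n * (η * √c) := by simp
      _ ≤ m * (η * √c) := by gcongr
  rcases lt_or_ge k m with hkm | hkm
  · have h1 : ‖z k‖ ≤ C * ((m + 1) * (η * √c)) := by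
      have h2 := hz 0 k
      have h3 := hsum 0 k hkm.le (by omega)
      rw [zero_add] at h2
      refine h2.trans ?_
      gcongr
      linarith
    calc ‖z k‖ ^ 2 ≤ (C * ((m + 1) * (η * √c))) ^ 2 := by gcongr
      _ = (C ^ 2 * (m + 1) ^ 2 * η ^ 2) * √c ^ 2 := by ring
      _ ≤ δ * c := by
        rw [hs]
        have : 0 ≤ C ^ 2 * (m + 1) ^ 2 * η ^ 2 := by positivity
        gcongr
        linarith
  -- Compare the state with each of its `m` predecessors and add up; their total energy is below c.
  · have h1 : ∀ j ∈ Finset.Ico (k - m) k, ‖z k‖ ^ 2 ≤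
        2 * C ^ 2 * ‖z j‖ ^ 2 + 2 * C ^ 2 * (m * (η * √c)) ^ 2 := by
      intro j hj
      have hj' := Finset.mem_Ico.1 hj
      have h2 := hz j (k - j)
      rw [Nat.add_sub_cancel' hj'.2.le] at h2
      have h3 := hsum j (k - j) (by omega) (by omega)
      have h4 : ‖z k‖ ≤ C * (‖z j‖ + m * (η * √c)) := h2.trans (by gcongr)
      calc ‖z k‖ ^ 2 ≤ (C * (‖z j‖ + m * (η * √c))) ^ 2 := by gcongr
        _ = C ^ 2 * (‖z j‖ + m * (η * √c)) ^ 2 := by ring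
        _ ≤ C ^ 2 * (2 * (‖z j‖ ^ 2 + (m * (η * √c)) ^ 2)) := by
          gcongr
          exact add_sq_le
        _ = _ := by ring
    have h2 := Finset.sum_le_sum h1
    rw [Finset.sum_add_distrib, ← Finset.mul_sum, Finset.sum_const, Finset.sum_const,
      Nat.card_Ico, Nat.sub_sub_self hkm, nsmul_eq_mul, nsmul_eq_mul] at h2
    have h3 : ∑ j ∈ Finset.Ico (k - m) k, ‖z j‖ ^ 2 ≤ c := by
      refine le_trans ?_ hek.le
      exact Finset.sum_le_sum_of_subset_of_nonneg
        (fun j hj => Finset.mem_range.2 (Finset.mem_Ico.1 hj).2) fun _ _ _ => sq_nonneg _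
    have h4 : 2 * C ^ 2 * (m * (η * √c)) ^ 2 ≤ δ / 2 * c := by
      calc 2 * C ^ 2 * (m * (η * √c)) ^ 2 = 2 * C ^ 2 * m ^ 2 * η ^ 2 * √c ^ 2 := by ring
        _ ≤ 2 * C ^ 2 * (m + 1) ^ 2 * η ^ 2 * √c ^ 2 := by gcongr; linarith
        _ = (4 * C ^ 2 * (m + 1) ^ 2 * η ^ 2) / 2 * √c ^ 2 := by ring
        _ = δ / 2 * c := by rw [hη2, hs]
    have h5 : m * ‖z k‖ ^ 2 ≤ m * (δ * c) := by
      calc m * ‖z k‖ ^ 2 ≤ 2 * C ^ 2 * ∑ j ∈ Finset.Ico (k - m) k, ‖z j‖ ^ 2 +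
            m * (2 * C ^ 2 * (m * (η * √c)) ^ 2) := h2
        _ ≤ 2 * C ^ 2 * c + m * (δ / 2 * c) := by gcongr
        _ ≤ m * δ / 2 * c + m * (δ / 2 * c) := by gcongr; linarith
        _ = m * (δ * c) := by ring
    exact le_of_mul_le_mul_left h5 hm0

/-- The innovations are controlled by the energy. -/
lemma sum_sq_innovation_le {β : EuclideanSpace ℝ (Fin (q + 1))} {u : ℕ → ℝ}
    (hz : ∀ k, z (k + 1) = step β (z k) (u k)) (M : ℕ) :
    ∑ k ∈ Finset.range M, u k ^ 2 ≤ 2 * (1 + ‖β‖ ^ 2) * energy z (M + 1) := by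
  have h1 : ∀ k, u k ^ 2 ≤ 2 * ‖z (k + 1)‖ ^ 2 + 2 * ‖β‖ ^ 2 * ‖z k‖ ^ 2 := by
    intro k
    have h2 : u k = z (k + 1) 0 - ∑ j, β j * z k j := by rw [hz, step_zero]; ring
    have h3 : |z (k + 1) 0| ≤ ‖z (k + 1)‖ := PiLp.norm_apply_le (z (k + 1)) 0
    have h4 : |∑ j, β j * z k j| ≤ ‖β‖ * ‖z k‖ := by
      have := abs_real_inner_le_norm β (z k)
      simpa [PiLp.inner_apply, mul_comm] using this
    have h5 : |u k| ≤ ‖z (k + 1)‖ + ‖β‖ * ‖z k‖ := by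
      rw [h2]
      exact (abs_sub _ _).trans (add_le_add h3 h4)
    calc u k ^ 2 = |u k| ^ 2 := (sq_abs _).symm
      _ ≤ (‖z (k + 1)‖ + ‖β‖ * ‖z k‖) ^ 2 := by gcongr
      _ ≤ 2 * (‖z (k + 1)‖ ^ 2 + (‖β‖ * ‖z k‖) ^ 2) := add_sq_le
      _ = _ := by ring
  have h2 : ∑ k ∈ Finset.range M, ‖z (k + 1)‖ ^ 2 ≤ energy z (M + 1) := by
    rw [energy, Finset.sum_range_succ']
    linarith [sq_nonneg ‖z 0‖]
  have h3 : ∑ k ∈ Finset.range M, ‖z k‖ ^ 2 ≤ energy z (M + 1) := energy_mono M.le_succ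
  calc ∑ k ∈ Finset.range M, u k ^ 2
      ≤ ∑ k ∈ Finset.range M, (2 * ‖z (k + 1)‖ ^ 2 + 2 * ‖β‖ ^ 2 * ‖z k‖ ^ 2) :=
        Finset.sum_le_sum fun k _ => h1 k
    _ = 2 * ∑ k ∈ Finset.range M, ‖z (k + 1)‖ ^ 2 +
        2 * ‖β‖ ^ 2 * ∑ k ∈ Finset.range M, ‖z k‖ ^ 2 := by
        rw [Finset.sum_add_distrib, Finset.mul_sum, Finset.mul_sum]
    _ ≤ 2 * energy z (M + 1) + 2 * ‖β‖ ^ 2 * energy z (M + 1) := by gcongr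
    _ = _ := by ring

/-- Description of the normalised path at the time `T` when its energy reaches the level `c`. -/
structure IsHit (c : ℝ) (z : ℕ → EuclideanSpace ℝ (Fin (q + 1))) (N T : ℕ) : Prop where
  lt : T < N
  energy_lt : ∀ k ≤ T, energy z k < c
  le_energy : c ≤ energy z (T + 1)
  trunc_eq : ∀ k ≤ T, trunc c z k = (√c)⁻¹ • z k
  trunc_eq_zero : ∀ k, T < k → trunc c z k = 0

/-- `energy z k` counts the states before `k`, so the first index with energy at least c is T + 1,
where T is the elapsed time τ_c - l. Smallness of the states ensures that truncation discards none
of the block. -/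
lemma exists_isHit {c : ℝ} (hc : 0 < c) {N : ℕ} (hN : c ≤ energy z N)
    (hsmall : ∀ k ≤ N, energy z k < c → ‖z k‖ ^ 2 ≤ c) : ∃ T, IsHit c z N T := by
  classical
  have hex : ∃ k, c ≤ energy z k := ⟨N, hN⟩
  obtain ⟨T, hT⟩ : ∃ T, Nat.find hex = T + 1 := by
    refine Nat.exists_eq_succ_of_ne_zero fun h0 => ?_
    have := Nat.find_spec hex
    rw [h0] at this
    simp [energy] at this
    linarith
  have hfind : Nat.find hex ≤ N := Nat.find_min' hex hN
  have hlt : ∀ k ≤ T, energy z k < c := fun k hk =>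
    not_le.1 (Nat.find_min hex (by omega))
  have hle : c ≤ energy z (T + 1) := hT ▸ Nat.find_spec hex
  refine ⟨T, by omega, hlt, hle, fun k hk => ?_, fun k hk => ?_⟩
  · rw [trunc, if_pos ⟨hlt k hk, hsmall k (by omega) (hlt k hk)⟩]
  · rw [trunc, if_neg]
    rintro ⟨h, -⟩
    exact absurd (hle.trans (energy_mono hk)) (not_le.2 h)

/-- Turns a randomly stopped sum into a predictable sum of deterministic length, the form the limit
theorem handles. -/
lemma IsHit.sum_eq {c : ℝ} {N T : ℕ} (h : IsHit c z N T) {E : Type*} [AddCommMonoid E]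
    (f : ℕ → EuclideanSpace ℝ (Fin (q + 1)) → E) (hf : ∀ k, f k 0 = 0) :
    ∑ k ∈ Finset.range N, f k (trunc c z k) = ∑ k ∈ Finset.range (T + 1), f k ((√c)⁻¹ • z k) := by
  have hsub : Finset.range (T + 1) ⊆ Finset.range N :=
    Finset.range_subset_range.2 h.lt
  rw [← Finset.sum_subset hsub fun k _ hk => ?_]
  · refine Finset.sum_congr rfl fun k hk => ?_
    rw [h.trunc_eq k (by have := Finset.mem_range.1 hk; omega)]
  · rw [h.trunc_eq_zero k (by simp at hk; omega), hf]

lemma IsHit.gram_eq {c : ℝ} (hc : 0 < c) {N T : ℕ} (h : IsHit c z N T) (i j : Fin (q + 1)) :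
    gram (trunc c z) N i j = c⁻¹ * ∑ k ∈ Finset.range (T + 1), z k i * z k j := by
  rw [gram, Matrix.of_apply, h.sum_eq (fun _ x => x i * x j) (by simp), Finset.mul_sum]
  refine Finset.sum_congr rfl fun k _ => ?_
  have : (√c)⁻¹ * (√c)⁻¹ = c⁻¹ := by rw [← mul_inv, Real.mul_self_sqrt hc.le]
  simp only [PiLp.smul_apply, smul_eq_mul, ← this]
  ring

lemma abs_mul_apply_le (x : EuclideanSpace ℝ (Fin (q + 1))) (i j : Fin (q + 1)) :
    |x i * x j| ≤ ‖x‖ ^ 2 := by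
  rw [abs_mul, sq]
  exact mul_le_mul (PiLp.norm_apply_le x i) (PiLp.norm_apply_le x j) (abs_nonneg _) (norm_nonneg _)

lemma abs_gram_trunc_le {c : ℝ} (hc : 0 < c) (N : ℕ) (i j : Fin (q + 1)) :
    |gram (trunc c z) N i j| ≤ 2 := by
  rw [gram, Matrix.of_apply]
  refine (Finset.abs_sum_le_sum_abs _ _).trans (le_trans ?_ (sum_norm_trunc_sq_le (z := z) hc N))
  exact Finset.sum_le_sum fun k _ => abs_mul_apply_le _ i j

/-- The normalised Gram matrix at the hitting time nearly solves the Stein equation. -/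
lemma IsHit.stein_approx {β : EuclideanSpace ℝ (Fin (q + 1))} {u : ℕ → ℝ}
    (hz : ∀ k, z (k + 1) = step β (z k) (u k)) {c δ δ' : ℝ} (hc : 0 < c) {N T : ℕ}
    (h : IsHit c z N T) (h0 : ‖z 0‖ ^ 2 ≤ δ * c) (hT : ‖z T‖ ^ 2 ≤ δ * c)
    (hT1 : ‖z (T + 1)‖ ^ 2 ≤ δ * c)
    (hscore : ∀ j, |∑ k ∈ Finset.range N, u k * trunc c z k j| ≤ δ' * √c) :
    (∀ i j : Fin q, |gram (trunc c z) N i.succ j.succ -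
      gram (trunc c z) N i.castSucc j.castSucc| ≤ 2 * δ) ∧
    (∀ j : Fin q, |gram (trunc c z) N 0 j.succ -
      ∑ m, β m * gram (trunc c z) N m j.castSucc| ≤ 2 * δ + δ') ∧
    |(gram (trunc c z) N).trace - 1| ≤ δ := by
  have hbd : ∀ i j, |z 0 i * z 0 j - z (T + 1) i * z (T + 1) j| ≤ 2 * δ * c := by
    intro i j
    refine (abs_sub _ _).trans ?_
    have := abs_mul_apply_le (z 0) i j
    have := abs_mul_apply_le (z (T + 1)) i j
    linarith
  -- Advancing the time index by one costs only the two boundary terms.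
  have htel : ∀ i j, ∑ k ∈ Finset.range (T + 1), z k i * z k j =
      ∑ k ∈ Finset.range (T + 1), z (k + 1) i * z (k + 1) j +
        (z 0 i * z 0 j - z (T + 1) i * z (T + 1) j) := by
    intro i j
    have h1 := Finset.sum_range_succ (fun k => z k i * z k j) (T + 1)
    have h2 := Finset.sum_range_succ' (fun k => z k i * z k j) (T + 1)
    linarith
  have hci : ∀ {x y : ℝ}, |x| ≤ y * c → |c⁻¹ * x| ≤ y := by
    intro x y hxy
    rw [abs_mul, abs_of_pos (inv_pos.2 hc), ← div_eq_inv_mul]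
    exact (div_le_iff₀ hc).2 hxy
  refine ⟨fun i j => ?_, fun j => ?_, ?_⟩
  · rw [h.gram_eq hc, h.gram_eq hc, ← mul_sub, htel]
    have : ∑ k ∈ Finset.range (T + 1), z (k + 1) i.succ * z (k + 1) j.succ =
        ∑ k ∈ Finset.range (T + 1), z k i.castSucc * z k j.castSucc :=
      Finset.sum_congr rfl fun k _ => by rw [hz, step_succ, step_succ]
    rw [this, add_sub_cancel_left]
    exact hci (hbd _ _)
  · have e1 : ∑ k ∈ Finset.range (T + 1), z (k + 1) 0 * z (k + 1) j.succ =
        ∑ m, β m * ∑ k ∈ Finset.range (T + 1), z k m * z k j.castSucc +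
          ∑ k ∈ Finset.range (T + 1), u k * z k j.castSucc := by
      have : ∀ m, β m * ∑ k ∈ Finset.range (T + 1), z k m * z k j.castSucc =
          ∑ k ∈ Finset.range (T + 1), β m * z k m * z k j.castSucc := fun m => by
        rw [Finset.mul_sum]
        exact Finset.sum_congr rfl fun k _ => by ring
      simp_rw [this]
      rw [Finset.sum_comm, ← Finset.sum_add_distrib]
      refine Finset.sum_congr rfl fun k _ => ?_
      rw [hz, step_zero, step_succ, add_mul, Finset.sum_mul]
    have e2 : ∑ k ∈ Finset.range (T + 1), u k * z k j.castSucc =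
        √c * ∑ k ∈ Finset.range N, u k * trunc c z k j.castSucc := by
      rw [h.sum_eq (fun k x => u k * x j.castSucc) (by simp), Finset.mul_sum]
      refine Finset.sum_congr rfl fun k _ => ?_
      have : √c * (√c)⁻¹ = 1 := mul_inv_cancel₀ (Real.sqrt_pos.2 hc).ne'
      simp only [PiLp.smul_apply, smul_eq_mul]
      linear_combination (- u k * z k j.castSucc) * this
    have e3 : gram (trunc c z) N 0 j.succ - ∑ m, β m * gram (trunc c z) N m j.castSucc =
        c⁻¹ * (√c * (∑ k ∈ Finset.range N, u k * trunc c z k j.castSucc) +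
          (z 0 0 * z 0 j.succ - z (T + 1) 0 * z (T + 1) j.succ)) := by
      have : ∀ m, β m * gram (trunc c z) N m j.castSucc =
          c⁻¹ * (β m * ∑ k ∈ Finset.range (T + 1), z k m * z k j.castSucc) := fun m => by
        rw [h.gram_eq hc]; ring
      simp_rw [this]
      rw [← Finset.mul_sum, h.gram_eq hc, htel, e1, e2]
      ring
    rw [e3]
    apply hci
    refine (abs_add_le _ _).trans ?_
    have h3 : |√c * (∑ k ∈ Finset.range N, u k * trunc c z k j.castSucc)| ≤ δ' * c := by
      rw [abs_mul, abs_of_nonneg (Real.sqrt_nonneg c)]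
      calc _ ≤ √c * (δ' * √c) := by gcongr; exact hscore _
        _ = δ' * (√c * √c) := by ring
        _ = _ := by rw [Real.mul_self_sqrt hc.le]
    linarith [hbd 0 j.succ]
  -- The deviation of the trace from 1 is the overshoot of the stopping rule, at most ‖z T‖²/c.
  · have e1 : (gram (trunc c z) N).trace = c⁻¹ * energy z (T + 1) := by
      simp only [Matrix.trace, Matrix.diag, h.gram_eq hc, ← Finset.mul_sum]
      rw [Finset.sum_comm]
      simp only [energy, EuclideanSpace.real_norm_sq_eq, ← sq]
    have e2 : c⁻¹ * energy z (T + 1) - 1 = c⁻¹ * (energy z (T + 1) - c) := by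
      rw [mul_sub, inv_mul_cancel₀ hc.ne']
    rw [e1, e2]
    apply hci
    have h1 := h.energy_lt T le_rfl
    have h2 := h.le_energy
    have h3 := energy_succ (z := z) T
    rw [abs_of_nonneg (by linarith)]
    linarith

end

end SLS

namespace SLS

noncomputable section

/-! ### The inverse square root of a symmetric matrix -/

/-- The inverse square root of a symmetric matrix (zero on the kernel). -/
def rsqrt {p : ℕ} (A : Matrix (Fin p) (Fin p) ℝ) : Matrix (Fin p) (Fin p) ℝ :=
  cfc (fun s : ℝ => (√s)⁻¹) A

lemma continuousOn_spectrum {p : ℕ} (f : ℝ → ℝ) (A : Matrix (Fin p) (Fin p) ℝ) :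
    ContinuousOn f (spectrum ℝ A) :=
  Matrix.finite_real_spectrum.continuousOn f

/-- √s · s⁻¹ = (√s)⁻¹ for every real s, the conventions at s ≤ 0 included, so no hypothesis on `A`
is needed. -/
lemma msqrt_mul_pinv {p : ℕ} (A : Matrix (Fin p) (Fin p) ℝ) : msqrt A * pinv A = rsqrt A := by
  rw [msqrt, pinv, ← cfc_mul _ _ A (continuousOn_spectrum _ A) (continuousOn_spectrum _ A), rsqrt]
  congr 1
  ext s
  rw [← div_eq_mul_inv, Real.sqrt_div_self', one_div]

/-- The square root vanishes on the kernel; hence `β` cancels from the normalised error even for a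
singular Gram matrix. -/
lemma msqrt_mul_pinv_mul {p : ℕ} {A : Matrix (Fin p) (Fin p) ℝ} (hA : A.IsHermitian) :
    msqrt A * pinv A * A = msqrt A := by
  conv_lhs =>
    rw [← cfc_id ℝ A hA.isSelfAdjoint, msqrt_mul_pinv, rsqrt,
      cfc_id ℝ A hA.isSelfAdjoint]
    rhs
    rw [← cfc_id ℝ A hA.isSelfAdjoint]
  rw [← cfc_mul _ _ A (continuousOn_spectrum _ A) (continuousOn_spectrum _ A), msqrt]
  congr 1
  ext s
  rw [id, ← div_eq_inv_mul, Real.div_sqrt]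

lemma rsqrt_smul {p : ℕ} {A : Matrix (Fin p) (Fin p) ℝ} (hA : A.IsHermitian) {c : ℝ} (hc : 0 ≤ c) :
    rsqrt (c • A) = (√c)⁻¹ • rsqrt A := by
  rw [rsqrt, ← cfc_comp_smul c _ A
    ((Matrix.finite_real_spectrum.image _).continuousOn _) hA.isSelfAdjoint, rsqrt,
    ← cfc_smul _ _ A (continuousOn_spectrum _ A)]
  congr 1
  ext s
  rw [smul_eq_mul, smul_eq_mul, Real.sqrt_mul hc, mul_inv]

lemma isHermitian_rsqrt {p : ℕ} (A : Matrix (Fin p) (Fin p) ℝ) : (rsqrt A).IsHermitian :=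
  (cfc_predicate _ A : IsSelfAdjoint (rsqrt A))

lemma spectrum_subset_Ioi {p : ℕ} {A : Matrix (Fin p) (Fin p) ℝ} (hA : A.PosDef) :
    spectrum ℝ A ⊆ Set.Ioi 0 := by
  rw [hA.isHermitian.spectrum_real_eq_range_eigenvalues]
  rintro _ ⟨i, rfl⟩
  exact hA.eigenvalues_pos i

lemma rsqrt_mul_mul_rsqrt {p : ℕ} {A : Matrix (Fin p) (Fin p) ℝ} (hA : A.PosDef) :
    rsqrt A * A * rsqrt A = 1 := by
  have h : cfc (fun s : ℝ => (√s)⁻¹ * s * (√s)⁻¹) A = rsqrt A * A * rsqrt A := by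
    rw [cfc_mul _ _ A (continuousOn_spectrum _ A) (continuousOn_spectrum _ A),
      cfc_mul _ _ A (continuousOn_spectrum _ A) (continuousOn_spectrum _ A),
      cfc_id' ℝ A hA.isHermitian.isSelfAdjoint, rsqrt]
  rw [← h, ← cfc_one ℝ A hA.isHermitian.isSelfAdjoint]
  refine cfc_congr fun s hs => ?_
  have hs' : 0 < s := spectrum_subset_Ioi hA hs
  have h1 : √s ≠ 0 := (Real.sqrt_pos.2 hs').ne'
  change (√s)⁻¹ * s * (√s)⁻¹ = 1
  field_simp
  exact (Real.sq_sqrt hs'.le).symm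

open scoped Matrix.Norms.L2Operator in
/-- The inverse square root is continuous at positive definite matrices. -/
lemma exists_forall_rsqrt_close {p : ℕ} {S : Matrix (Fin p) (Fin p) ℝ} (hS : S.PosDef) {δ : ℝ}
    (hδ : 0 < δ) :
    ∃ η > 0, ∀ H : Matrix (Fin p) (Fin p) ℝ, H.IsHermitian → (∀ i j, |H i j - S i j| ≤ η) →
      ∀ v : EuclideanSpace ℝ (Fin p),
        ‖WithLp.toLp 2 (Matrix.mulVec (rsqrt H) v) - WithLp.toLp 2 (Matrix.mulVec (rsqrt S) v)‖
          ≤ δ * ‖v‖ := by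
  -- A compact neighbourhood of the spectrum inside (0, ∞): the function is continuous there, and
  -- upper hemicontinuity keeps the spectra of nearby matrices in it.
  obtain ⟨K, hK, hSK, hK0⟩ := exists_compact_between
    (Matrix.finite_real_spectrum (A := S)).isCompact isOpen_Ioi (spectrum_subset_Ioi hS)
  have hcont : ContinuousOn (fun s : ℝ => (√s)⁻¹) K := by
    refine ContinuousOn.inv₀ Real.continuous_sqrt.continuousOn fun s hs => ?_
    exact (Real.sqrt_pos.2 (hK0 hs)).ne'
  have hspec : ∀ᶠ H in 𝓝 S, spectrum ℝ H ⊆ K := by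
    filter_upwards [(upperHemicontinuous_spectrum ℝ (Matrix (Fin p) (Fin p) ℝ)).upperHemicontinuousAt
      S K (subset_interior_iff_mem_nhdsSet.1 hSK)] with H hH using subset_of_mem_nhdsSet hH
  have htend : Tendsto (fun H => rsqrt H) (𝓝[{H | IsSelfAdjoint H}] S) (𝓝 (rsqrt S)) :=
    Filter.Tendsto.cfc hK _ (tendsto_id.mono_left nhdsWithin_le_nhds)
      (nhdsWithin_le_nhds hspec) self_mem_nhdsWithin (hSK.trans interior_subset)
      hS.isHermitian.isSelfAdjoint hcont
  have hev : ∀ᶠ H in 𝓝 S, IsSelfAdjoint H → ‖rsqrt H - rsqrt S‖ ≤ δ := by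
    have := (tendsto_iff_norm_sub_tendsto_zero.1 htend).eventually_le_const hδ
    exact eventually_nhdsWithin_iff.1 this
  have hbasis : ∃ η > 0, ∀ H : Matrix (Fin p) (Fin p) ℝ, (∀ i j, |H i j - S i j| ≤ η) →
      IsSelfAdjoint H → ‖rsqrt H - rsqrt S‖ ≤ δ := by
    have hof : Tendsto (fun M : Fin p → Fin p → ℝ => Matrix.of M) (𝓝 fun i j => S i j) (𝓝 S) := by
      have : Continuous fun M : Fin p → Fin p → ℝ => Matrix.of M := continuous_id
      exact this.tendsto _
    obtain ⟨η, hη, hball⟩ := Metric.nhds_basis_closedBall.eventually_iff.1 (hof.eventually hev)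
    refine ⟨η, hη, fun H hH hsa => ?_⟩
    refine hball (x := fun i j => H i j) ?_ hsa
    rw [Metric.mem_closedBall, dist_pi_le_iff hη.le]
    intro i
    rw [dist_pi_le_iff hη.le]
    exact fun j => hH i j
  obtain ⟨η, hη, hη'⟩ := hbasis
  refine ⟨η, hη, fun H hH hcl v => ?_⟩
  have h1 := Matrix.l2_opNorm_mulVec (rsqrt H - rsqrt S) v
  rw [Matrix.sub_mulVec] at h1
  refine h1.trans ?_
  gcongr
  exact hη' H hcl hH.isSelfAdjoint

/-! ### The normalised error of the estimator -/

lemma sum_Icc_add_natCast {E : Type*} [AddCommMonoid E] (f : ℤ → E) (l : ℤ) (T : ℕ) :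
    ∑ i ∈ Finset.Icc l (l + T), f i = ∑ k ∈ Finset.range (T + 1), f (l + k) := by
  symm
  refine Finset.sum_bij (fun k _ => l + (k : ℤ)) ?_ ?_ ?_ (fun _ _ => rfl)
  · intro k hk
    have := Finset.mem_range.1 hk
    rw [Finset.mem_Icc]
    omega
  · intro a _ b _ h
    simpa using h
  · intro i hi
    have := Finset.mem_Icc.1 hi
    exact ⟨(i - l).toNat, by rw [Finset.mem_range]; omega, by omega⟩

variable {q : ℕ} {z : ℕ → EuclideanSpace ℝ (Fin (q + 1))}

lemma IsHit.stopTime_eq {c : ℝ} {N T : ℕ} (h : IsHit c z N T) {x : ℤ → ℝ} {l : ℤ}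
    (hx : ∀ k : ℕ, lagVector (q + 1) x (l + k) = z k) : stopTime (q + 1) x l c = l + T := by
  have he : ∀ k : ℕ, ∑ i ∈ Finset.Icc l (l + k), ‖lagVector (q + 1) x i‖ ^ 2 = energy z (k + 1) := by
    intro k
    rw [sum_Icc_add_natCast (fun i => ‖lagVector (q + 1) x i‖ ^ 2), energy]
    simp only [hx]
  refine IsLeast.csInf_eq ⟨⟨by omega, ?_⟩, ?_⟩
  · rw [he]
    exact h.le_energy
  · rintro t ⟨ht1, ht2⟩
    by_contra hlt
    obtain ⟨k, hk⟩ : ∃ k : ℕ, t = l + k := ⟨(t - l).toNat, by omega⟩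
    rw [hk, he] at ht2
    exact absurd ht2 (not_le.2 (h.energy_lt (k + 1) (by omega)))

lemma isHermitian_gram (y : ℕ → EuclideanSpace ℝ (Fin (q + 1))) (N : ℕ) :
    (gram y N).IsHermitian := by
  ext i j
  simp [gram, mul_comm]

/-- The normalised estimation error in terms of the normalised states. -/
lemma IsHit.normalizedError_eq {β : EuclideanSpace ℝ (Fin (q + 1))} {u : ℕ → ℝ} {c : ℝ}
    (hc : 0 < c) {N T : ℕ} (h : IsHit c z N T) {x : ℤ → ℝ} {l : ℤ}
    (hx : ∀ k : ℕ, lagVector (q + 1) x (l + k) = z k)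
    (hxu : ∀ k : ℕ, x (l + k) = ∑ j, β j * z k j + u k) :
    normalizedError β x l c = WithLp.toLp 2 (Matrix.mulVec (rsqrt (gram (trunc c z) N))
      (∑ k ∈ Finset.range N, u k • trunc c z k : EuclideanSpace ℝ (Fin (q + 1)))) := by
  have hst := h.stopTime_eq hx
  have hG : (design (q + 1) x l (l + T)).transpose * design (q + 1) x l (l + T) =
      c • gram (trunc c z) N := by
    ext i j
    rw [Matrix.smul_apply, h.gram_eq hc, smul_eq_mul, mul_inv_cancel_left₀ hc.ne',
      Matrix.mul_apply]
    simp only [Matrix.transpose_apply, design, Matrix.of_apply]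
    rw [Finset.sum_coe_sort (Finset.Icc l (l + (T : ℤ)))
      (fun t => lagVector (q + 1) x t i * lagVector (q + 1) x t j), sum_Icc_add_natCast]
    simp only [hx]
  set H := gram (trunc c z) N with hH
  have hHh : H.IsHermitian := isHermitian_gram _ _
  have hGh : (c • H).IsHermitian := by
    rw [Matrix.IsHermitian, Matrix.conjTranspose_smul, hHh.eq, star_trivial]
  have hs : √c * (√c)⁻¹ = 1 := mul_inv_cancel₀ (Real.sqrt_pos.2 hc).ne'
  -- Substitute the model into the normal equations: Γᵀ(x_l, …) = Gβ + √c v with G = ΓᵀΓ.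
  have hr : Matrix.mulVec (design (q + 1) x l (l + T)).transpose (response x l (l + T)) =
      Matrix.mulVec (c • H) β + √c • (∑ k ∈ Finset.range N, u k • trunc c z k :
        EuclideanSpace ℝ (Fin (q + 1))).ofLp := by
    ext j
    have e0 : Matrix.mulVec (design (q + 1) x l (l + T)).transpose (response x l (l + T)) j =
        ∑ k ∈ Finset.range (T + 1), z k j * (∑ m, β m * z k m + u k) := by
      simp only [Matrix.mulVec, dotProduct, Matrix.transpose_apply, design, Matrix.of_apply,
        response]
      rw [Finset.sum_coe_sort (Finset.Icc l (l + (T : ℤ)))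
        (fun t => lagVector (q + 1) x t j * x t), sum_Icc_add_natCast]
      simp only [hx, hxu]
    have e1 : √c * (∑ k ∈ Finset.range N, u k • trunc c z k :
        EuclideanSpace ℝ (Fin (q + 1))).ofLp j = ∑ k ∈ Finset.range (T + 1), z k j * u k := by
      rw [h.sum_eq (fun k x => u k • x) (by simp)]
      simp only [WithLp.ofLp_sum, Finset.sum_apply, PiLp.smul_apply, smul_eq_mul, Finset.mul_sum]
      refine Finset.sum_congr rfl fun k _ => ?_
      linear_combination (u k * z k j) * hs
    have e2 : Matrix.mulVec (c • H) β j = ∑ k ∈ Finset.range (T + 1), z k j * ∑ m, β m * z k m := by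
      simp only [Matrix.mulVec, dotProduct, Matrix.smul_apply, smul_eq_mul, hH, h.gram_eq hc,
        mul_inv_cancel_left₀ hc.ne', Finset.sum_mul, Finset.mul_sum]
      rw [Finset.sum_comm]
      exact Finset.sum_congr rfl fun k _ => Finset.sum_congr rfl fun m _ => by ring
    rw [Pi.add_apply, Pi.smul_apply, smul_eq_mul, e0, e1, e2, ← Finset.sum_add_distrib]
    exact Finset.sum_congr rfl fun k _ => by ring
  rw [normalizedError]
  congr 1
  have hest : (fun j => lsEstimate (q + 1) x l (stopTime (q + 1) x l c) j - β j) =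
      Matrix.mulVec (pinv (c • H)) (Matrix.mulVec (c • H) β + √c • (∑ k ∈ Finset.range N,
        u k • trunc c z k : EuclideanSpace ℝ (Fin (q + 1))).ofLp) - β.ofLp := by
    rw [hst, lsEstimate, hG, hr]
    rfl
  rw [hest, hst, hG, Matrix.mulVec_sub, Matrix.mulVec_mulVec, Matrix.mulVec_add,
    Matrix.mulVec_mulVec, msqrt_mul_pinv_mul hGh, add_sub_cancel_left, msqrt_mul_pinv,
    rsqrt_smul hHh hc.le, Matrix.smul_mulVec, Matrix.mulVec_smul, smul_smul, mul_comm, hs, one_smul]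

end

end SLS

namespace SLS

noncomputable section

/-! ### From characteristic functions to distribution functions, uniformly -/

lemma gaussianReal_Ioc_le (a t : ℝ) (ht : 0 ≤ t) :
    (gaussianReal 0 1).real (Set.Ioc a (a + t)) ≤ t := by
  have h1 : gaussianReal 0 1 (Set.Ioc a (a + t)) ≤ ENNReal.ofReal t := by
    rw [gaussianReal_apply _ one_ne_zero]
    calc ∫⁻ x in Set.Ioc a (a + t), gaussianPDF 0 1 x
        ≤ ∫⁻ _ in Set.Ioc a (a + t), 1 := by
          refine lintegral_mono fun x => ?_
          rw [gaussianPDF, ← ENNReal.ofReal_one]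
          apply ENNReal.ofReal_le_ofReal
          rw [gaussianPDFReal]
          have hpi : 1 ≤ √(2 * Real.pi * (1 : NNReal)) := by
            rw [Real.one_le_sqrt]
            have := Real.pi_gt_three
            simp only [NNReal.coe_one]
            linarith
          have h3 : Real.exp (-(x - 0) ^ 2 / (2 * (1 : NNReal))) ≤ 1 := by
            rw [Real.exp_le_one_iff]
            have : (0 : ℝ) ≤ (x - 0) ^ 2 := sq_nonneg _
            simp only [NNReal.coe_one]
            linarith
          exact mul_le_one₀ (inv_le_one_of_one_le₀ hpi) (Real.exp_pos _).le h3
      _ = ENNReal.ofReal t := by simp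
  exact ENNReal.toReal_le_of_le_ofReal ht h1

/-- Shift all coordinates by `t`. -/
def shiftBy {p : ℕ} (x : EuclideanSpace ℝ (Fin p)) (t : ℝ) : EuclideanSpace ℝ (Fin p) :=
  WithLp.toLp 2 fun j => x j + t

lemma measurableSet_orthant {p : ℕ} (x : EuclideanSpace ℝ (Fin p)) :
    MeasurableSet {v : EuclideanSpace ℝ (Fin p) | ∀ j, v j ≤ x j} := by
  have : {v : EuclideanSpace ℝ (Fin p) | ∀ j, v j ≤ x j} = ⋂ j, {v | v j ≤ x j} := by
    ext; simp
  rw [this]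
  exact MeasurableSet.iInter fun j => measurableSet_le (by fun_prop) measurable_const

/-- The larger orthant adds at most `p` slabs of width `t`, and the one-dimensional density is below
1. Uniformity in `x` of the final convergence rests on this. -/
lemma stdNormalCDF_shiftBy_le {p : ℕ} (x : EuclideanSpace ℝ (Fin p)) {t : ℝ} (ht : 0 ≤ t) :
    stdNormalCDF (shiftBy x t) ≤ stdNormalCDF x + p * t := by
  unfold stdNormalCDF jointCDF
  have hmarg : ∀ j : Fin p, (stdGaussian (EuclideanSpace ℝ (Fin p))).real
      {v | v j ∈ Set.Ioc (x j) (x j + t)} ≤ t := by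
    intro j
    have hmp := measurePreserving_eval_multivariateGaussian (μ := (0 : EuclideanSpace ℝ (Fin p)))
      (S := 1) Matrix.PosSemidef.one (i := j)
    rw [multivariateGaussian_zero_one] at hmp
    simp only [PiLp.zero_apply, Matrix.one_apply_eq, Real.toNNReal_one] at hmp
    have := hmp.measureReal_preimage (s := Set.Ioc (x j) (x j + t)) measurableSet_Ioc.nullMeasurableSet
    exact this.le.trans (gaussianReal_Ioc_le _ _ ht)
  have hsub : {v : EuclideanSpace ℝ (Fin p) | ∀ j, id v j ≤ shiftBy x t j} ⊆
      {v | ∀ j, id v j ≤ x j} ∪ ⋃ j ∈ (Finset.univ : Finset (Fin p)),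
        {v | v j ∈ Set.Ioc (x j) (x j + t)} := by
    intro v hv
    by_cases h : ∀ j, v j ≤ x j
    · exact Or.inl h
    · push Not at h
      obtain ⟨j, hj⟩ := h
      refine Or.inr (Set.mem_iUnion₂.2 ⟨j, Finset.mem_univ _, hj, hv j⟩)
  refine (measureReal_mono hsub).trans ((measureReal_union_le _ _).trans ?_)
  gcongr
  refine (measureReal_biUnion_finset_le _ _).trans ?_
  calc _ ≤ ∑ _j : Fin p, t := Finset.sum_le_sum fun j _ => hmarg j
    _ = p * t := by simp

/-- The law `N(0, σ² I)`. -/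
def scaledGaussian (p : ℕ) (σ : ℝ) : ProbabilityMeasure (EuclideanSpace ℝ (Fin p)) :=
  ⟨(stdGaussian (EuclideanSpace ℝ (Fin p))).map (fun v => σ • v),
    Measure.isProbabilityMeasure_map (by fun_prop)⟩

lemma charFun_scaledGaussian (p : ℕ) (σ : ℝ) (t : EuclideanSpace ℝ (Fin p)) :
    charFun (scaledGaussian p σ : Measure (EuclideanSpace ℝ (Fin p))) t =
      Complex.exp (-(σ ^ 2 / 2 * ‖t‖ ^ 2 : ℝ)) := by
  change charFun ((stdGaussian (EuclideanSpace ℝ (Fin p))).map (fun v => σ • v)) t = _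
  rw [charFun_map_smul, charFun_stdGaussian, norm_smul, Real.norm_eq_abs]
  congr 1
  rw [← Complex.ofReal_pow, mul_pow, sq_abs]
  push_cast
  ring

lemma scaledGaussian_orthant {p : ℕ} {σ : ℝ} (hσ : 0 < σ) (x : EuclideanSpace ℝ (Fin p)) :
    (scaledGaussian p σ : Measure (EuclideanSpace ℝ (Fin p))).real {v | ∀ j, v j ≤ x j} =
      stdNormalCDF (σ⁻¹ • x) := by
  change ((stdGaussian (EuclideanSpace ℝ (Fin p))).map (fun v => σ • v)).real _ = _
  rw [map_measureReal_apply (by fun_prop) (measurableSet_orthant x), stdNormalCDF, jointCDF]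
  congr 1
  ext v
  refine forall_congr' fun j => ?_
  simp only [PiLp.smul_apply, smul_eq_mul, id]
  rw [← div_eq_inv_mul, le_div_iff₀ hσ, mul_comm]

lemma shiftBy_shiftBy {p : ℕ} (x : EuclideanSpace ℝ (Fin p)) (s t : ℝ) :
    shiftBy (shiftBy x s) t = shiftBy x (s + t) := by
  ext j
  simp [shiftBy, add_assoc]

lemma smul_shiftBy {p : ℕ} (x : EuclideanSpace ℝ (Fin p)) (a t : ℝ) :
    a • shiftBy x t = shiftBy (a • x) (a * t) := by
  ext j
  simp [shiftBy, mul_add]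

lemma thickening_orthant_subset {p : ℕ} (x : EuclideanSpace ℝ (Fin p)) (δ : ℝ) :
    Metric.thickening δ {v : EuclideanSpace ℝ (Fin p) | ∀ j, v j ≤ x j} ⊆
      {v | ∀ j, v j ≤ shiftBy x δ j} := by
  intro v hv j
  obtain ⟨w, hw, hd⟩ := Metric.mem_thickening_iff.1 hv
  have h1 : |v j - w j| ≤ ‖v - w‖ := PiLp.norm_apply_le (v - w) j
  rw [← dist_eq_norm] at h1
  have h2 := (abs_le.1 h1).2
  have h3 := hw j
  change v j ≤ x j + δ
  linarith

/-- Convergence of characteristic functions of `W n` to that of `N(0, σ² I)`, together with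
`V n - W n → 0` in probability, gives uniform convergence of the distribution functions of
`V n`. -/
theorem eventually_forall_abs_jointCDF_sub_le {Ω : Type*} [MeasurableSpace Ω] {p : ℕ} {σ : ℝ}
    (hσ : 0 < σ) {P : ℕ → Measure Ω} [∀ n, IsProbabilityMeasure (P n)]
    {V W : ℕ → Ω → EuclideanSpace ℝ (Fin p)} (hW : ∀ n, Measurable (W n))
    (hchar : ∀ t : EuclideanSpace ℝ (Fin p), Tendsto (fun n => charFun ((P n).map (W n)) t) atTop
      (𝓝 (Complex.exp (-(σ ^ 2 / 2 * ‖t‖ ^ 2 : ℝ)))))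
    (hVW : ∀ δ > 0, Whp P fun n ω => ‖V n ω - W n ω‖ ≤ δ) {ε : ℝ} (hε : 0 < ε) :
    ∀ᶠ n in atTop, ∀ x, |jointCDF (P n) (V n) x - stdNormalCDF (σ⁻¹ • x)| ≤ ε := by
  let μ : ℕ → ProbabilityMeasure (EuclideanSpace ℝ (Fin p)) := fun n =>
    ⟨(P n).map (W n), Measure.isProbabilityMeasure_map (hW n).aemeasurable⟩
  have hμ : Tendsto μ atTop (𝓝 (scaledGaussian p σ)) := by
    refine ProbabilityMeasure.tendsto_of_tendsto_charFun fun t => ?_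
    rw [charFun_scaledGaussian]
    exact hchar t
  have hLP : Tendsto (fun n => LevyProkhorov.ofMeasure (μ n)) atTop
      (𝓝 (LevyProkhorov.ofMeasure (scaledGaussian p σ))) :=
    (LevyProkhorov.continuous_ofMeasure_probabilityMeasure.tendsto _).comp hμ
  -- One `δ` each for the Lévy–Prokhorov distance and the event that V and W differ; both also shift
  -- the orthant by `δ`, which the Lipschitz bound pays for.
  obtain ⟨δ, hδ, hδε⟩ : ∃ δ > 0, 2 * δ + p * (σ⁻¹ * (2 * δ)) ≤ ε := by
    refine ⟨ε / (2 + p * (σ⁻¹ * 2)), by positivity, le_of_eq ?_⟩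
    field_simp
  have hδ' : 0 < ENNReal.ofReal δ := ENNReal.ofReal_pos.2 hδ
  have hev1 : ∀ᶠ n in atTop, levyProkhorovEDist (μ n : Measure (EuclideanSpace ℝ (Fin p)))
      (scaledGaussian p σ : Measure (EuclideanSpace ℝ (Fin p))) < ENNReal.ofReal δ := by
    have := hLP.eventually (Metric.eball_mem_nhds _ hδ')
    filter_upwards [this] with n hn
    exact hn
  have hev2 : ∀ᶠ n in atTop, P n {ω | ¬ ‖V n ω - W n ω‖ ≤ δ} ≤ ENNReal.ofReal δ :=
    (hVW δ hδ).eventually_le_const hδ'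
  filter_upwards [hev1, hev2] with n h1 h2 x
  have hbad : (P n).real {ω | ¬ ‖V n ω - W n ω‖ ≤ δ} ≤ δ := ENNReal.toReal_le_of_le_ofReal hδ.le h2
  have hcdfW : ∀ y : EuclideanSpace ℝ (Fin p), (P n).real {ω | ∀ j, W n ω j ≤ y j} =
      (μ n : Measure (EuclideanSpace ℝ (Fin p))).real {v | ∀ j, v j ≤ y j} := by
    intro y
    change _ = ((P n).map (W n)).real _
    rw [map_measureReal_apply (hW n) (measurableSet_orthant y)]
    rfl
  have hcoord : ∀ {ω}, ‖V n ω - W n ω‖ ≤ δ → ∀ j, |V n ω j - W n ω j| ≤ δ := fun h j =>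
    (PiLp.norm_apply_le (V n _ - W n _) j).trans h
  have hlp1 : ∀ y : EuclideanSpace ℝ (Fin p),
      (μ n : Measure (EuclideanSpace ℝ (Fin p))).real {v | ∀ j, v j ≤ y j} ≤
        stdNormalCDF (σ⁻¹ • shiftBy y δ) + δ := by
    intro y
    have := left_measure_le_of_levyProkhorovEDist_lt h1 (measurableSet_orthant y)
    rw [ENNReal.toReal_ofReal hδ.le] at this
    have h3 := this.trans (add_le_add (measure_mono (thickening_orthant_subset y δ)) le_rfl)
    have h4 := ENNReal.toReal_mono (by finiteness) h3
    rw [ENNReal.toReal_add (by finiteness) (by finiteness), ENNReal.toReal_ofReal hδ.le] at h4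
    rwa [← scaledGaussian_orthant hσ]
  have hlp2 : ∀ y : EuclideanSpace ℝ (Fin p), stdNormalCDF (σ⁻¹ • y) ≤
      (μ n : Measure (EuclideanSpace ℝ (Fin p))).real {v | ∀ j, v j ≤ shiftBy y δ j} + δ := by
    intro y
    have := right_measure_le_of_levyProkhorovEDist_lt h1 (measurableSet_orthant y)
    rw [ENNReal.toReal_ofReal hδ.le] at this
    have h3 := this.trans (add_le_add (measure_mono (thickening_orthant_subset y δ)) le_rfl)
    have h4 := ENNReal.toReal_mono (by finiteness) h3
    rw [ENNReal.toReal_add (by finiteness) (by finiteness), ENNReal.toReal_ofReal hδ.le] at h4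
    rwa [← scaledGaussian_orthant hσ]
  rw [abs_le]
  constructor
  -- `V n` need not be measurable: only inclusions, monotonicity and subadditivity involve it.
  · have hsub : {ω | ∀ j, W n ω j ≤ shiftBy x (-δ) j} ⊆
        {ω | ∀ j, V n ω j ≤ x j} ∪ {ω | ¬ ‖V n ω - W n ω‖ ≤ δ} := by
      intro ω hω
      by_cases hb : ‖V n ω - W n ω‖ ≤ δ
      · refine Or.inl fun j => ?_
        have e1 := (abs_le.1 (hcoord hb j)).2
        have e2 : W n ω j ≤ x j + -δ := hω j
        linarith
      · exact Or.inr hb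
    have h3 := (measureReal_mono (μ := P n) hsub).trans (measureReal_union_le _ _)
    rw [hcdfW] at h3
    have h4 := hlp2 (shiftBy x (-(2 * δ)))
    rw [shiftBy_shiftBy, show -(2 * δ) + δ = -δ by ring] at h4
    have h5 := stdNormalCDF_shiftBy_le (σ⁻¹ • shiftBy x (-(2 * δ)))
      (show 0 ≤ σ⁻¹ * (2 * δ) by positivity)
    rw [← smul_shiftBy, shiftBy_shiftBy, neg_add_cancel] at h5
    have h6 : shiftBy x 0 = x := by ext j; simp [shiftBy]
    rw [h6] at h5
    change _ ≤ (P n).real _ - _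
    linarith
  · have hsub : {ω | ∀ j, V n ω j ≤ x j} ⊆
        {ω | ∀ j, W n ω j ≤ shiftBy x δ j} ∪ {ω | ¬ ‖V n ω - W n ω‖ ≤ δ} := by
      intro ω hω
      by_cases hb : ‖V n ω - W n ω‖ ≤ δ
      · refine Or.inl fun j => ?_
        have e1 := (abs_le.1 (hcoord hb j)).1
        have e2 : V n ω j ≤ x j := hω j
        change W n ω j ≤ x j + δ
        linarith
      · exact Or.inr hb
    have h3 := (measureReal_mono (μ := P n) hsub).trans (measureReal_union_le _ _)
    rw [hcdfW] at h3
    have h4 := hlp1 (shiftBy x δ)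
    rw [shiftBy_shiftBy, smul_shiftBy] at h4
    have h5 := stdNormalCDF_shiftBy_le (σ⁻¹ • x) (show 0 ≤ σ⁻¹ * (δ + δ) by positivity)
    have h6 : σ⁻¹ * (δ + δ) = σ⁻¹ * (2 * δ) := by ring
    rw [h6] at h4 h5
    change (P n).real _ - _ ≤ _
    linarith

end

end SLS

namespace SLS

noncomputable section

/-! ### The random path -/

/-- The lag vectors generated by the innovations `u` from the initial lag vector `z₀`. -/
def state {q : ℕ} (β z₀ : EuclideanSpace ℝ (Fin (q + 1))) (u : ℕ → ℝ) :
    ℕ → EuclideanSpace ℝ (Fin (q + 1))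
  | 0 => z₀
  | k + 1 => step β (state β z₀ u k) (u k)

lemma continuous_step {q : ℕ} (β : EuclideanSpace ℝ (Fin (q + 1))) :
    Continuous fun x : EuclideanSpace ℝ (Fin (q + 1)) × ℝ => step β x.1 x.2 := by
  refine (PiLp.continuous_toLp 2 _).comp (continuous_pi fun i => ?_)
  cases i using Fin.cases with
  | zero => simp only [Fin.cons_zero]; fun_prop
  | succ i => simp only [Fin.cons_succ]; fun_prop

lemma measurable_state {Ω : Type*} {m : MeasurableSpace Ω} {P : Measure Ω} {ν : Measure ℝ}
    {F : Filtration ℕ m} {ξ : ℕ → Ω → ℝ} (h : IsInnovation P ν F ξ) {q : ℕ}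
    (β : EuclideanSpace ℝ (Fin (q + 1))) {Z : Ω → EuclideanSpace ℝ (Fin (q + 1))}
    (hZ : Measurable[F 0] Z) (k : ℕ) :
    Measurable[F k] fun ω => state β (Z ω) (fun i => ξ i ω) k := by
  induction k with
  | zero => exact hZ
  | succ k ih =>
    have hs : Measurable fun x : EuclideanSpace ℝ (Fin (q + 1)) × ℝ => step β x.1 x.2 :=
      (continuous_step β).measurable
    have hpair : Measurable[F (k + 1)] fun ω => (state β (Z ω) (fun i => ξ i ω) k, ξ k ω) :=
      (ih.mono (F.mono k.le_succ) le_rfl).prodMk (h.measurable_succ k)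
    have hcomp := Measurable.comp hs hpair
    simpa only [state, Function.comp_def] using hcomp

lemma measurable_trunc {Ω : Type*} {m : MeasurableSpace Ω} {F : Filtration ℕ m} {q : ℕ}
    {z : Ω → ℕ → EuclideanSpace ℝ (Fin (q + 1))} (hz : ∀ k, Measurable[F k] fun ω => z ω k)
    (c : ℝ) (k : ℕ) : Measurable[F k] fun ω => trunc c (z ω) k := by
  have he : Measurable[F k] fun ω => energy (z ω) k :=
    Finset.measurable_fun_sum _ fun i hi =>
      (measurable_norm.comp
        ((hz i).mono (F.mono (Finset.mem_range.1 hi).le) le_rfl)).pow_const 2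
  have hn : Measurable[F k] fun ω => ‖z ω k‖ ^ 2 := (measurable_norm.comp (hz k)).pow_const 2
  unfold trunc
  refine Measurable.ite ?_ ((measurable_const_smul (√c)⁻¹).comp (hz k)) measurable_const
  exact (he measurableSet_Iio).inter (hn measurableSet_Iic)

/-- The data of the limit theorem: innovations along filtrations, initial states that are
negligible compared with `√(c n)`, parameters in the region that converge within the region. -/
structure Setting {Ω : Type*} {m : MeasurableSpace Ω} {q : ℕ} (P : ℕ → Measure Ω) (ν : Measure ℝ)
    (σ : ℝ) (F : ℕ → Filtration ℕ m) (ξ : ℕ → ℕ → Ω → ℝ)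
    (Z : ℕ → Ω → EuclideanSpace ℝ (Fin (q + 1))) (β : ℕ → EuclideanSpace ℝ (Fin (q + 1)))
    (β₀ : EuclideanSpace ℝ (Fin (q + 1))) (c : ℕ → ℝ) : Prop where
  prob : ∀ n, IsProbabilityMeasure (P n)
  probν : IsProbabilityMeasure ν
  memLp : MemLp id 2 ν
  mean : ∫ y, y ∂ν = 0
  second : ∫ y, y ^ 2 ∂ν = σ ^ 2
  σ_pos : 0 < σ
  innovation : ∀ n, IsInnovation (P n) ν (F n) (ξ n)
  measurable_init : ∀ n, Measurable[F n 0] (Z n)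
  mem_region : ∀ n, β n ∈ region (q + 1)
  lim_mem_region : β₀ ∈ region (q + 1)
  tendsto_β : Tendsto β atTop (𝓝 β₀)
  c_pos : ∀ n, 0 < c n
  tendsto_c : Tendsto c atTop atTop
  init_small : ∀ η > 0, Whp P fun n ω => ‖Z n ω‖ ≤ η * √(c n)

namespace Setting

variable {Ω : Type*} {m : MeasurableSpace Ω} {q : ℕ} {P : ℕ → Measure Ω} {ν : Measure ℝ}
  {σ : ℝ} {F : ℕ → Filtration ℕ m} {ξ : ℕ → ℕ → Ω → ℝ}
  {Z : ℕ → Ω → EuclideanSpace ℝ (Fin (q + 1))} {β : ℕ → EuclideanSpace ℝ (Fin (q + 1))}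
  {β₀ : EuclideanSpace ℝ (Fin (q + 1))} {c : ℕ → ℝ}

lemma integrable_sq (s : Setting P ν σ F ξ Z β β₀ c) : Integrable (fun y : ℝ => y ^ 2) ν :=
  s.memLp.integrable_sq

/-- Within a number of steps of the order of `c`, no innovation is of the order of `√c`. -/
lemma whp_innovation_le (s : Setting P ν σ F ξ Z β β₀ c) {N : ℕ → ℕ} {b : ℝ}
    (hN : ∀ᶠ n in atTop, (N n : ℝ) ≤ b * c n) {η : ℝ} (hη : 0 < η) :
    Whp P fun n ω => ∀ k < N n, |ξ n k ω| ≤ η * √(c n) := by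
  have := s.probν
  have hlim : Tendsto (fun n => η * √(c n)) atTop atTop :=
    (Real.tendsto_sqrt_atTop.comp s.tendsto_c).const_mul_atTop hη
  have h1 := ((tendsto_mul_measure_lt_abs s.integrable_sq).comp hlim).const_mul (b / η ^ 2)
  rw [mul_zero] at h1
  have h2 := ENNReal.tendsto_ofReal h1
  rw [ENNReal.ofReal_zero] at h2
  refine Whp.of_measure_le h2 ?_
  filter_upwards [hN] with n hn
  have h3 : {ω | ¬ ∀ k < N n, |ξ n k ω| ≤ η * √(c n)} =
      {ω | ∃ k < N n, η * √(c n) < |ξ n k ω|} := by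
    ext ω; simp
  rw [h3]
  refine (measure_exists_lt_abs_le (s.innovation n) _ _).trans ?_
  rw [← ENNReal.ofReal_natCast, ← ofReal_measureReal, ← ENNReal.ofReal_mul (by positivity)]
  apply ENNReal.ofReal_le_ofReal
  -- The union bound over O(c) innovations is matched with t²ν(|y| > t) at t = η√c.
  have h4 : b / η ^ 2 * ((η * √(c n)) ^ 2 * ν.real {y | η * √(c n) < |y|}) =
      b * c n * ν.real {y | η * √(c n) < |y|} := by
    rw [mul_pow, Real.sq_sqrt (s.c_pos n).le]
    field_simp
  simp only [Function.comp]
  rw [h4]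
  gcongr

/-- The energy reaches the level `c` within a number of steps of the order of `c`. -/
lemma exists_horizon (s : Setting P ν σ F ξ Z β β₀ c) :
    ∃ N : ℕ → ℕ, (∃ b : ℝ, ∀ᶠ n in atTop, (N n : ℝ) ≤ b * c n) ∧
      Whp P fun n ω => c n ≤ energy (state (β n) (Z n ω) fun i => ξ n i ω) (N n) := by
  have := s.probν
  have := s.prob
  obtain ⟨κ, hκ, ρ, hρ0, hρ1, hρ⟩ := exists_measure_sum_sq_lt_le s.integrable_sq
    (by rw [s.second]; have := s.σ_pos; positivity)
  set B := ‖β₀‖ + 1 with hB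
  -- By `sum_sq_innovation_le`, energy below c after M + 1 states forces Σ ξ² < 2(1 + B²)c = κbc
  -- over M innovations. With M ≥ bc this is below κM, which is exponentially unlikely.
  set b := 2 * (1 + B ^ 2) / κ with hb
  have hb0 : 0 < b := by positivity
  have hβB : ∀ᶠ n in atTop, ‖β n‖ ≤ B :=
    s.tendsto_β.norm.eventually_le_const (by rw [hB]; linarith)
  refine ⟨fun n => ⌈b * c n⌉₊ + 1, ⟨b + 2, ?_⟩, ?_⟩
  · filter_upwards [s.tendsto_c.eventually_ge_atTop 1] with n hn
    have := (Nat.ceil_lt_add_one (mul_nonneg hb0.le (s.c_pos n).le)).le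
    push_cast
    linarith
  · have hM : Tendsto (fun n => ⌈b * c n⌉₊) atTop atTop :=
      tendsto_nat_ceil_atTop.comp (s.tendsto_c.const_mul_atTop hb0)
    have h1 := ENNReal.tendsto_ofReal ((tendsto_pow_atTop_nhds_zero_of_lt_one hρ0 hρ1).comp hM)
    rw [ENNReal.ofReal_zero] at h1
    refine Whp.of_measure_le h1 ?_
    filter_upwards [hβB] with n hn
    refine (measure_mono fun ω hω => ?_).trans (hρ (s.innovation n) _)
    have hω' : energy (state (β n) (Z n ω) fun i => ξ n i ω) (⌈b * c n⌉₊ + 1) < c n := not_le.1 hω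
    have h2 := sum_sq_innovation_le (z := state (β n) (Z n ω) fun i => ξ n i ω)
      (u := fun i => ξ n i ω) (fun k => rfl) ⌈b * c n⌉₊
    refine h2.trans_lt ?_
    calc 2 * (1 + ‖β n‖ ^ 2) * energy (state (β n) (Z n ω) fun i => ξ n i ω) (⌈b * c n⌉₊ + 1)
        < 2 * (1 + ‖β n‖ ^ 2) * c n := by gcongr
      _ ≤ 2 * (1 + B ^ 2) * c n := by have := (s.c_pos n).le; gcongr
      _ = κ * (b * c n) := by rw [hb]; field_simp
      _ ≤ κ * ⌈b * c n⌉₊ := by gcongr; exact Nat.le_ceil _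

/-- Description of the path up to the stopping time, with high probability. -/
lemma whp_isHit (s : Setting P ν σ F ξ Z β β₀ c) {N : ℕ → ℕ} {b : ℝ}
    (hN : ∀ᶠ n in atTop, (N n : ℝ) ≤ b * c n)
    (hE : Whp P fun n ω => c n ≤ energy (state (β n) (Z n ω) fun i => ξ n i ω) (N n))
    {δ : ℝ} (hδ : 0 < δ) :
    Whp P fun n ω => ∃ T, IsHit (c n) (state (β n) (Z n ω) fun i => ξ n i ω) (N n) T ∧
      ‖Z n ω‖ ^ 2 ≤ δ * c n ∧
      (∀ k ≤ T, ‖state (β n) (Z n ω) (fun i => ξ n i ω) k‖ ^ 2 ≤ δ * c n) ∧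
      ‖state (β n) (Z n ω) (fun i => ξ n i ω) (T + 1)‖ ^ 2 ≤ δ * c n := by
  obtain ⟨C, hC, ρ, hρ, hpath⟩ := exists_forall_norm_path_le s.lim_mem_region
  -- The bound 1 keeps truncation inactive. The bound δ/(4C²) pays for one extra step to T + 1,
  -- where the energy is no longer below c.
  set δ₁ := min δ (min 1 (δ / (4 * C ^ 2))) with hδ₁
  have hδ₁0 : 0 < δ₁ := by positivity
  have hδ₁a : δ₁ ≤ δ := min_le_left _ _
  have hδ₁b : δ₁ ≤ 1 := (min_le_right _ _).trans (min_le_left _ _)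
  have hδ₁c : δ₁ ≤ δ / (4 * C ^ 2) := (min_le_right _ _).trans (min_le_right _ _)
  obtain ⟨η₁, hη₁, hsmall⟩ := exists_forall_norm_sq_le q hC hδ₁0
  set η := min η₁ √δ₁ with hη
  have hη0 : 0 < η := lt_min hη₁ (Real.sqrt_pos.2 hδ₁0)
  have hη2 : ∀ {n : ℕ} {x : ℝ}, 0 ≤ x → x ≤ η * √(c n) → x ^ 2 ≤ δ₁ * c n := by
    intro n x hx hxη
    calc x ^ 2 ≤ (√δ₁ * √(c n)) ^ 2 := by
          gcongr
          exact hxη.trans (by gcongr; exact min_le_right _ _)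
      _ = δ₁ * c n := by rw [mul_pow, Real.sq_sqrt hδ₁0.le, Real.sq_sqrt (s.c_pos n).le]
  have hdist : ∀ᶠ n in atTop, dist (β n) β₀ ≤ ρ :=
    (tendsto_iff_dist_tendsto_zero.1 s.tendsto_β).eventually_le_const hρ
  refine (((s.whp_innovation_le hN hη0).and (s.init_small η hη0)).and hE).mono' ?_
  filter_upwards [hdist] with n hn ω ⟨⟨hu, h0⟩, hen⟩
  set z := state (β n) (Z n ω) fun i => ξ n i ω with hz
  have hcn := s.c_pos n
  have hp := hpath (β n) (s.mem_region n) hn z (fun i => ξ n i ω) fun k => rfl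
  have hs := hsmall z (fun i => ξ n i ω) (c n) (N n) hcn hp
    (h0.trans (by gcongr; exact min_le_left _ _))
    (fun k hk => (hu k hk).trans (by gcongr; exact min_le_left _ _))
  obtain ⟨T, hT⟩ := exists_isHit hcn hen fun k hk hek => (hs k hk hek).trans (by nlinarith)
  have hδc : δ₁ * c n ≤ δ * c n := by gcongr
  refine ⟨T, hT, (hη2 (norm_nonneg _) h0).trans hδc, fun k hk =>
    (hs k (hk.trans hT.lt.le) (hT.energy_lt k hk)).trans hδc, ?_⟩
  have h1 := hp T 1
  simp only [Finset.range_one, Finset.sum_singleton, add_zero] at h1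
  have h2 := hs T hT.lt.le (hT.energy_lt T le_rfl)
  have h3 := hη2 (abs_nonneg _) (hu T hT.lt)
  calc ‖z (T + 1)‖ ^ 2 ≤ (C * (‖z T‖ + |ξ n T ω|)) ^ 2 := by gcongr
    _ = C ^ 2 * (‖z T‖ + |ξ n T ω|) ^ 2 := by ring
    _ ≤ C ^ 2 * (2 * (‖z T‖ ^ 2 + |ξ n T ω| ^ 2)) := by gcongr; exact add_sq_le
    _ ≤ C ^ 2 * (2 * (δ₁ * c n + δ₁ * c n)) := by gcongr
    _ = 4 * C ^ 2 * δ₁ * c n := by ring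
    _ ≤ δ * c n := by
      gcongr
      rwa [mul_comm, ← le_div_iff₀ (by positivity)]

lemma measurable_trunc_state (s : Setting P ν σ F ξ Z β β₀ c) (n k : ℕ) :
    Measurable[F n k] fun ω => trunc (c n) (state (β n) (Z n ω) fun i => ξ n i ω) k :=
  measurable_trunc (fun k => measurable_state (s.innovation n) (β n) (s.measurable_init n) k) _ k

/-- The normalised score is bounded in probability. -/
lemma measure_lt_norm_score_le (s : Setting P ν σ F ξ Z β β₀ c) (n N : ℕ) {R : ℝ} (hR : 0 < R) :
    P n {ω | ¬ ‖∑ k ∈ Finset.range N, ξ n k ω •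
      trunc (c n) (state (β n) (Z n ω) fun i => ξ n i ω) k‖ ≤ R} ≤
      ENNReal.ofReal ((q + 1) * (σ ^ 2 * 2) / R ^ 2) := by
  have := s.probν
  have := s.prob
  set y : ℕ → Ω → EuclideanSpace ℝ (Fin (q + 1)) := fun k ω =>
    trunc (c n) (state (β n) (Z n ω) fun i => ξ n i ω) k with hy
  have hyF : ∀ k, Measurable[F n k] (y k) := s.measurable_trunc_state n
  have hcoord : ∀ j : Fin (q + 1), Measurable fun x : EuclideanSpace ℝ (Fin (q + 1)) => x j :=
    fun j => by fun_prop
  have hj := fun j : Fin (q + 1) => (s.innovation n).integral_sum_sq_le s.memLp s.mean s.second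
    (w := fun k ω => y k ω j) (fun k => (hcoord j).comp (hyF k)) (L := 2) (fun M ω => by
      refine le_trans (Finset.sum_le_sum fun k _ => ?_)
        (sum_norm_trunc_sq_le (z := state (β n) (Z n ω) fun i => ξ n i ω) (s.c_pos n) M)
      rw [← sq_abs]
      gcongr
      exact PiLp.norm_apply_le (y k ω) j) N
  have hnorm : ∀ ω, ‖∑ k ∈ Finset.range N, ξ n k ω • y k ω‖ ^ 2 =
      ∑ j, (∑ k ∈ Finset.range N, y k ω j * ξ n k ω) ^ 2 := by
    intro ω
    rw [EuclideanSpace.real_norm_sq_eq]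
    refine Finset.sum_congr rfl fun j _ => ?_
    simp [WithLp.ofLp_sum, Finset.sum_apply, mul_comm]
  have hInt : Integrable (fun ω => ‖∑ k ∈ Finset.range N, ξ n k ω • y k ω‖ ^ 2) (P n) := by
    simp_rw [hnorm]
    exact integrable_finsetSum _ fun j _ => (hj j).1
  have hle : ∫ ω, ‖∑ k ∈ Finset.range N, ξ n k ω • y k ω‖ ^ 2 ∂(P n) ≤ (q + 1) * (σ ^ 2 * 2) := by
    simp_rw [hnorm]
    rw [integral_finsetSum _ fun j _ => (hj j).1]
    refine (Finset.sum_le_sum fun j _ => (hj j).2).trans ?_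
    simp
  have hmark := mul_meas_ge_le_integral_of_nonneg (ae_of_all _ fun ω => sq_nonneg _) hInt (R ^ 2)
  refine ENNReal.le_ofReal_iff_toReal_le (measure_ne_top _ _) (by positivity) |>.2 ?_
  rw [le_div_iff₀ (by positivity), mul_comm]
  refine le_trans ?_ (hmark.trans hle)
  gcongr
  refine measureReal_mono fun ω hω => ?_
  have : R < ‖∑ k ∈ Finset.range N, ξ n k ω • y k ω‖ := not_le.1 hω
  change R ^ 2 ≤ _
  gcongr

/-- The normalised Gram matrix converges in probability. -/
lemma whp_gram_close (s : Setting P ν σ F ξ Z β β₀ c) {N : ℕ → ℕ} {b : ℝ}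
    (hN : ∀ᶠ n in atTop, (N n : ℝ) ≤ b * c n)
    (hE : Whp P fun n ω => c n ≤ energy (state (β n) (Z n ω) fun i => ξ n i ω) (N n))
    {S : Matrix (Fin (q + 1)) (Fin (q + 1)) ℝ}
    (hS : ∀ H, IsStein β₀ H → H.trace = 1 → H = S) {δ : ℝ} (hδ : 0 < δ) :
    Whp P fun n ω => ∀ i j,
      |gram (trunc (c n) (state (β n) (Z n ω) fun i => ξ n i ω)) (N n) i j - S i j| ≤ δ := by
  obtain ⟨η, hη, hclose⟩ := exists_forall_stein_close hS 2 hδ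
  have hdist : ∀ᶠ n in atTop, dist (β n) β₀ ≤ η :=
    (tendsto_iff_dist_tendsto_zero.1 s.tendsto_β).eventually_le_const hη
  -- The score is bounded in probability by its second moment alone, hence negligible against √c.
  have hscore : Whp P fun n ω => ‖∑ k ∈ Finset.range (N n), ξ n k ω •
      trunc (c n) (state (β n) (Z n ω) fun i => ξ n i ω) k‖ ≤ η / 2 * √(c n) := by
    have hlim : Tendsto (fun n => (η / 2 * √(c n)) ^ 2) atTop atTop :=
      (tendsto_pow_atTop two_ne_zero).comp
        ((Real.tendsto_sqrt_atTop.comp s.tendsto_c).const_mul_atTop (by positivity))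
    have h1 := ENNReal.tendsto_ofReal (hlim.const_div_atTop (((q : ℝ) + 1) * (σ ^ 2 * 2)))
    rw [ENNReal.ofReal_zero] at h1
    refine Whp.of_measure_le h1 (Eventually.of_forall fun n => ?_)
    have := Real.sqrt_pos.2 (s.c_pos n)
    exact s.measure_lt_norm_score_le n (N n) (by positivity)
  -- The Yule–Walker error is 2(η/4) + η/2 = η.
  refine ((s.whp_isHit hN hE (show 0 < η / 4 by positivity)).and hscore).mono' ?_
  filter_upwards [hdist] with n hn ω ⟨⟨T, hT, h0, hk, hT1⟩, hsc⟩
  obtain ⟨e1, e2, e3⟩ := hT.stein_approx (u := fun i => ξ n i ω) (fun k => rfl) (s.c_pos n) h0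
    (hk T le_rfl) hT1 (δ' := η / 2) (fun j => by
      refine le_trans ?_ hsc
      refine le_trans (le_of_eq ?_) (PiLp.norm_apply_le _ j)
      rw [Real.norm_eq_abs]
      simp [WithLp.ofLp_sum, Finset.sum_apply])
  refine hclose (β n) _ hn (abs_gram_trunc_le (s.c_pos n) (N n))
    (fun i j => by simp [gram, mul_comm]) (fun i j => (e1 i j).trans (by linarith))
    (fun j => (e2 j).trans (by linarith)) (e3.trans (by linarith))

lemma sum_sq_eq_quad_gram (a : EuclideanSpace ℝ (Fin (q + 1)))
    (y : ℕ → EuclideanSpace ℝ (Fin (q + 1))) (N : ℕ) :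
    ∑ k ∈ Finset.range N, (∑ j, a j * y k j) ^ 2 = quad (gram y N) a := by
  simp only [quad, gram, Matrix.of_apply, Finset.mul_sum, Finset.sum_mul]
  calc ∑ k ∈ Finset.range N, (∑ j, a j * y k j) ^ 2
      = ∑ k ∈ Finset.range N, ∑ i, ∑ j, a i * (y k i * y k j) * a j := by
        refine Finset.sum_congr rfl fun k _ => ?_
        rw [sq, Finset.sum_mul_sum]
        exact Finset.sum_congr rfl fun i _ => Finset.sum_congr rfl fun j _ => by ring
    _ = _ := by
        rw [Finset.sum_comm]
        exact Finset.sum_congr rfl fun i _ => Finset.sum_comm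

/-- Characteristic functions of the score, normalised by the limit of the Gram matrix. -/
lemma tendsto_charFun (s : Setting P ν σ F ξ Z β β₀ c) {N : ℕ → ℕ} {b : ℝ}
    (hN : ∀ᶠ n in atTop, (N n : ℝ) ≤ b * c n)
    (hE : Whp P fun n ω => c n ≤ energy (state (β n) (Z n ω) fun i => ξ n i ω) (N n))
    {S : Matrix (Fin (q + 1)) (Fin (q + 1)) ℝ} (hpd : S.PosDef)
    (hS : ∀ H, IsStein β₀ H → H.trace = 1 → H = S)
    {W : ℕ → Ω → EuclideanSpace ℝ (Fin (q + 1))} (hWm : ∀ n, Measurable (W n))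
    (hW : ∀ n ω, W n ω = WithLp.toLp 2 (Matrix.mulVec (rsqrt S)
      (∑ k ∈ Finset.range (N n), ξ n k ω • trunc (c n)
        (state (β n) (Z n ω) fun i => ξ n i ω) k : EuclideanSpace ℝ (Fin (q + 1)))))
    (t : EuclideanSpace ℝ (Fin (q + 1))) :
    Tendsto (fun n => charFun ((P n).map (W n)) t) atTop
      (𝓝 (Complex.exp (-(σ ^ 2 / 2 * ‖t‖ ^ 2 : ℝ)))) := by
  have := s.probν
  have := s.prob
  set a : EuclideanSpace ℝ (Fin (q + 1)) := WithLp.toLp 2 (Matrix.mulVec (rsqrt S) t) with ha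
  set y : ℕ → ℕ → Ω → EuclideanSpace ℝ (Fin (q + 1)) := fun n k ω =>
    trunc (c n) (state (β n) (Z n ω) fun i => ξ n i ω) k with hy
  set w : ℕ → ℕ → Ω → ℝ := fun n k ω => ∑ j, a j * y n k ω j with hw
  have hwabs : ∀ n k ω, |w n k ω| ≤ ‖a‖ * ‖y n k ω‖ := by
    intro n k ω
    have := abs_real_inner_le_norm a (y n k ω)
    simpa [PiLp.inner_apply, mul_comm, hw] using this
  have hsymm : (rsqrt S).transpose = rsqrt S := by
    rw [← Matrix.conjTranspose_eq_transpose_of_trivial]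
    exact isHermitian_rsqrt S
  have hadj : ∀ x x' : Fin (q + 1) → ℝ, dotProduct (Matrix.mulVec (rsqrt S) x) x' =
      dotProduct x (Matrix.mulVec (rsqrt S) x') := fun x x' => by
    rw [Matrix.dotProduct_mulVec, ← Matrix.mulVec_transpose, hsymm]
  -- With a = S^{-1/2}t, the limiting quadratic variation aᵀSa equals ‖t‖².
  have hqa : quad S a = ‖t‖ ^ 2 := by
    have h1 : quad S a = dotProduct (Matrix.mulVec (rsqrt S) t.ofLp)
        (Matrix.mulVec S (Matrix.mulVec (rsqrt S) t.ofLp)) := by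
      simp [quad, dotProduct, Matrix.mulVec, Finset.mul_sum, mul_assoc, ha]
    rw [h1, hadj, Matrix.mulVec_mulVec, Matrix.mulVec_mulVec, rsqrt_mul_mul_rsqrt hpd,
      Matrix.one_mulVec, EuclideanSpace.real_norm_sq_eq]
    simp [dotProduct, sq]
  have hinner : ∀ n ω, inner ℝ (W n ω) t = ∑ k ∈ Finset.range (N n), w n k ω * ξ n k ω := by
    intro n ω
    set v : EuclideanSpace ℝ (Fin (q + 1)) := ∑ k ∈ Finset.range (N n), ξ n k ω • y n k ω with hv
    have h1 : inner ℝ (W n ω) t = dotProduct (Matrix.mulVec (rsqrt S) v.ofLp) t.ofLp := by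
      rw [hW]
      simp [PiLp.inner_apply, dotProduct, mul_comm, hv, hy]
    have h2 : dotProduct (Matrix.mulVec (rsqrt S) v.ofLp) t.ofLp = ∑ j, v j * a j := by
      rw [hadj]
      rfl
    rw [h1, h2]
    simp only [hv, hw, WithLp.ofLp_sum, Finset.sum_apply, PiLp.smul_apply, smul_eq_mul,
      Finset.sum_mul]
    rw [Finset.sum_comm]
    exact Finset.sum_congr rfl fun k _ => Finset.sum_congr rfl fun j _ => by ring
  have hmain := tendsto_integral_exp_sum s.memLp s.mean s.second s.innovation (w := w)
    (fun n k => Finset.measurable_fun_sum _ fun j _ =>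
      ((by fun_prop : Measurable fun x : EuclideanSpace ℝ (Fin (q + 1)) => a j * x j).comp
        (s.measurable_trunc_state n k))) N (L := ‖a‖ ^ 2 * 2) (v := ‖t‖ ^ 2) ?_ ?_ ?_
  · refine hmain.congr fun n => ?_
    rw [charFun_apply, integral_map (hWm n).aemeasurable (by fun_prop)]
    simp_rw [hinner]
  · intro n M ω
    refine le_trans (Finset.sum_le_sum (g := fun k => ‖a‖ ^ 2 * ‖y n k ω‖ ^ 2) fun k _ => ?_) ?_
    · rw [← sq_abs, ← mul_pow]
      have := hwabs n k ω
      gcongr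
    · rw [← Finset.mul_sum]
      gcongr
      exact sum_norm_trunc_sq_le (s.c_pos n) M
  · intro η hη
    have hδ : 0 < (η / (‖a‖ + 1)) ^ 2 := by positivity
    refine (s.whp_isHit hN hE hδ).mono ?_
    rintro n ω ⟨T, hT, -, hk, -⟩ k -
    refine (hwabs n k ω).trans ?_
    have hyb : ‖y n k ω‖ ≤ η / (‖a‖ + 1) := by
      rcases le_or_gt k T with hkT | hkT
      · refine abs_le_of_sq_le_sq' ?_ (by positivity) |>.2
        simp only [hy]
        rw [hT.trunc_eq k hkT, norm_inv_sqrt_smul_sq (s.c_pos n), div_le_iff₀ (s.c_pos n)]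
        exact hk k hkT
      · simp only [hy]
        rw [hT.trunc_eq_zero k hkT, norm_zero]
        positivity
    calc ‖a‖ * ‖y n k ω‖ ≤ (‖a‖ + 1) * (η / (‖a‖ + 1)) := by gcongr; linarith
      _ = η := by field_simp
  · intro δ hδ
    have hδ' : 0 < δ / ((q + 1) * (‖a‖ ^ 2 + 1)) := by positivity
    refine (s.whp_gram_close hN hE hS hδ').mono fun n ω hg => ?_
    simp only [hw]
    rw [sum_sq_eq_quad_gram a (fun k => y n k ω), ← hqa]
    have h1 : quad (gram (fun k => y n k ω) (N n)) a - quad S a =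
        quad (gram (fun k => y n k ω) (N n) - S) a := by
      simp only [quad, Matrix.sub_apply, ← Finset.sum_sub_distrib]
      exact Finset.sum_congr rfl fun i _ => Finset.sum_congr rfl fun j _ => by ring
    rw [h1]
    refine (abs_quad_le (δ := δ / ((q + 1) * (‖a‖ ^ 2 + 1))) (fun i j => hg i j) a).trans ?_
    calc δ / ((q + 1) * (‖a‖ ^ 2 + 1)) * (q + 1) * ‖a‖ ^ 2
        ≤ δ / ((q + 1) * (‖a‖ ^ 2 + 1)) * (q + 1) * (‖a‖ ^ 2 + 1) := by gcongr; linarith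
      _ = δ := by field_simp

/-- The limit theorem along a sequence of parameters and levels. -/
theorem eventually_abs_jointCDF_sub_le (s : Setting P ν σ F ξ Z β β₀ c)
    {X : ℕ → Ω → ℤ → ℝ} {l : ℕ → Ω → ℤ}
    (hlag : ∀ n, ∀ᵐ ω ∂(P n), ∀ k : ℕ, lagVector (q + 1) (X n ω) (l n ω + k) =
      state (β n) (Z n ω) (fun i => ξ n i ω) k)
    (hX : ∀ n, ∀ᵐ ω ∂(P n), ∀ k : ℕ, X n ω (l n ω + k) =
      ∑ j, β n j * state (β n) (Z n ω) (fun i => ξ n i ω) k j + ξ n k ω)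
    {ε : ℝ} (hε : 0 < ε) :
    ∀ᶠ n in atTop, ∀ x, |jointCDF (P n) (fun ω => normalizedError (β n) (X n ω) (l n ω) (c n)) x -
      stdNormalCDF (σ⁻¹ • x)| ≤ ε := by
  have := s.prob
  obtain ⟨S, hpd, -, -, hS⟩ := exists_stein_of_mem_region s.lim_mem_region
  obtain ⟨N, ⟨b, hN⟩, hE⟩ := s.exists_horizon
  set v : ℕ → Ω → EuclideanSpace ℝ (Fin (q + 1)) := fun n ω =>
    ∑ k ∈ Finset.range (N n), ξ n k ω • trunc (c n)
      (state (β n) (Z n ω) fun i => ξ n i ω) k with hv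
  have hvm : ∀ n, Measurable (v n) := fun n => by
    refine Finset.measurable_fun_sum _ fun k _ => ?_
    exact ((s.innovation n).measurable k).smul
      ((s.measurable_trunc_state n k).mono ((F n).le k) le_rfl)
  set W : ℕ → Ω → EuclideanSpace ℝ (Fin (q + 1)) := fun n ω =>
    WithLp.toLp 2 (Matrix.mulVec (rsqrt S) (v n ω)) with hW
  have hWm : ∀ n, Measurable (W n) := fun n => by
    have hc : Continuous fun x : EuclideanSpace ℝ (Fin (q + 1)) =>
        WithLp.toLp 2 (Matrix.mulVec (rsqrt S) x) := by
      refine (PiLp.continuous_toLp 2 _).comp ?_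
      exact Continuous.matrix_mulVec continuous_const (PiLp.continuous_ofLp 2 _)
    exact hc.measurable.comp (hvm n)
  refine eventually_forall_abs_jointCDF_sub_le s.σ_pos hWm
    (s.tendsto_charFun hN hE hpd hS hWm fun n ω => rfl) ?_ hε
  -- The difference is (H^{-1/2} - S^{-1/2})v, and H is close to S.
  have hclose : ∀ a > 0, Whp P fun n ω =>
      ‖normalizedError (β n) (X n ω) (l n ω) (c n) - W n ω‖ ≤ a * ‖v n ω‖ := by
    intro a ha
    obtain ⟨η, hη, hrs⟩ := exists_forall_rsqrt_close hpd ha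
    refine (((s.whp_isHit hN hE one_pos).and (s.whp_gram_close hN hE hS hη)).and
      ((Whp.of_ae hlag).and (Whp.of_ae hX))).mono ?_
    rintro n ω ⟨⟨⟨T, hT, -⟩, hg⟩, hl, hx⟩
    rw [hT.normalizedError_eq (s.c_pos n) hl hx]
    exact hrs _ (isHermitian_gram _ _) hg (v n ω)
  intro δ hδ
  rw [Whp, ENNReal.tendsto_nhds_zero]
  intro ε' hε'
  have hlim : Tendsto (fun R : ℝ => ENNReal.ofReal (((q : ℝ) + 1) * (σ ^ 2 * 2) / R ^ 2)) atTop
      (𝓝 0) := by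
    have := ENNReal.tendsto_ofReal
      ((tendsto_pow_atTop two_ne_zero).const_div_atTop (((q : ℝ) + 1) * (σ ^ 2 * 2)))
    rwa [ENNReal.ofReal_zero] at this
  have hε2 : 0 < ε' / 2 := ENNReal.half_pos hε'.ne'
  -- ‖v‖ ≤ R up to probability ε'/2 for all n at once, so relative accuracy δ/R gives absolute
  -- accuracy δ.
  obtain ⟨R, hR1, hR2⟩ := ((hlim.eventually_le_const hε2).and (eventually_gt_atTop 0)).exists
  filter_upwards [(hclose (δ / R) (by positivity)).eventually_le_const hε2] with n hn
  calc P n {ω | ¬ ‖normalizedError (β n) (X n ω) (l n ω) (c n) - W n ω‖ ≤ δ}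
      ≤ P n ({ω | ¬ ‖normalizedError (β n) (X n ω) (l n ω) (c n) - W n ω‖ ≤ δ / R * ‖v n ω‖} ∪
          {ω | ¬ ‖v n ω‖ ≤ R}) := by
        refine measure_mono fun ω hω => ?_
        by_contra hcon
        simp only [Set.mem_union, Set.mem_ofPred_eq, not_or, not_not] at hcon
        apply hω
        refine hcon.1.trans ?_
        calc δ / R * ‖v n ω‖ ≤ δ / R * R := by have := hcon.2; gcongr
          _ = δ := by field_simp
    _ ≤ ε' / 2 + ε' / 2 := (measure_union_le _ _).trans
        (add_le_add hn ((s.measure_lt_norm_score_le n (N n) hR2).trans hR1))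
    _ = ε' := ENNReal.add_halves ε'

end Setting

end

end SLS

namespace SLS

noncomputable section

/-! ### The past of the stream -/

/-- The initial state and the innovations before time `k` (the later ones replaced by zero). -/
def past {Ω E : Type*} (Z : Ω → E) (ξ : ℕ → Ω → ℝ) (k : ℕ) (ω : Ω) : (ℕ → ℝ) × E :=
  (fun i => if i < k then ξ i ω else 0, Z ω)

/-- The filtration generated by the initial state and the innovations. -/
def pastFiltration {Ω E : Type*} [m : MeasurableSpace Ω] [MeasurableSpace E] {Z : Ω → E}
    {ξ : ℕ → Ω → ℝ} (hZ : Measurable Z) (hξ : ∀ k, Measurable (ξ k)) : Filtration ℕ m where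
  seq k := MeasurableSpace.comap (past Z ξ k) inferInstance
  mono' := by
    intro j k hjk
    let g : (ℕ → ℝ) × E → (ℕ → ℝ) × E := fun x => (fun i => if i < j then x.1 i else 0, x.2)
    have hg : Measurable g := by
      refine Measurable.prodMk (measurable_pi_lambda _ fun i => ?_) measurable_snd
      split_ifs
      · fun_prop
      · exact measurable_const
    have : past Z ξ j = g ∘ past Z ξ k := by
      funext ω
      refine Prod.ext (funext fun i => ?_) rfl
      simp only [past, g, Function.comp]
      split_ifs with h1 h2
      · rfl
      · omega
      · rfl
    change MeasurableSpace.comap _ _ ≤ MeasurableSpace.comap _ _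
    rw [this, ← MeasurableSpace.comap_comp]
    exact MeasurableSpace.comap_mono hg.comap_le
  le' k := by
    refine Measurable.comap_le (Measurable.prodMk (measurable_pi_lambda _ fun i => ?_) hZ)
    split_ifs
    · exact hξ i
    · exact measurable_const

lemma measurable_pastFiltration_zero {Ω E : Type*} [MeasurableSpace Ω] [MeasurableSpace E]
    {Z : Ω → E} {ξ : ℕ → Ω → ℝ} (hZ : Measurable Z) (hξ : ∀ k, Measurable (ξ k)) :
    Measurable[pastFiltration hZ hξ 0] Z := by
  have h1 : Measurable[pastFiltration hZ hξ 0] (past Z ξ 0) := comap_measurable _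
  exact measurable_snd.comp h1

/-- If `A` and `B` are independent, and `(A, B)` is independent of `C`, then `(B, C)` is
independent of `A`. -/
lemma indepFun_prodMk_of_prodMk {Ω α β γ : Type*} [MeasurableSpace Ω] [MeasurableSpace α]
    [MeasurableSpace β] [MeasurableSpace γ] {P : Measure Ω} [IsProbabilityMeasure P]
    {A : Ω → α} {B : Ω → β} {C : Ω → γ} (hA : Measurable A) (hB : Measurable B) (hC : Measurable C)
    (hAB : IndepFun A B P) (hABC : IndepFun (fun ω => (A ω, B ω)) C P) :
    IndepFun (fun ω => (B ω, C ω)) A P := by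
  have hBC : IndepFun B C P := hABC.comp measurable_snd measurable_id
  refine IndepFun.symm ?_
  rw [indepFun_iff_map_prod_eq_prod_map_map hA.aemeasurable (hB.prodMk hC).aemeasurable]
  rw [indepFun_iff_map_prod_eq_prod_map_map (hA.prodMk hB).aemeasurable hC.aemeasurable,
    (indepFun_iff_map_prod_eq_prod_map_map hA.aemeasurable hB.aemeasurable).1 hAB] at hABC
  rw [(indepFun_iff_map_prod_eq_prod_map_map hB.aemeasurable hC.aemeasurable).1 hBC]
  have hpA : IsProbabilityMeasure (P.map A) := Measure.isProbabilityMeasure_map hA.aemeasurable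
  have hpB : IsProbabilityMeasure (P.map B) := Measure.isProbabilityMeasure_map hB.aemeasurable
  have hpC : IsProbabilityMeasure (P.map C) := Measure.isProbabilityMeasure_map hC.aemeasurable
  rw [← Measure.prodAssoc_prod, ← hABC,
    Measure.map_map MeasurableEquiv.prodAssoc.measurable ((hA.prodMk hB).prodMk hC)]
  rfl

/-- ξ_k is independent of the earlier innovations, and jointly with them independent of the start;
regrouping makes it independent of the whole past. -/
lemma isInnovation_pastFiltration {Ω E : Type*} [MeasurableSpace Ω] [MeasurableSpace E]
    {P : Measure Ω} [IsProbabilityMeasure P] {ν : Measure ℝ} {Z : Ω → E} {ξ : ℕ → Ω → ℝ}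
    (hZ : Measurable Z) (hξ : ∀ k, Measurable (ξ k)) (hlaw : ∀ k, P.map (ξ k) = ν)
    (hi : iIndepFun ξ P) (hind : IndepFun (fun ω k => ξ k ω) Z P) :
    IsInnovation P ν (pastFiltration hZ hξ) ξ where
  measurable_succ k := by
    have h1 : Measurable[pastFiltration hZ hξ (k + 1)] (past Z ξ (k + 1)) :=
      comap_measurable _
    have h2 : Measurable fun x : (ℕ → ℝ) × E => x.1 k := by fun_prop
    have h3 := h2.comp h1
    have h4 : ξ k = (fun x : (ℕ → ℝ) × E => x.1 k) ∘ past Z ξ (k + 1) := by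
      funext ω
      simp [past]
    rw [h4]
    exact h3
  law := hlaw
  indep k := by
    have hB : Measurable fun ω (i : ℕ) => if i < k then ξ i ω else 0 := by
      refine measurable_pi_lambda _ fun i => ?_
      split_ifs
      · exact hξ i
      · exact measurable_const
    have hAB : IndepFun (ξ k) (fun ω (i : ℕ) => if i < k then ξ i ω else 0) P := by
      have h1 := hi.indepFun_finset {k} (Finset.range k) (by simp) hξ
      let f : (({k} : Finset ℕ) → ℝ) → ℝ := fun x => x ⟨k, by simp⟩
      let g : (Finset.range k → ℝ) → ℕ → ℝ := fun x i =>
        if h : i < k then x ⟨i, Finset.mem_range.2 h⟩ else 0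
      have hf : Measurable f := by fun_prop
      have hg : Measurable g := by
        refine measurable_pi_lambda _ fun i => ?_
        by_cases h : i < k
        · simp only [g, h, dif_pos]; fun_prop
        · simp only [g, h, dif_neg, not_false_eq_true]; exact measurable_const
      have e : (fun ω (i : ℕ) => if i < k then ξ i ω else 0) =
          g ∘ fun ω (i : Finset.range k) => ξ i ω := by
        funext ω i
        simp only [g, Function.comp]
        split_ifs <;> rfl
      rw [e]
      exact h1.comp hf hg
    have hABC : IndepFun (fun ω => (ξ k ω, fun (i : ℕ) => if i < k then ξ i ω else 0)) Z P := by
      let f : (ℕ → ℝ) → ℝ × (ℕ → ℝ) := fun x => (x k, fun i => if i < k then x i else 0)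
      have hf : Measurable f := by
        refine Measurable.prodMk (by fun_prop) (measurable_pi_lambda _ fun i => ?_)
        split_ifs
        · fun_prop
        · exact measurable_const
      exact hind.comp hf measurable_id
    exact indepFun_prodMk_of_prodMk (hξ k) hB hZ hAB hABC

/-! ### Autoregressive streams -/

lemma measurable_comp_random_time {Ω : Type*} [MeasurableSpace Ω] {Y : ℤ → Ω → ℝ}
    (hY : ∀ i, Measurable (Y i)) {l : Ω → ℤ} (hl : Measurable l) (i : ℤ) :
    Measurable fun ω => Y (l ω + i) ω := by
  have h1 : Measurable fun x : ℤ × Ω => Y x.1 x.2 := measurable_from_prod_countable_right hY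
  exact h1.comp ((hl.add_const i).prodMk measurable_id)

lemma lagVector_succ {q : ℕ} {x : ℤ → ℝ} {i : ℤ} {β : EuclideanSpace ℝ (Fin (q + 1))} {e : ℝ}
    (h : x i = ∑ j : Fin (q + 1), β j * x (i - 1 - (j : ℤ)) + e) :
    lagVector (q + 1) x (i + 1) = step β (lagVector (q + 1) x i) e := by
  ext j
  cases j using Fin.cases with
  | zero =>
    rw [step_zero]
    simp only [lagVector, Fin.val_zero, Nat.cast_zero, sub_zero, add_sub_cancel_right]
    exact h
  | succ j =>
    rw [step_succ]
    simp only [lagVector, Fin.val_succ, Fin.val_castSucc]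
    congr 1
    push_cast
    ring

namespace IsARStream

variable {Ω : Type*} [MeasurableSpace Ω] {q : ℕ} {P : Measure Ω}
  {β : EuclideanSpace ℝ (Fin (q + 1))} {ν : Measure ℝ} {X ε : ℤ → Ω → ℝ} {l : Ω → ℤ}

lemma measurable_innovation (h : IsARStream P β ν X ε l) (k : ℕ) :
    Measurable fun ω => ε (l ω + k) ω :=
  measurable_comp_random_time h.measurable_ε h.measurable_l k

lemma measurable_init (h : IsARStream P β ν X ε l) :
    Measurable fun ω => lagVector (q + 1) (fun i => X i ω) (l ω) := by
  refine (PiLp.continuous_toLp 2 _).measurable.comp (measurable_pi_lambda _ fun j => ?_)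
  have := measurable_comp_random_time h.measurable_X h.measurable_l (-1 - (j : ℤ))
  convert this using 3
  ring

lemma ae_lagVector_eq (h : IsARStream P β ν X ε l) :
    ∀ᵐ ω ∂P, ∀ k : ℕ, lagVector (q + 1) (fun i => X i ω) (l ω + k) =
      state β (lagVector (q + 1) (fun i => X i ω) (l ω)) (fun i => ε (l ω + i) ω) k := by
  filter_upwards [h.model] with ω hω k
  induction k with
  | zero => simp [state]
  | succ k ih =>
    rw [state, ← ih]
    have := lagVector_succ (x := fun i => X i ω) (hω (l ω + k) (by omega))
    rw [← this]
    push_cast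
    congr 1
    ring

lemma ae_eq (h : IsARStream P β ν X ε l) :
    ∀ᵐ ω ∂P, ∀ k : ℕ, X (l ω + k) ω =
      ∑ j, β j * state β (lagVector (q + 1) (fun i => X i ω) (l ω)) (fun i => ε (l ω + i) ω) k j
        + ε (l ω + k) ω := by
  filter_upwards [h.model, h.ae_lagVector_eq] with ω hω hl k
  rw [← hl k, hω (l ω + k) (by omega)]
  rfl

end IsARStream

end

end SLS

/-! ### Uniformity over the compact set, by passing to sequences -/

theorem mainTheorem2 {Ω : Type*} [MeasurableSpace Ω] (p : ℕ) (hp : 1 ≤ p)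
    (σ : ℝ) (hσ : 0 < σ)
    (ν : Measure ℝ) [IsProbabilityMeasure ν] (hν : MemLp id 2 ν)
    (hmean : ∫ s, s ∂ν = 0) (hvar : variance id ν = σ ^ 2)
    (K : Set (EuclideanSpace ℝ (Fin p))) (hK : IsCompact K) (hKΛ : K ⊆ SLS.region p)
    (P : EuclideanSpace ℝ (Fin p) → Measure Ω) [∀ β, IsProbabilityMeasure (P β)]
    (X ε : EuclideanSpace ℝ (Fin p) → ℤ → Ω → ℝ)
    (l : EuclideanSpace ℝ (Fin p) → Ω → ℤ)
    (hX : ∀ β ∈ K, SLS.IsARStream (P β) β ν (X β) (ε β) (l β))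
    (hstart : IsTightMeasureSet
      ((fun β => (P β).map fun ω => SLS.lagVector p (fun i => X β i ω) (l β ω)) '' K)) :
    Tendsto
      (fun c : ℝ => ⨆ β : K, ⨆ x : EuclideanSpace ℝ (Fin p),
        |SLS.jointCDF (P β)
            (fun ω => SLS.normalizedError (β : EuclideanSpace ℝ (Fin p))
              (fun i => X β i ω) (l β ω) c) x
          - SLS.stdNormalCDF (σ⁻¹ • x)|)
      atTop (𝓝 0) := by
  obtain ⟨q, rfl⟩ : ∃ q, p = q + 1 := ⟨p - 1, by omega⟩
  have hsecond : ∫ y, y ^ 2 ∂ν = σ ^ 2 := by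
    rw [← hvar, variance_of_integral_eq_zero aemeasurable_id (by simpa using hmean)]
    simp
  suffices hmain : ∀ δ > 0, ∀ᶠ c : ℝ in atTop, ∀ β ∈ K, ∀ x : EuclideanSpace ℝ (Fin (q + 1)),
      |SLS.jointCDF (P β) (fun ω => SLS.normalizedError β (fun i => X β i ω) (l β ω) c) x
        - SLS.stdNormalCDF (σ⁻¹ • x)| ≤ δ by
    rw [Metric.tendsto_nhds]
    intro δ hδ
    filter_upwards [hmain (δ / 2) (by positivity)] with c hc
    rw [Real.dist_eq, sub_zero, abs_of_nonneg
      (Real.iSup_nonneg fun β => Real.iSup_nonneg fun x => abs_nonneg _)]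
    refine lt_of_le_of_lt ?_ (half_lt_self hδ)
    -- Nonnegativity of the bound covers an empty `K`, where the supremum is 0 by convention.
    exact Real.iSup_le (fun β => Real.iSup_le (fun x => hc β β.2 x) (by positivity)) (by positivity)
  intro δ hδ
  by_contra hcon
  rw [not_eventually, frequently_atTop] at hcon
  -- A failure yields levels c n ≥ n + 1, positive and tending to infinity, each with a bad
  -- parameter and a bad point.
  choose c hcn hbad using fun n : ℕ => hcon (n + 1)
  push Not at hbad
  choose β hβK x hx using hbad
  obtain ⟨β₀, hβ₀, φ, hφ, hlim⟩ := hK.tendsto_subseq hβK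
  have hc0 : ∀ n, 0 < c n := fun n => lt_of_lt_of_le (by positivity) (hcn n)
  have hctop : Tendsto c atTop atTop := by
    refine tendsto_atTop_mono (fun n => ?_) tendsto_natCast_atTop_atTop
    exact le_trans (by linarith) (hcn n)
  have hAR := fun n => hX (β (φ n)) (hβK (φ n))
  have hsetting : SLS.Setting (fun n => P (β (φ n))) ν σ
      (fun n => SLS.pastFiltration (hAR n).measurable_init (hAR n).measurable_innovation)
      (fun n k ω => ε (β (φ n)) (l (β (φ n)) ω + k) ω)
      (fun n ω => SLS.lagVector (q + 1) (fun i => X (β (φ n)) i ω) (l (β (φ n)) ω))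
      (fun n => β (φ n)) β₀ (fun n => c (φ n)) :=
    { prob := fun n => inferInstance
      probν := inferInstance
      memLp := hν
      mean := hmean
      second := hsecond
      σ_pos := hσ
      innovation := fun n => SLS.isInnovation_pastFiltration _ _ (hAR n).law (hAR n).indep
        (hAR n).indep_start
      measurable_init := fun n => SLS.measurable_pastFiltration_zero _ _
      mem_region := fun n => hKΛ (hβK _)
      lim_mem_region := hKΛ hβ₀
      tendsto_β := hlim
      c_pos := fun n => hc0 _
      tendsto_c := hctop.comp hφ.tendsto_atTop
      -- Tightness of the starting laws over `K`, read at the radii η√c → ∞.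
      init_small := fun η hη => by
        rw [isTightMeasureSet_iff_tendsto_measure_norm_gt] at hstart
        have h1 : Tendsto (fun n => η * √(c (φ n))) atTop atTop :=
          (Real.tendsto_sqrt_atTop.comp (hctop.comp hφ.tendsto_atTop)).const_mul_atTop hη
        refine SLS.Whp.of_measure_le (hstart.comp h1) (Eventually.of_forall fun n => ?_)
        have h2 : MeasurableSet {v : EuclideanSpace ℝ (Fin (q + 1)) | η * √(c (φ n)) < ‖v‖} :=
          measurableSet_lt measurable_const measurable_norm
        refine le_trans (le_of_eq ?_) (le_iSup₂ (f := fun (μ : Measure (EuclideanSpace ℝ (Fin (q + 1))))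
          (_ : μ ∈ _) => μ {v | η * √(c (φ n)) < ‖v‖}) _ ⟨β (φ n), hβK _, rfl⟩)
        simp only
        rw [Measure.map_apply (hAR n).measurable_init h2]
        congr 1
        ext ω
        exact not_le }
  obtain ⟨n, hn⟩ := (hsetting.eventually_abs_jointCDF_sub_le
    (fun n => (hAR n).ae_lagVector_eq) (fun n => (hAR n).ae_eq) hδ).exists
  exact absurd (hn (x (φ n))) (not_le.2 (hx (φ n)))
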